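/- Let $q$ be a fixed prime, $\mathbb F=\mathbb F_q$, let $\epsilon>0$ be a constant, and for each $n$ let $m=m(n)$ be $(1+\epsilon)n$ rounded (up or down) to an integer. For a list $V=(v_1,\dots,v_m)$ of vectors in $\mathbb F^n$ and $M\in \mathrm{GL}_n(\mathbb F)$ let $f_V(M)=\{Mv_1,\dots,Mv_m\}$, regarded as an unordered collection with multiplicities (presented in lexicographic order). In the probabilities below $M$ is uniformly random in $\mathrm{GL}_n(\mathbb F)$, and the entries $v_i$ of $V$ are independent and uniformly random in $\mathbb F^n$, independent of $M$; the randomness of the algorithm is included. Call $f_V$ \emph{polynomially hard to invert} if for every function $t(n)=n^{O(1)}$, $t>0$, and every (uniform) quantum algorithm $A$ running in time $t(n)$, $$\Pr_{V,M}\bigl[A(f_V(M),V)=M\bigr]\le \frac1{t(n)}\qquad\text{for all sufficiently large } n.$$ Call a family of functions $b_n:\mathrm{GL}_n(\mathbb F)\to\mathbb F$ a \emph{polynomially hard-core predicate} for $f_V$ if it is computable in (deterministic) polynomial time and for every function $s(n)=n^{O(1)}$, $s>0$, and every quantum algorithm $A$ with outputs in $\mathbb F$ running in time $s(n)$, $$\Bigl|\Pr_{V,M}\bigl[A(f_V(M),V)=b_n(M)\bigr]-\frac1q\Bigr|\le\frac1{s(n)}\qquad\text{for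 all sufficiently large } n.$$ Theorem. If $f_V$ is polynomially hard to invert, then the trace $\mathrm{tr}:\mathrm{GL}_n(\mathbb F)\to\mathbb F$ is a polynomially hard-core predicate for $f_V$. (For $q=2$ the constant $1/q$ is the usual $1/2$.) -/

import Mathlib

open scoped BigOperators

namespace TraceHC

/-- Values of classical variables: binary trees. A leaf is either `nil` or a
reference to a qubit. -/
inductive Data : Type
  | nil : Data
  | ref : ℕ → Data
  | cons : Data → Data → Data

/-- First component of a pair (`nil` on leaves). -/
def Data.hd : Data → Data
  | .cons a _ => a
  | _ => .nil

/-- Second component of a pair (`nil` on leaves). -/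
def Data.tl : Data → Data
  | .cons _ b => b
  | _ => .nil

/-- The test used by `ite` and `loop`: is the tree a pair? -/
def Data.isPair : Data → Bool
  | .cons _ _ => true
  | _ => false

/-- Programs of a uniform quantum machine model: imperative while-programs over binary trees
as classical control, together with allocation of qubits, the universal gate set
`{H, T, CNOT}`, and measurement in the computational basis. Classical variables are
numbered. -/
inductive Com : Type
  | skip : Com
  | setNil (x : ℕ) : Com
  | copy (x y : ℕ) : Com
  | pair (x y z : ℕ) : Com
  | head (x y : ℕ) : Com
  | tail (x y : ℕ) : Com
  | seq (c d : Com) : Com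
  | ite (x : ℕ) (c d : Com) : Com
  | loop (x : ℕ) (c : Com) : Com
  | newQubit (x : ℕ) : Com
  | gateH (x : ℕ) : Com
  | gateT (x : ℕ) : Com
  | gateCNOT (x y : ℕ) : Com
  | measure (x y : ℕ) : Com

/-- Programs without quantum instructions: the deterministic classical algorithms. -/
def Com.Classical : Com → Prop
  | .seq c d => c.Classical ∧ d.Classical
  | .ite _ c d => c.Classical ∧ d.Classical
  | .loop _ c => c.Classical
  | .newQubit _ => False
  | .gateH _ => False
  | .gateT _ => False
  | .gateCNOT _ _ => False
  | .measure _ _ => False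
  | _ => True

/-- State vectors of a memory of qubits numbered by `ℕ`, all but finitely many of which are
in state `0`: finite superpositions of basis states, where the basis state `S` is the one
in which exactly the qubits in `S` are `1`. Not necessarily normalized. -/
abbrev QState : Type := Finset ℕ →₀ ℂ

/-- Squared norm of a state vector. -/
noncomputable def normSq (ψ : QState) : ℝ := ψ.sum fun _ a => ‖a‖ ^ 2

/-- The Hadamard gate on qubit `k`. -/
noncomputable def hadamard (k : ℕ) : QState →ₗ[ℂ] QState :=
  Finsupp.linearCombination ℂ fun S =>
    Finsupp.single (S.erase k) (((Real.sqrt 2)⁻¹ : ℝ) : ℂ) +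
      Finsupp.single (insert k S)
        ((if k ∈ S then -1 else 1) * (((Real.sqrt 2)⁻¹ : ℝ) : ℂ))

/-- The gate `T = diag (1, exp (i π / 4))` on qubit `k`. -/
noncomputable def phaseT (k : ℕ) : QState →ₗ[ℂ] QState :=
  Finsupp.linearCombination ℂ fun S =>
    Finsupp.single S (if k ∈ S then Complex.exp (Complex.I * Real.pi / 4) else 1)

/-- The controlled-not gate with control `j` and target `k`; no operation if `j = k`. -/
noncomputable def cnot (j k : ℕ) : QState →ₗ[ℂ] QState :=
  Finsupp.linearCombination ℂ fun S =>
    Finsupp.single (if j ∈ S ∧ j ≠ k then symmDiff S {k} else S) (1 : ℂ)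

/-- Unnormalized post-measurement state: projection to qubit `k` being `1` (`b = true`) or
`0` (`b = false`). -/
noncomputable def project (k : ℕ) (b : Bool) (ψ : QState) : QState :=
  ψ.filter fun S => decide (k ∈ S) = b

/-- A configuration: the stack of commands still to be executed, the contents of the
classical variables, the number of the next unused qubit, and the unnormalized state
vector, whose squared norm is the probability of the measurement outcomes so far. -/
structure Conf : Type where
  code : List Com
  store : ℕ → Data
  fresh : ℕ
  psi : QState

/-- Truth values as trees. -/
def encBool : Bool → Data
  | false => .nil
  | true => .cons .nil .nil

/-- One time step. The result lists the successor configurations: none if the machine has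
halted, two for a measurement, one otherwise. Gates and measurements applied to something
that is not a qubit do nothing. -/
noncomputable def step : Conf → List Conf
  | ⟨[], _, _, _⟩ => []
  | ⟨.skip :: K, σ, n, ψ⟩ => [⟨K, σ, n, ψ⟩]
  | ⟨.setNil x :: K, σ, n, ψ⟩ => [⟨K, Function.update σ x .nil, n, ψ⟩]
  | ⟨.copy x y :: K, σ, n, ψ⟩ => [⟨K, Function.update σ x (σ y), n, ψ⟩]
  | ⟨.pair x y z :: K, σ, n, ψ⟩ => [⟨K, Function.update σ x (.cons (σ y) (σ z)), n, ψ⟩]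
  | ⟨.head x y :: K, σ, n, ψ⟩ => [⟨K, Function.update σ x (σ y).hd, n, ψ⟩]
  | ⟨.tail x y :: K, σ, n, ψ⟩ => [⟨K, Function.update σ x (σ y).tl, n, ψ⟩]
  | ⟨.seq c d :: K, σ, n, ψ⟩ => [⟨c :: d :: K, σ, n, ψ⟩]
  | ⟨.ite x c d :: K, σ, n, ψ⟩ => [⟨(if (σ x).isPair then c else d) :: K, σ, n, ψ⟩]
  | ⟨.loop x c :: K, σ, n, ψ⟩ =>
      [⟨if (σ x).isPair then c :: .loop x c :: K else K, σ, n, ψ⟩]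
  | ⟨.newQubit x :: K, σ, n, ψ⟩ => [⟨K, Function.update σ x (.ref n), n + 1, ψ⟩]
  | ⟨.gateH x :: K, σ, n, ψ⟩ =>
      match σ x with
      | .ref k => [⟨K, σ, n, hadamard k ψ⟩]
      | _ => [⟨K, σ, n, ψ⟩]
  | ⟨.gateT x :: K, σ, n, ψ⟩ =>
      match σ x with
      | .ref k => [⟨K, σ, n, phaseT k ψ⟩]
      | _ => [⟨K, σ, n, ψ⟩]
  | ⟨.gateCNOT x y :: K, σ, n, ψ⟩ =>
      match σ x, σ y with
      | .ref j, .ref k => [⟨K, σ, n, cnot j k ψ⟩]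
      | _, _ => [⟨K, σ, n, ψ⟩]
  | ⟨.measure x y :: K, σ, n, ψ⟩ =>
      match σ y with
      | .ref k =>
          [⟨K, Function.update σ x (encBool false), n, project k false ψ⟩,
           ⟨K, Function.update σ x (encBool true), n, project k true ψ⟩]
      | _ => [⟨K, σ, n, ψ⟩]

/-- Every branch of positive probability halts within the given number of steps. -/
def HaltsWithin : ℕ → Conf → Prop
  | 0, c => c.psi = 0 ∨ c.code = []
  | t + 1, c => c.psi = 0 ∨ ∀ c' ∈ step c, HaltsWithin t c'

open Classical in
/-- Probability of halting within the given number of steps with an output, the content of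
variable `0`, in the set `E`. -/
noncomputable def probWithin (E : Set Data) : ℕ → Conf → ℝ
  | 0, c => if c.code = [] ∧ c.store 0 ∈ E then normSq c.psi else 0
  | t + 1, c =>
      if c.code = [] then (if c.store 0 ∈ E then normSq c.psi else 0)
      else ((step c).map (probWithin E t)).sum

/-- The start of program `A` on input `x`: the input is in variable `0`, all other variables
are `nil`, all qubits are `0`. -/
noncomputable def start (A : Com) (x : Data) : Conf :=
  ⟨[A], Function.update (fun _ => Data.nil) 0 x, 0, Finsupp.single ∅ 1⟩

/-- The probability that `A` on input `x` halts with an output in `E`. -/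
noncomputable def prob (A : Com) (x : Data) (E : Set Data) : ℝ :=
  ⨆ t : ℕ, probWithin E t (start A x)

/-- Lists as trees. -/
def encList : List Data → Data
  | [] => .nil
  | a :: l => .cons a (encList l)

/-- Numbers in unary. -/
def encNat (k : ℕ) : Data := encList (List.replicate k .nil)

/-- An element of the field with `q` elements, by its representative in `{0, …, q - 1}`. -/
def encField {q : ℕ} (a : ZMod q) : Data := encNat a.val

/-- Vectors as lists of their entries. -/
def encVec {q n : ℕ} (v : Fin n → ZMod q) : Data := encList (List.ofFn fun i => encField (v i))

/-- Matrices as lists of their rows. -/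
def encMat {q n : ℕ} (M : Matrix (Fin n) (Fin n) (ZMod q)) : Data :=
  encList (List.ofFn fun i => encVec (M i))

/-- The length of a tree as a list. -/
def Data.len : Data → ℕ
  | .cons _ b => b.len + 1
  | _ => 0

/-- Every output can be read as an element of the field with `q` elements, so that a predictor
always predicts something; this is a left inverse of `encField`. -/
def readField (q : ℕ) (d : Data) : ZMod q := (d.len : ZMod q)

/-- `f_V (M)`: the unordered collection of the vectors `M v`, for `v` in the list `V`. -/
def fV {q n m : ℕ} (V : Fin m → Fin n → ZMod q) (M : GL (Fin n) (ZMod q)) :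
    Multiset (Fin n → ZMod q) :=
  Finset.univ.val.map fun i => (M : Matrix (Fin n) (Fin n) (ZMod q)).mulVec (V i)

/-- An unordered collection of vectors, written down as the list of its members (with
multiplicities) in lexicographic order. -/
def encColl {q n : ℕ} (W : Multiset (Fin n → ZMod q)) : Data :=
  encList (((W.map fun w => List.ofFn fun i => (w i).val).sort (· ≤ ·)).map
    fun l => encList (l.map encNat))

/-- The input `(f_V (M), V)` as a tree. -/
def instanceOf {q n m : ℕ} (V : Fin m → Fin n → ZMod q) (M : GL (Fin n) (ZMod q)) : Data :=
  .cons (encColl (fV V M)) (encList (List.ofFn fun i => encVec (V i)))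

/-- `A` runs in time `t n` on the inputs `(f_V (M), V)` of dimension `n`, where `V` has `m n`
members. -/
def RunsInTime (q : ℕ) (m : ℕ → ℕ) (A : Com) (t : ℕ → ℝ) : Prop :=
  ∀ n : ℕ, 1 ≤ n → ∀ (V : Fin (m n) → Fin n → ZMod q) (M : GL (Fin n) (ZMod q)),
    HaltsWithin ⌊t n⌋₊ (start A (instanceOf V M))

/-- `Pr [A (f_V (M), V) = M]` for uniformly random `V` and `M`, and the randomness of `A`. -/
noncomputable def invertProb (q : ℕ) [Fact q.Prime] (m : ℕ → ℕ) (A : Com) (n : ℕ) : ℝ :=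
  𝔼 p : (Fin (m n) → Fin n → ZMod q) × GL (Fin n) (ZMod q),
    prob A (instanceOf p.1 p.2) {encMat (p.2 : Matrix (Fin n) (Fin n) (ZMod q))}

/-- `Pr [A (f_V (M), V) = b (M)]` for uniformly random `V` and `M`, and the randomness
of `A`. -/
noncomputable def predictProb (q : ℕ) [Fact q.Prime] (m : ℕ → ℕ)
    (b : ∀ n : ℕ, GL (Fin n) (ZMod q) → ZMod q) (A : Com) (n : ℕ) : ℝ :=
  𝔼 p : (Fin (m n) → Fin n → ZMod q) × GL (Fin n) (ZMod q),
    prob A (instanceOf p.1 p.2) {d | readField q d = b n p.2}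

/-- `t n = n ^ O(1)`. -/
def IsPoly (t : ℕ → ℝ) : Prop :=
  (∀ n : ℕ, 1 ≤ n → 0 < t n) ∧ ∃ c : ℕ, t =O[Filter.atTop] fun n : ℕ => (n : ℝ) ^ c

/-- `f_V` is `t n`-hard to invert. -/
def IsHard (q : ℕ) [Fact q.Prime] (m : ℕ → ℕ) (t : ℕ → ℝ) : Prop :=
  ∀ A : Com, RunsInTime q m A t → ∀ᶠ n in Filter.atTop, invertProb q m A n ≤ 1 / t n

/-- The family `b` is computed by a deterministic classical polynomial-time algorithm. -/
def PolyTimeComputable (q : ℕ) (b : ∀ n : ℕ, GL (Fin n) (ZMod q) → ZMod q) : Prop :=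
  ∃ B : Com, B.Classical ∧ ∃ t : ℕ → ℝ, IsPoly t ∧
    ∀ n : ℕ, 1 ≤ n → ∀ M : GL (Fin n) (ZMod q),
      HaltsWithin ⌊t n⌋₊ (start B (encMat (M : Matrix (Fin n) (Fin n) (ZMod q)))) ∧
      prob B (encMat (M : Matrix (Fin n) (Fin n) (ZMod q))) {encField (b n M)} = 1

/-- The family `b`, with values in the field with `q` elements, is an `s n`-hard-core predicate
for `f_V`: it is computable in polynomial time, but quantum algorithms running in time `s n`
predict it no better and no worse than a uniformly random guess, up to `1 / s n`. -/
def IsHardCore (q : ℕ) [Fact q.Prime] (m : ℕ → ℕ)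
    (b : ∀ n : ℕ, GL (Fin n) (ZMod q) → ZMod q) (s : ℕ → ℝ) : Prop :=
  PolyTimeComputable q b ∧
    ∀ A : Com, RunsInTime q m A s →
      ∀ᶠ n in Filter.atTop, |predictProb q m b A n - 1 / (q : ℝ)| ≤ 1 / s n

end TraceHC

namespace TraceHC

/-! ### Squared norms and the gates -/

/-! The theorem is a Goldreich–Levin argument over the field with `q` elements, applied to the
linear functional `R ↦ tr (M R)` on matrices. For invertible `R` the collection of the vectors `M v`
is also the collection of the vectors `(M R)(R⁻¹ v)`. Hence from an instance for `M` one can write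
down an instance for `M R` without knowing `M` (`query_eq`), and for fixed `R` the map `(V, M) ↦
(R⁻¹ V, M R)` is a bijection (`expect_pullBack`). A predictor for the trace is thus a noisy oracle
for `tr (M R)` at random invertible `R`, and the entries of `M` are values of this functional up to
sign (`negTrace_rowMatrix`).

Suppose that the predictor deviates from `1/q` by more than `1/s`. Adding a suitable constant `u` to
its output makes it right with probability at least `1/q + δ` for some `δ` of order `1/s`
(`exists_shift`). Call an instance good if the average over `R` of the success probability on its
queries is at least `1/q + δ/2`. On a good instance the inverter takes `k + 1` random matrices,
guesses the value of `-tr (M R)` on each, and forms `q ^ k` combinations on which correct guesses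
extend by linearity (`ex_listD_ge`); all guesses are right with probability `q ^ -(k + 1)`, which is
inverse polynomial.

To find `x₀ = -tr (M U)`, the predictor is queried at `R + y U` for all listed `R` and all scalars
`y`, and each answer votes for the candidates consistent with it. Relative to a correct answer, a
wrong candidate `x` corresponds to the error `y (x₀ - x)`, which runs once through all scalars as
`y` does. So the expected lead of `x₀` over `x` per listed matrix is `q` times the probability of a
correct answer minus the total mass of answers, whatever the distribution of the errors
(`ex_lineD_gain`). It is positive as soon as the predictor beats `1/q`. Singular matrices are not
queried; invertible ones have density at least `1/4` (`expect_isUnit_ge`). The listed matrices are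
pairwise independent (`ex_lineD_sq`), so Chebyshev's inequality and a union bound over candidates
and entries give `M` with probability at least one half once `q ^ k` is a large enough polynomial
(`ex_lineD_entryD`, `ex_invertD_ge`). Only fair coins are available, so random scalars are uniform
up to an exponentially small loss (`covers_scalarD`).

The rest of the work shows that this inverter is a program of the machine model running in
polynomial time. Small expression languages `Ex` and `RX` are compiled to programs with a verified
distribution of results and time bound (`Ex.runs_compile`, `RX.runs_compile`). A quantum predictor
is called as a subroutine on fresh qubits, the state of the older qubits being an untouched tensor
factor (`Sim.val`, `runs_callProg`). Linear systems are solved by elimination (`solveList_eq`). The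
parameters are chosen in `eventually_shift_lt`. -/

theorem normSq_eq_sum (ψ : QState) (s : Finset (Finset ℕ)) (h : ψ.support ⊆ s) :
    normSq ψ = ∑ S ∈ s, ‖ψ S‖ ^ 2 := by
  unfold normSq
  exact Finsupp.sum_of_support_subset _ h _ (by simp)

theorem normSq_nonneg (ψ : QState) : 0 ≤ normSq ψ :=
  Finset.sum_nonneg fun _ _ => by positivity

@[simp] theorem normSq_zero : normSq 0 = 0 := by simp [normSq]

theorem normSq_single (S : Finset ℕ) (a : ℂ) : normSq (Finsupp.single S a) = ‖a‖ ^ 2 := by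
  simp [normSq]

theorem hadamard_apply (k : ℕ) (ψ : QState) (S : Finset ℕ) :
    hadamard k ψ S = (((Real.sqrt 2)⁻¹ : ℝ) : ℂ) *
      (if k ∈ S then ψ (S.erase k) - ψ S else ψ S + ψ (insert k S)) := by
  induction ψ using Finsupp.induction_linear with
  | zero => simp
  | add f g hf hg =>
    rw [map_add, Finsupp.add_apply, hf, hg]
    split_ifs <;> simp only [Finsupp.add_apply] <;> ring
  | single R a =>
    simp only [hadamard, Finsupp.linearCombination_single, Finsupp.smul_apply, Finsupp.add_apply,
      Finsupp.single_apply, smul_eq_mul]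
    by_cases hS : k ∈ S
    · have h1 : R.erase k ≠ S := fun h => by rw [← h] at hS; simp at hS
      simp only [hS, if_true, h1, if_false, zero_add]
      by_cases hR : k ∈ R
      · have h2 : insert k R = R := Finset.insert_eq_of_mem hR
        have h3 : R ≠ S.erase k := fun h => by rw [h] at hR; simp at hR
        simp only [h2, hR, if_true, h3, if_false]
        split_ifs <;> ring
      · have h2 : insert k R = S ↔ R = S.erase k := by
          constructor
          · rintro rfl; simp [hR]
          · rintro rfl; simp [hS]
        have h3 : R ≠ S := fun h => hR (h ▸ hS)
        simp only [h2, hR, if_false, h3]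
        split_ifs <;> ring
    · have h1 : insert k R ≠ S := fun h => by rw [← h] at hS; simp at hS
      simp only [hS, if_false, h1, add_zero]
      by_cases hR : k ∈ R
      · have h2 : R ≠ S := fun h => hS (h ▸ hR)
        have h3 : R.erase k = S ↔ R = insert k S := by
          constructor
          · rintro rfl; simp [hR]
          · rintro rfl; simp [hS]
        simp only [h2, if_false, h3]
        split_ifs <;> ring
      · have h2 : R.erase k = R := Finset.erase_eq_of_notMem hR
        have h3 : R ≠ insert k S := fun h => by rw [h] at hR; simp at hR
        simp only [h2, h3, if_false]
        split_ifs <;> ring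

theorem normSq_hadamard (k : ℕ) (ψ : QState) : normSq (hadamard k ψ) = normSq ψ := by
  -- All subsets of one finite set containing `k` are summed over, so that basis states come in
  -- pairs `S`, `insert k S`. On each pair the gate acts as a two-by-two block, and the
  -- parallelogram law shows that the block is an isometry.
  set Y : Finset ℕ := (ψ.support ∪ (hadamard k ψ).support).sup id with hY
  have hsub : ∀ S ∈ ψ.support ∪ (hadamard k ψ).support, S ∈ (insert k (Y.erase k)).powerset := by
    intro S hS
    rw [Finset.mem_powerset]
    intro x hx
    have : x ∈ Y := by
      have h1 : id S ≤ Y := Finset.le_sup hS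
      exact h1 hx
    by_cases hxk : x = k
    · simp [hxk]
    · simp [hxk, this]
  rw [normSq_eq_sum ψ _ (fun S hS => hsub S (Finset.mem_union_left _ hS)),
    normSq_eq_sum (hadamard k ψ) _ (fun S hS => hsub S (Finset.mem_union_right _ hS)),
    Finset.sum_powerset_insert (Finset.notMem_erase k Y),
    Finset.sum_powerset_insert (Finset.notMem_erase k Y), ← Finset.sum_add_distrib,
    ← Finset.sum_add_distrib]
  refine Finset.sum_congr rfl fun S hS => ?_
  have hk : k ∉ S := fun h => Finset.notMem_erase k Y (Finset.mem_powerset.1 hS h)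
  rw [hadamard_apply, hadamard_apply]
  simp only [hk, if_false, Finset.mem_insert_self, if_true, Finset.erase_insert hk, norm_mul,
    mul_pow]
  have h2 : ‖(((Real.sqrt 2)⁻¹ : ℝ) : ℂ)‖ ^ 2 = 1 / 2 := by
    rw [Complex.norm_real, Real.norm_eq_abs, sq_abs, inv_pow, Real.sq_sqrt (by norm_num)]
    norm_num
  rw [h2]
  have := parallelogram_law_with_norm ℝ (ψ S) (ψ (insert k S))
  nlinarith [this]

theorem phaseT_apply (k : ℕ) (ψ : QState) (S : Finset ℕ) :
    phaseT k ψ S = (if k ∈ S then Complex.exp (Complex.I * Real.pi / 4) else 1) * ψ S := by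
  induction ψ using Finsupp.induction_linear with
  | zero => simp
  | add f g hf hg => rw [map_add, Finsupp.add_apply, hf, hg, Finsupp.add_apply]; ring
  | single R a =>
    simp only [phaseT, Finsupp.linearCombination_single, Finsupp.smul_apply,
      Finsupp.single_apply, smul_eq_mul]
    by_cases h : R = S
    · subst h; simp [mul_comm]
    · simp [h]

theorem normSq_phaseT (k : ℕ) (ψ : QState) : normSq (phaseT k ψ) = normSq ψ := by
  have hs : (phaseT k ψ).support ⊆ ψ.support := by
    intro S hS
    rw [Finsupp.mem_support_iff, phaseT_apply] at hS
    rw [Finsupp.mem_support_iff]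
    exact right_ne_zero_of_mul hS
  rw [normSq_eq_sum ψ _ subset_rfl, normSq_eq_sum _ _ hs]
  refine Finset.sum_congr rfl fun S _ => ?_
  rw [phaseT_apply, norm_mul]
  have : ‖(if k ∈ S then Complex.exp (Complex.I * Real.pi / 4) else 1 : ℂ)‖ = 1 := by
    split_ifs
    · rw [Complex.norm_exp]; simp
    · simp
  rw [this, one_mul]

/-- The permutation of basis states underlying `cnot`. -/
def cnotMap (j k : ℕ) (S : Finset ℕ) : Finset ℕ :=
  if j ∈ S ∧ j ≠ k then symmDiff S {k} else S

theorem cnotMap_involutive (j k : ℕ) : Function.Involutive (cnotMap j k) := by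
  intro S
  unfold cnotMap
  by_cases h : j ∈ S ∧ j ≠ k
  · have : j ∈ symmDiff S {k} := by simp [Finset.mem_symmDiff, h.1, h.2]
    rw [if_pos h, if_pos ⟨this, h.2⟩]
    simp
  · rw [if_neg h, if_neg h]

theorem cnot_eq (j k : ℕ) (ψ : QState) : cnot j k ψ = ψ.mapDomain (cnotMap j k) := by
  simp only [cnot, Finsupp.linearCombination_apply, Finsupp.mapDomain, Finsupp.smul_single,
    smul_eq_mul, mul_one]
  rfl

theorem normSq_cnot (j k : ℕ) (ψ : QState) : normSq (cnot j k ψ) = normSq ψ := by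
  rw [cnot_eq, normSq, Finsupp.sum_mapDomain_index_inj (cnotMap_involutive j k).injective]
  rfl

theorem normSq_project (k : ℕ) (ψ : QState) :
    normSq (project k false ψ) + normSq (project k true ψ) = normSq ψ := by
  have h : ∀ b, (project k b ψ).support ⊆ ψ.support := fun b => by
    unfold project
    exact Finset.filter_subset _ _
  rw [normSq_eq_sum ψ _ subset_rfl, normSq_eq_sum _ _ (h false), normSq_eq_sum _ _ (h true),
    ← Finset.sum_add_distrib]
  refine Finset.sum_congr rfl fun S _ => ?_
  simp only [project, Finsupp.filter_apply]
  by_cases hk : k ∈ S <;> simp [hk]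

@[simp] theorem project_zero (k : ℕ) (b : Bool) : project k b 0 = 0 :=
  Finsupp.filter_zero _

/-! ### Halting and output probabilities -/

theorem step_eq_nil {c : Conf} (h : c.code = []) : step c = [] := by
  obtain ⟨code, σ, n, ψ⟩ := c
  subst h
  rfl

theorem HaltsWithin.succ {t : ℕ} : ∀ {c : Conf}, HaltsWithin t c → HaltsWithin (t + 1) c := by
  induction t with
  | zero =>
    intro c h
    rcases h with h | h
    · exact Or.inl h
    · refine Or.inr ?_
      simp [step_eq_nil h]
  | succ t ih =>
    intro c h
    rcases h with h | h
    · exact Or.inl h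
    · exact Or.inr fun c' hc' => ih (h c' hc')

theorem HaltsWithin.mono {t t' : ℕ} {c : Conf} (h : HaltsWithin t c) (htt : t ≤ t') :
    HaltsWithin t' c := by
  induction htt with
  | refl => exact h
  | step _ ih => exact ih.succ

theorem haltsWithin_of_psi {t : ℕ} {c : Conf} (h : c.psi = 0) : HaltsWithin t c := by
  cases t <;> exact Or.inl h

theorem step_psi_zero {c : Conf} (h : c.psi = 0) : ∀ c' ∈ step c, c'.psi = 0 := by
  obtain ⟨code, σ, n, ψ⟩ := c
  simp only at h
  subst h
  rcases code with _ | ⟨a, K⟩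
  · simp [step]
  · cases a <;> simp [step] <;> (try split) <;> simp

/-- Conservation of probability: gates are isometries and a measurement splits the state into two
orthogonal parts. -/
theorem normSq_step (c : Conf) (h : c.code ≠ []) :
    ((step c).map fun c' => normSq c'.psi).sum = normSq c.psi := by
  obtain ⟨code, σ, n, ψ⟩ := c
  rcases code with _ | ⟨a, K⟩
  · simp at h
  · cases a <;> simp [step] <;> (try split) <;>
      simp [normSq_hadamard, normSq_phaseT, normSq_cnot, normSq_project]

theorem probWithin_of_code {E : Set Data} {t : ℕ} {c : Conf} (h : c.code = []) :
    probWithin E t c = probWithin E 0 c := by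
  classical
  cases t with
  | zero => rfl
  | succ t =>
    simp only [probWithin, h]
    by_cases hE : c.store 0 ∈ E <;> simp [hE]

theorem probWithin_of_psi {E : Set Data} {t : ℕ} :
    ∀ {c : Conf}, c.psi = 0 → probWithin E t c = 0 := by
  induction t with
  | zero => intro c h; simp [probWithin, h]
  | succ t ih =>
    intro c h
    simp only [probWithin, h]
    split_ifs
    · simp
    · simp
    · apply List.sum_eq_zero
      intro x hx
      obtain ⟨c', hc', rfl⟩ := List.mem_map.1 hx
      exact ih (step_psi_zero h c' hc')

theorem probWithin_nonneg {E : Set Data} {t : ℕ} : ∀ c : Conf, 0 ≤ probWithin E t c := by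
  induction t with
  | zero =>
    intro c
    simp only [probWithin]
    split_ifs
    · exact normSq_nonneg _
    · exact le_rfl
  | succ t ih =>
    intro c
    simp only [probWithin]
    split_ifs
    · exact normSq_nonneg _
    · exact le_rfl
    · apply List.sum_nonneg
      intro x hx
      obtain ⟨c', hc', rfl⟩ := List.mem_map.1 hx
      exact ih c'

theorem probWithin_succ_of_ne {E : Set Data} {t : ℕ} {c : Conf} (h : c.code ≠ []) :
    probWithin E (t + 1) c = ((step c).map (probWithin E t)).sum := by
  simp [probWithin, h]

theorem probWithin_le_succ {E : Set Data} {t : ℕ} :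
    ∀ c : Conf, probWithin E t c ≤ probWithin E (t + 1) c := by
  induction t with
  | zero =>
    intro c
    by_cases h : c.code = []
    · exact (probWithin_of_code (t := 0 + 1) h).ge
    · have : probWithin E 0 c = 0 := by simp [probWithin, h]
      rw [this]
      exact probWithin_nonneg c
  | succ t ih =>
    intro c
    by_cases h : c.code = []
    · exact ((probWithin_of_code h).trans (probWithin_of_code (t := t + 1 + 1) h).symm).le
    · rw [probWithin_succ_of_ne h, probWithin_succ_of_ne h]
      refine List.sum_le_sum ?_
      intro c' _
      exact ih c'

theorem probWithin_mono {E : Set Data} (c : Conf) : Monotone fun t : ℕ => probWithin E t c :=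
  monotone_nat_of_le_succ fun t => probWithin_le_succ (t := t) c

/-- A branch still running at time `t` has amplitude zero and contributes nothing later. This turns
the supremum in `prob` into the value at a single time. -/
theorem probWithin_const {E : Set Data} {t : ℕ} :
    ∀ {c : Conf}, HaltsWithin t c → ∀ t', t ≤ t' → probWithin E t' c = probWithin E t c := by
  induction t with
  | zero =>
    intro c h t' _
    rcases h with h | h
    · rw [probWithin_of_psi h, probWithin_of_psi h]
    · exact probWithin_of_code h
  | succ t ih =>
    intro c h t' ht'
    by_cases hc : c.code = []
    · rw [probWithin_of_code hc, probWithin_of_code (t := t + 1) hc]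
    rcases h with h | h
    · rw [probWithin_of_psi h, probWithin_of_psi h]
    · obtain ⟨s, rfl⟩ : ∃ s, t' = s + 1 := ⟨t' - 1, by omega⟩
      rw [probWithin_succ_of_ne hc, probWithin_succ_of_ne hc]
      congr 1
      refine List.map_congr_left fun c' hc' => ?_
      exact ih (h c' hc') s (by omega)

theorem prob_eq_of_haltsWithin {A : Com} {x : Data} {E : Set Data} {t : ℕ}
    (h : HaltsWithin t (start A x)) : prob A x E = probWithin E t (start A x) := by
  unfold prob
  apply le_antisymm
  · refine ciSup_le fun s => ?_
    rcases le_total s t with hs | hs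
    · exact probWithin_mono _ hs
    · exact (probWithin_const h s hs).le
  · refine le_ciSup (f := fun t => probWithin E t (start A x)) ⟨probWithin E t (start A x), ?_⟩ t
    rintro _ ⟨s, rfl⟩
    rcases le_total s t with hs | hs
    · exact probWithin_mono _ hs
    · exact (probWithin_const h s hs).le

theorem prob_nonneg (A : Com) (x : Data) (E : Set Data) : 0 ≤ prob A x E :=
  Real.iSup_nonneg fun _ => probWithin_nonneg _

/-- All branches of positive weight have halted, so the fibres of a finite reading `g` of the output
share the whole norm. For the predictor this says that its answers have total probability one. -/
theorem sum_probWithin_fiber {α : Type*} [Fintype α] (g : Data → α) {t : ℕ} :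
    ∀ {c : Conf}, HaltsWithin t c → ∑ a, probWithin {x | g x = a} t c = normSq c.psi := by
  classical
  have base : ∀ c : Conf, c.code = [] →
      ∑ a, probWithin {x | g x = a} 0 c = normSq c.psi := by
    intro c h
    simp only [probWithin, h, true_and, Set.mem_ofPred_eq]
    simp
  induction t with
  | zero =>
    intro c h
    rcases h with h | h
    · simp [probWithin_of_psi h, h]
    · exact base c h
  | succ t ih =>
    intro c h
    by_cases hc : c.code = []
    · simp only [probWithin_of_code (t := t + 1) hc]
      exact base c hc
    rcases h with h | h
    · simp [probWithin_of_psi h, h]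
    · simp only [probWithin_succ_of_ne hc]
      rw [← normSq_step c hc]
      clear hc
      revert h
      induction step c with
      | nil => simp
      | cons a l ihl =>
        intro h
        simp only [List.map_cons, List.sum_cons, Finset.sum_add_distrib]
        rw [ih (h a (by simp)), ihl fun c' hc' => h c' (by simp [hc'])]

/-! ### Time and output probability from a configuration -/

/-- From `c` the machine halts within `T` steps, with output in `E` with probability `v`. -/
def Val (E : Set Data) (T : ℕ) (c : Conf) (v : ℝ) : Prop :=
  HaltsWithin T c ∧ ∀ t, T ≤ t → probWithin E t c = v

theorem Val.mono {E : Set Data} {T T' : ℕ} {c : Conf} {v : ℝ} (h : Val E T c v) (hT : T ≤ T') :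
    Val E T' c v :=
  ⟨h.1.mono hT, fun t ht => h.2 t (hT.trans ht)⟩

theorem Val.of_eq {E : Set Data} {T : ℕ} {c : Conf} {v v' : ℝ} (h : Val E T c v) (e : v = v') :
    Val E T c v' := e ▸ h

theorem Val.of_psi {E : Set Data} {T : ℕ} {c : Conf} (h : c.psi = 0) : Val E T c 0 :=
  ⟨haltsWithin_of_psi h, fun _ _ => probWithin_of_psi h⟩

theorem Val.step_one {E : Set Data} {T : ℕ} {c c' : Conf} {v : ℝ} (hs : step c = [c'])
    (h : Val E T c' v) : Val E (T + 1) c v := by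
  have hc : c.code ≠ [] := fun hc => by simp [step_eq_nil hc] at hs
  refine ⟨Or.inr fun d hd => ?_, fun t ht => ?_⟩
  · rw [hs, List.mem_singleton] at hd
    rw [hd]
    exact h.1
  · obtain ⟨s, rfl⟩ : ∃ s, t = s + 1 := ⟨t - 1, by omega⟩
    rw [probWithin_succ_of_ne hc, hs]
    simpa using h.2 s (by omega)

theorem Val.step_two {E : Set Data} {T : ℕ} {c c₁ c₂ : Conf} {v₁ v₂ : ℝ}
    (hs : step c = [c₁, c₂]) (h₁ : Val E T c₁ v₁) (h₂ : Val E T c₂ v₂) :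
    Val E (T + 1) c (v₁ + v₂) := by
  have hc : c.code ≠ [] := fun hc => by simp [step_eq_nil hc] at hs
  refine ⟨Or.inr fun d hd => ?_, fun t ht => ?_⟩
  · rw [hs] at hd
    simp only [List.mem_cons, List.not_mem_nil, or_false] at hd
    rcases hd with rfl | rfl
    · exact h₁.1
    · exact h₂.1
  · obtain ⟨s, rfl⟩ : ∃ s, t = s + 1 := ⟨t - 1, by omega⟩
    rw [probWithin_succ_of_ne hc, hs]
    simp [h₁.2 s (by omega), h₂.2 s (by omega)]

theorem Val.halted {E : Set Data} {T : ℕ} {σ : ℕ → Data} {n : ℕ} {ψ : QState} [Decidable (σ 0 ∈ E)] :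
    Val E T ⟨[], σ, n, ψ⟩ (normSq ψ * if σ 0 ∈ E then 1 else 0) := by
  refine ⟨HaltsWithin.mono (t := 0) (Or.inr rfl) (Nat.zero_le _), fun t _ => ?_⟩
  rw [probWithin_of_code rfl]
  by_cases h : σ 0 ∈ E <;> simp [probWithin, h]

theorem Val.prob {E : Set Data} {T : ℕ} {A : Com} {x : Data} {v : ℝ}
    (h : Val E T (start A x) v) : prob A x E = v := by
  rw [prob_eq_of_haltsWithin h.1, h.2 T le_rfl]


open scoped NNReal

/-! ### Finite distributions -/

/-- Finitely supported (sub)distributions, as lists of weighted values. -/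
def Distr (α : Type*) : Type _ := List (α × ℝ≥0)

namespace Distr

variable {α β γ : Type*}

/-- The expectation of `F`. -/
def ex (μ : Distr α) (F : α → ℝ) : ℝ :=
  (List.map (fun p : α × ℝ≥0 => (p.2 : ℝ) * F p.1) μ).sum

/-- `x` is one of the listed values. -/
def Supp (μ : Distr α) (x : α) : Prop := ∃ p : α × ℝ≥0, List.Mem p μ ∧ p.1 = x

/-- The point distribution. -/
def pure (x : α) : Distr α := ([(x, 1)] : List (α × ℝ≥0))

/-- Sequential composition of random experiments. -/
def bind (μ : Distr α) (k : α → Distr β) : Distr β :=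
  List.flatMap (fun p : α × ℝ≥0 =>
    List.map (fun r : β × ℝ≥0 => ((r.1, p.2 * r.2) : β × ℝ≥0)) (k p.1)) μ

@[simp] theorem ex_pure (x : α) (F : α → ℝ) : ex (pure x) F = F x := by
  simp [ex, pure]

@[simp] theorem supp_pure (x y : α) : Supp (pure x) y ↔ y = x := by
  constructor
  · rintro ⟨p, hp, rfl⟩
    have : p ∈ [(x, (1 : ℝ≥0))] := hp
    simp only [List.mem_singleton] at this
    rw [this]
  · rintro rfl
    exact ⟨(y, 1), List.mem_singleton.2 rfl, rfl⟩

theorem ex_bind (μ : Distr α) (k : α → Distr β) (F : β → ℝ) :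
    ex (bind μ k) F = ex μ fun x => ex (k x) F := by
  unfold Distr at μ
  induction μ with
  | nil => rfl
  | cons p μ ih =>
    have h : ∀ l : List (β × ℝ≥0),
        (List.map (fun q : β × ℝ≥0 => (q.2 : ℝ) * F q.1)
          (List.map (fun r : β × ℝ≥0 => ((r.1, p.2 * r.2) : β × ℝ≥0)) l)).sum =
          (p.2 : ℝ) * (List.map (fun q : β × ℝ≥0 => (q.2 : ℝ) * F q.1) l).sum := by
      intro l
      induction l with
      | nil => simp
      | cons r l ihl =>
        simp only [List.map_cons, List.sum_cons, ihl, NNReal.coe_mul]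
        ring
    unfold ex bind at *
    simp only [List.flatMap_cons, List.map_append, List.sum_append, ih, List.map_cons,
      List.sum_cons]
    rw [h (k p.1)]

theorem supp_bind (μ : Distr α) (k : α → Distr β) (y : β) :
    Supp (bind μ k) y ↔ ∃ x, Supp μ x ∧ Supp (k x) y := by
  constructor
  · rintro ⟨p, hp, rfl⟩
    obtain ⟨a, ha, hp⟩ := List.mem_flatMap.1 hp
    obtain ⟨r, hr, rfl⟩ := List.mem_map.1 hp
    exact ⟨a.1, ⟨a, ha, rfl⟩, ⟨r, hr, rfl⟩⟩
  · rintro ⟨x, ⟨p, hp, rfl⟩, ⟨r, hr, rfl⟩⟩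
    exact ⟨(r.1, p.2 * r.2), List.mem_flatMap.2 ⟨p, hp, List.mem_map.2 ⟨r, hr, rfl⟩⟩, rfl⟩

theorem ex_mono {μ : Distr α} {F G : α → ℝ} (h : ∀ x, Supp μ x → F x ≤ G x) : ex μ F ≤ ex μ G := by
  refine List.sum_le_sum ?_
  intro p hp
  exact mul_le_mul_of_nonneg_left (h p.1 ⟨p, hp, rfl⟩) p.2.2

theorem ex_congr {μ : Distr α} {F G : α → ℝ} (h : ∀ x, Supp μ x → F x = G x) : ex μ F = ex μ G :=
  le_antisymm (ex_mono fun x hx => (h x hx).le) (ex_mono fun x hx => (h x hx).ge)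

theorem ex_add (μ : Distr α) (F G : α → ℝ) : ex μ (fun x => F x + G x) = ex μ F + ex μ G := by
  simp only [ex, mul_add]
  exact List.sum_map_add

theorem ex_mul_left (μ : Distr α) (c : ℝ) (F : α → ℝ) : ex μ (fun x => c * F x) = c * ex μ F := by
  refine Eq.trans (congrArg List.sum ?_)
    (List.sum_map_mul_left μ (fun p : α × ℝ≥0 => (p.2 : ℝ) * F p.1) c)
  exact List.map_congr_left fun p _ => by ring

theorem ex_sub (μ : Distr α) (F G : α → ℝ) : ex μ (fun x => F x - G x) = ex μ F - ex μ G := by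
  have h : (fun x => F x - G x) = fun x => F x + (-1) * G x := by funext x; ring
  rw [h, ex_add, ex_mul_left]
  ring

@[simp] theorem ex_zero (μ : Distr α) : ex μ (fun _ => 0) = 0 := by
  have := ex_mul_left μ 0 fun _ => (0 : ℝ)
  simpa using this

theorem ex_nonneg {μ : Distr α} {F : α → ℝ} (h : ∀ x, Supp μ x → 0 ≤ F x) : 0 ≤ ex μ F := by
  rw [← ex_zero μ]
  exact ex_mono h

@[simp] theorem pure_bind (x : α) (k : α → Distr β) : bind (pure x) k = k x := by
  have : List.map (fun r : β × ℝ≥0 => ((r.1, 1 * r.2) : β × ℝ≥0)) (k x) = k x := by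
    simp only [one_mul]
    exact List.map_id _
  simp only [bind, pure, List.flatMap_cons, List.flatMap_nil, List.append_nil]
  exact this

/-- The distribution on a finite type with the given weights, mapped by `f`. -/
noncomputable def ofWeights [Fintype α] (w : α → ℝ≥0) (f : α → β) : Distr β :=
  (Finset.univ : Finset α).toList.map fun a => (f a, w a)

theorem ex_ofWeights [Fintype α] (w : α → ℝ≥0) (f : α → β) (F : β → ℝ) :
    ex (ofWeights w f) F = ∑ a, (w a : ℝ) * F (f a) := by
  simp only [ex, ofWeights, List.map_map]
  rw [← Finset.sum_map_toList]
  rfl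

theorem supp_ofWeights [Fintype α] (w : α → ℝ≥0) (f : α → β) (y : β) :
    Supp (ofWeights w f) y ↔ ∃ a, f a = y := by
  constructor
  · rintro ⟨p, hp, rfl⟩
    obtain ⟨a, _, rfl⟩ := List.mem_map.1 hp
    exact ⟨a, rfl⟩
  · rintro ⟨a, rfl⟩
    exact ⟨(f a, w a), List.mem_map.2 ⟨a, by simp, rfl⟩, rfl⟩

end Distr

open Distr

/-! ### Program families and their behaviour -/

/-- All qubits that may be `1` have numbers below `n`. -/
def QState.Below (n : ℕ) (ψ : QState) : Prop := ∀ S ∈ ψ.support, ∀ k ∈ S, k < n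

/-- On every base `b`, the program `p b` replaces the content `d` of variable `b` by a random
value with distribution `μ`, within `T` steps, without changing variables below `b`. -/
def Runs (p : ℕ → Com) (d : Data) (T : ℕ) (μ : Distr Data) : Prop :=
  ∀ (b : ℕ) (σ : ℕ → Data) (K : List Com) (n : ℕ) (ψ : QState) (E : Set Data) (T' : ℕ)
    (F : Data → ℝ), σ b = d → QState.Below n ψ →
    (∀ x, Supp μ x → ∀ σ' n' ψ', QState.Below n' ψ' → σ' b = x → (∀ i < b, σ' i = σ i) →
      Val E T' ⟨K, σ', n', ψ'⟩ (normSq ψ' * F x)) →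
    Val E (T + T') ⟨p b :: K, σ, n, ψ⟩ (normSq ψ * ex μ F)

theorem Runs.mono {p : ℕ → Com} {d : Data} {T T₁ : ℕ} {μ : Distr Data} (h : Runs p d T μ)
    (hT : T ≤ T₁) : Runs p d T₁ μ := fun b σ K n ψ E T' F hb hψ hl =>
  (h b σ K n ψ E T' F hb hψ hl).mono (by omega)

theorem runs_skip (d : Data) : Runs (fun _ => .skip) d 1 (pure d) := by
  intro b σ K n ψ E T' F hb hψ hl
  rw [ex_pure]
  refine Val.mono (T := T' + 1) ?_ (by omega)
  exact Val.step_one rfl (hl d (by simp) _ _ _ hψ hb fun _ _ => rfl)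

theorem runs_setNil (d : Data) : Runs (fun b => .setNil b) d 1 (pure .nil) := by
  intro b σ K n ψ E T' F hb hψ hl
  rw [ex_pure]
  refine Val.mono (T := T' + 1) ?_ (by omega)
  exact Val.step_one rfl (hl _ (by simp) _ _ _ hψ (by simp) fun i hi => by simp [hi.ne])

theorem runs_head (d : Data) : Runs (fun b => .head b b) d 1 (pure d.hd) := by
  intro b σ K n ψ E T' F hb hψ hl
  rw [ex_pure]
  refine Val.mono (T := T' + 1) ?_ (by omega)
  exact Val.step_one rfl (hl _ (by simp) _ _ _ hψ (by simp [hb]) fun i hi => by simp [hi.ne])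

theorem runs_tail (d : Data) : Runs (fun b => .tail b b) d 1 (pure d.tl) := by
  intro b σ K n ψ E T' F hb hψ hl
  rw [ex_pure]
  refine Val.mono (T := T' + 1) ?_ (by omega)
  exact Val.step_one rfl (hl _ (by simp) _ _ _ hψ (by simp [hb]) fun i hi => by simp [hi.ne])

/-- The continuation form of `Runs` makes composition immediate: what remains after `p` is `r`
followed by the old continuation. The qubits left behind may be in any state, since the
continuation's value depends on that state only through its squared norm. -/
theorem Runs.seq {p r : ℕ → Com} {d : Data} {T₁ T₂ : ℕ} {μ : Distr Data} {k : Data → Distr Data}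
    (hp : Runs p d T₁ μ) (hr : ∀ x, Supp μ x → Runs r x T₂ (k x)) :
    Runs (fun b => .seq (p b) (r b)) d (T₁ + T₂ + 1) (bind μ k) := by
  intro b σ K n ψ E T' F hb hψ hl
  rw [ex_bind]
  refine Val.mono (T := T₁ + (T₂ + T') + 1) ?_ (by omega)
  refine Val.step_one rfl ?_
  refine hp b σ _ n ψ E _ _ hb hψ fun x hx σ' n' ψ' hψ' hb' hσ' => ?_
  refine hr x hx b σ' K n' ψ' E T' F hb' hψ' fun y hy σ'' n'' ψ'' hψ'' hb'' hσ'' => ?_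
  exact hl y ((supp_bind _ _ _).2 ⟨x, hx, hy⟩) σ'' n'' ψ'' hψ'' hb'' fun i hi => by
    rw [hσ'' i hi, hσ' i hi]

/-- Bind the result of `p` and continue with `r`. -/
def letProg (p r : ℕ → Com) : ℕ → Com := fun b =>
  .seq (.copy (b + 1) b) (.seq (p (b + 1)) (.seq (.pair b (b + 1) b) (r b)))

theorem Runs.letProg {p r : ℕ → Com} {d : Data} {T₁ T₂ : ℕ} {μ : Distr Data}
    {k : Data → Distr Data} (hp : Runs p d T₁ μ)
    (hr : ∀ x, Supp μ x → Runs r (.cons x d) T₂ (k x)) :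
    Runs (letProg p r) d (T₁ + T₂ + 5) (bind μ k) := by
  intro b σ K n ψ E T' F hb hψ hl
  rw [ex_bind]
  refine Val.mono (T := T₁ + (T₂ + T' + 1 + 1) + 1 + 1 + 1) ?_ (by omega)
  refine Val.step_one rfl (Val.step_one rfl (Val.step_one rfl ?_))
  refine hp (b + 1) _ _ n ψ E _ _ (by simp [hb]) hψ fun x hx σ' n' ψ' hψ' hb' hσ' => ?_
  refine Val.step_one rfl (Val.step_one rfl ?_)
  -- The environment survives in `b` because `p`, working from base `b + 1`, leaves lower variables
  -- alone.
  have hbb : σ' b = d := by rw [hσ' b (by omega)]; simp [hb]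
  refine hr x hx b _ K n' ψ' E T' F (by simp [hb', hbb]) hψ'
    fun y hy σ'' n'' ψ'' hψ'' hb'' hσ'' => ?_
  refine hl y ((supp_bind _ _ _).2 ⟨x, hx, hy⟩) σ'' n'' ψ'' hψ'' hb'' fun i hi => ?_
  rw [hσ'' i hi, Function.update_of_ne hi.ne, hσ' i (by omega),
    Function.update_of_ne (by omega)]

/-- The pair of the results of `p` and `r`. -/
def consProg (p r : ℕ → Com) : ℕ → Com := fun b =>
  .seq (.copy (b + 1) b) (.seq (p (b + 1)) (.seq (.copy (b + 2) b)
    (.seq (r (b + 2)) (.pair b (b + 1) (b + 2)))))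

theorem Runs.consProg {p r : ℕ → Com} {d x y : Data} {T₁ T₂ : ℕ} (hp : Runs p d T₁ (pure x))
    (hr : Runs r d T₂ (pure y)) :
    Runs (consProg p r) d (T₁ + T₂ + 7) (pure (.cons x y)) := by
  intro b σ K n ψ E T' F hb hψ hl
  rw [ex_pure]
  refine Val.mono (T := T₁ + (T₂ + (T' + 1) + 1 + 1 + 1) + 1 + 1 + 1) ?_ (by omega)
  refine Val.step_one rfl (Val.step_one rfl (Val.step_one rfl ?_))
  rw [← ex_pure x fun _ => F (.cons x y)]
  refine hp (b + 1) _ _ n ψ E _ _ (by simp [hb]) hψ fun x' hx σ' n' ψ' hψ' hb' hσ' => ?_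
  rw [supp_pure] at hx
  subst hx
  have hbb : σ' b = d := by rw [hσ' b (by omega)]; simp [hb]
  refine Val.step_one rfl (Val.step_one rfl (Val.step_one rfl ?_))
  rw [← ex_pure y fun _ => F (.cons x' y)]
  refine hr (b + 2) _ _ n' ψ' E _ _ (by simp [hbb]) hψ' fun y' hy σ'' n'' ψ'' hψ'' hb'' hσ'' => ?_
  rw [supp_pure] at hy
  subst hy
  refine Val.step_one rfl ?_
  have h1 : σ'' (b + 1) = x' := by
    rw [hσ'' (b + 1) (by omega), Function.update_of_ne (by omega), hb']
  refine hl _ (by simp) _ _ _ hψ'' (by simp [h1, hb'']) fun i hi => ?_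
  rw [Function.update_of_ne hi.ne, hσ'' i (by omega), Function.update_of_ne (by omega),
    hσ' i (by omega), Function.update_of_ne (by omega)]

/-- Branch on the result of `c`. -/
def iteProg (c p r : ℕ → Com) : ℕ → Com := fun b =>
  .seq (.copy (b + 1) b) (.seq (c (b + 1)) (.ite (b + 1) (p b) (r b)))

theorem Runs.iteProg {c p r : ℕ → Com} {d x : Data} {T₁ T₂ : ℕ} {μ : Distr Data}
    (hc : Runs c d T₁ (pure x)) (hp : x.isPair = true → Runs p d T₂ μ)
    (hr : x.isPair = false → Runs r d T₂ μ) :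
    Runs (iteProg c p r) d (T₁ + T₂ + 5) μ := by
  intro b σ K n ψ E T' F hb hψ hl
  refine Val.mono (T := T₁ + (T₂ + T' + 1) + 1 + 1 + 1) ?_ (by omega)
  refine Val.step_one rfl (Val.step_one rfl (Val.step_one rfl ?_))
  rw [← ex_pure x fun _ => ex μ F]
  refine hc (b + 1) _ _ n ψ E _ _ (by simp [hb]) hψ fun x' hx σ' n' ψ' hψ' hb' hσ' => ?_
  rw [supp_pure] at hx
  subst hx
  have hbb : σ' b = d := by rw [hσ' b (by omega)]; simp [hb]
  refine Val.step_one rfl ?_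
  have key : ∀ r' : ℕ → Com, Runs r' d T₂ μ →
      Val E (T₂ + T') ⟨r' b :: K, σ', n', ψ'⟩ (normSq ψ' * ex μ F) := by
    intro r' hr'
    refine hr' b σ' K n' ψ' E T' F hbb hψ' fun y hy σ'' n'' ψ'' hψ'' hb'' hσ'' => ?_
    refine hl y hy σ'' n'' ψ'' hψ'' hb'' fun i hi => ?_
    rw [hσ'' i hi, hσ' i (by omega), Function.update_of_ne (by omega)]
  rw [hb']
  cases hx' : x'.isPair
  · exact key r (hr hx')
  · exact key p (hp hx')

/-- Random left fold over the members of a list. -/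
def foldDist (k : Data → Data → Distr Data) : Data → Data → Distr Data
  | .cons x l, acc => bind (k x acc) (foldDist k l)
  | .nil, acc => pure acc
  | .ref _, acc => pure acc

/-- `P` holds at every call of the step function of `foldDist`. -/
def FoldAll (k : Data → Data → Distr Data) (P : Data → Data → Prop) : Data → Data → Prop
  | .cons x l, acc => P x acc ∧ ∀ acc', Supp (k x acc) acc' → FoldAll k P l acc'
  | .nil, _ => True
  | .ref _, _ => True

/-- Fold over the list computed by `l`, starting with the result of `a`; the step function is
given a member of the list, the accumulator and the environment. -/
def foldProg (f l a : ℕ → Com) : ℕ → Com := fun b =>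
  .seq (.copy (b + 1) b) (.seq (l (b + 1)) (.seq (.copy (b + 2) b) (.seq (a (b + 2))
    (.seq (.loop (b + 1)
      (.seq (.head (b + 3) (b + 1)) (.seq (.pair (b + 4) (b + 2) b)
        (.seq (.pair (b + 3) (b + 3) (b + 4)) (.seq (.tail (b + 1) (b + 1))
          (.seq (f (b + 3)) (.copy (b + 2) (b + 3))))))))
      (.copy b (b + 2))))))

/-- Layout: `b` holds the environment, `b + 1` the rest of the list, `b + 2` the accumulator, and
`f` works from `b + 3` on. The summand `12` covers the loop test, sequencing and copying in each
round; the final `1` is the failing test. -/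
theorem val_loop {f : ℕ → Com} {d : Data} {T : ℕ} {k : Data → Data → Distr Data}
    {b : ℕ} {E : Set Data} {T' : ℕ} {F : Data → ℝ} {K : List Com} {σ₀ : ℕ → Data} (l : Data) :
    ∀ (acc : Data) (σ : ℕ → Data) (n : ℕ) (ψ : QState),
    FoldAll k (fun x acc => Runs f (.cons x (.cons acc d)) T (k x acc)) l acc →
    σ b = d → σ (b + 1) = l → σ (b + 2) = acc → (∀ i < b, σ i = σ₀ i) → QState.Below n ψ →
    (∀ x, Supp (foldDist k l acc) x → ∀ σ' n' ψ', QState.Below n' ψ' → σ' (b + 2) = x →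
      (∀ i < b, σ' i = σ₀ i) → Val E T' ⟨K, σ', n', ψ'⟩ (normSq ψ' * F x)) →
    Val E (l.len * (T + 12) + 1 + T')
      ⟨.loop (b + 1)
      (.seq (.head (b + 3) (b + 1)) (.seq (.pair (b + 4) (b + 2) b)
        (.seq (.pair (b + 3) (b + 3) (b + 4)) (.seq (.tail (b + 1) (b + 1))
          (.seq (f (b + 3)) (.copy (b + 2) (b + 3))))))) :: K, σ, n, ψ⟩
      (normSq ψ * ex (foldDist k l acc) F) := by
  have done : ∀ (l acc : Data) (σ : ℕ → Data) (n : ℕ) (ψ : QState), l.isPair = false →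
      foldDist k l acc = pure acc →
      σ b = d → σ (b + 1) = l → σ (b + 2) = acc → (∀ i < b, σ i = σ₀ i) → QState.Below n ψ →
      (∀ x, Supp (foldDist k l acc) x → ∀ σ' n' ψ', QState.Below n' ψ' → σ' (b + 2) = x →
        (∀ i < b, σ' i = σ₀ i) → Val E T' ⟨K, σ', n', ψ'⟩ (normSq ψ' * F x)) →
      Val E (l.len * (T + 12) + 1 + T')
      ⟨.loop (b + 1)
      (.seq (.head (b + 3) (b + 1)) (.seq (.pair (b + 4) (b + 2) b)
        (.seq (.pair (b + 3) (b + 3) (b + 4)) (.seq (.tail (b + 1) (b + 1))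
          (.seq (f (b + 3)) (.copy (b + 2) (b + 3))))))) :: K, σ, n, ψ⟩
      (normSq ψ * ex (foldDist k l acc) F) := by
    intro l acc σ n ψ hl hfd hb h1 h2 hσ hψ hcont
    refine Val.mono (T := T' + 1) ?_ (by omega)
    refine Val.step_one rfl ?_
    rw [h1, hl, hfd, ex_pure]
    exact hcont acc (by simp [hfd]) σ n ψ hψ h2 hσ
  induction l with
  | nil => intro acc σ n ψ _; exact done _ acc σ n ψ rfl rfl
  | ref j => intro acc σ n ψ _; exact done _ acc σ n ψ rfl rfl
  | cons x l _ ih =>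
    intro acc σ n ψ hall hb h1 h2 hσ hψ hcont
    obtain ⟨hstep, hall⟩ := hall
    refine Val.mono (T := T + (l.len * (T + 12) + 1 + T' + 1) + 1 + 1 + 1 + 1 + 1 + 1 + 1 + 1 + 1
      + 1) ?_ (by simp only [Data.len, add_mul]; omega)
    refine Val.step_one rfl ?_
    have hp : (σ (b + 1)).isPair = true := by rw [h1]; rfl
    rw [hp]
    refine Val.step_one rfl (Val.step_one rfl (Val.step_one rfl (Val.step_one rfl
      (Val.step_one rfl (Val.step_one rfl (Val.step_one rfl (Val.step_one rfl
      (Val.step_one rfl ?_))))))))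
    simp only [foldDist, ex_bind]
    refine hstep (b + 3) _ _ n ψ E _ _ ?_ hψ ?_
    · simp [h1, h2, hb, Data.hd]
    · intro acc' hacc' σ' n' ψ' hψ' hb' hσ'
      refine Val.step_one rfl ?_
      refine ih acc' _ n' ψ' (hall acc' hacc') ?_ ?_ ?_ ?_ hψ' ?_
      · rw [Function.update_of_ne (by omega), hσ' b (by omega)]
        simp [hb]
      · rw [Function.update_of_ne (by omega), hσ' (b + 1) (by omega)]
        simp [h1, Data.tl]
      · simp [hb']
      · intro i hi
        rw [Function.update_of_ne (by omega), hσ' i (by omega),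
          Function.update_of_ne (by omega), Function.update_of_ne (by omega),
          Function.update_of_ne (by omega), Function.update_of_ne (by omega), hσ i hi]
      · intro y hy
        exact hcont y ((supp_bind _ _ _).2 ⟨acc', hacc', hy⟩)

theorem Runs.foldProg {f l a : ℕ → Com} {d xl xa : Data} {T T₁ T₂ : ℕ}
    {k : Data → Data → Distr Data} (hl : Runs l d T₁ (pure xl)) (ha : Runs a d T₂ (pure xa))
    (hf : FoldAll k (fun x acc => Runs f (.cons x (.cons acc d)) T (k x acc)) xl xa) :
    Runs (foldProg f l a) d (T₁ + T₂ + xl.len * (T + 12) + 9) (foldDist k xl xa) := by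
  intro b σ K n ψ E T' F hb hψ hcont
  refine Val.mono (T := T₁ + (T₂ + (xl.len * (T + 12) + 1 + (T' + 1) + 1) + 1 + 1 + 1)
    + 1 + 1 + 1) ?_ (by omega)
  refine Val.step_one rfl (Val.step_one rfl (Val.step_one rfl ?_))
  rw [← ex_pure xl fun _ => ex (foldDist k xl xa) F]
  refine hl (b + 1) _ _ n ψ E _ _ (by simp [hb]) hψ fun x hx σ' n' ψ' hψ' hb' hσ' => ?_
  rw [supp_pure] at hx
  subst hx
  have hbb : σ' b = d := by rw [hσ' b (by omega)]; simp [hb]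
  refine Val.step_one rfl (Val.step_one rfl (Val.step_one rfl ?_))
  rw [← ex_pure xa fun y => ex (foldDist k x xa) F]
  refine ha (b + 2) _ _ n' ψ' E _ _ (by simp [hbb]) hψ' fun y hy σ'' n'' ψ'' hψ'' hb'' hσ'' => ?_
  rw [supp_pure] at hy
  subst hy
  refine Val.step_one rfl ?_
  refine val_loop (σ₀ := σ) x y σ'' n'' ψ'' hf ?_ ?_ hb'' ?_ hψ'' ?_
  · rw [hσ'' b (by omega), Function.update_of_ne (by omega), hbb]
  · rw [hσ'' (b + 1) (by omega), Function.update_of_ne (by omega), hb']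
  · intro i hi
    rw [hσ'' i (by omega), Function.update_of_ne (by omega), hσ' i (by omega),
      Function.update_of_ne (by omega)]
  · intro z hz σ₃ n₃ ψ₃ hψ₃ h₃ hσ₃
    refine Val.step_one rfl ?_
    refine hcont z hz _ _ _ hψ₃ (by simp [h₃]) fun i hi => ?_
    rw [Function.update_of_ne hi.ne, hσ₃ i hi]


open scoped NNReal
open Distr

/-! ### Running a program as a subroutine -/

/-- Rename qubit references. -/
def Data.shift (n₀ : ℕ) : Data → Data
  | .nil => .nil
  | .ref j => .ref (n₀ + j)
  | .cons x y => .cons (x.shift n₀) (y.shift n₀)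

/-- All references are to qubits below `n`. -/
def Data.RefsBelow (n : ℕ) : Data → Prop
  | .nil => True
  | .ref j => j < n
  | .cons x y => x.RefsBelow n ∧ y.RefsBelow n

/-- The height of a tree. -/
def Data.depth : Data → ℕ
  | .cons x y => max x.depth y.depth + 1
  | _ => 0

theorem Data.shift_hd (n₀ : ℕ) (d : Data) : (d.shift n₀).hd = d.hd.shift n₀ := by
  cases d <;> rfl

theorem Data.shift_tl (n₀ : ℕ) (d : Data) : (d.shift n₀).tl = d.tl.shift n₀ := by
  cases d <;> rfl

theorem Data.shift_isPair (n₀ : ℕ) (d : Data) : (d.shift n₀).isPair = d.isPair := by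
  cases d <;> rfl

theorem Data.shift_len (n₀ : ℕ) (d : Data) : (d.shift n₀).len = d.len := by
  induction d with
  | nil => rfl
  | ref => rfl
  | cons x y _ ih => simp [Data.shift, Data.len, ih]

theorem Data.shift_depth (n₀ : ℕ) (d : Data) : (d.shift n₀).depth = d.depth := by
  induction d with
  | nil => rfl
  | ref => rfl
  | cons x y hx hy => simp [Data.shift, Data.depth, hx, hy]

theorem Data.len_le_depth (d : Data) : d.len ≤ d.depth := by
  induction d with
  | nil => exact le_rfl
  | ref => exact le_rfl
  | cons x y _ ih => simp only [Data.len, Data.depth]; omega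

theorem Data.RefsBelow.shift_eq {d : Data} (h : d.RefsBelow 0) (n₀ : ℕ) : d.shift n₀ = d := by
  induction d with
  | nil => rfl
  | ref j => exact absurd h (Nat.not_lt_zero _)
  | cons x y hx hy => simp [Data.shift, hx h.1, hy h.2]

theorem Data.RefsBelow.mono {d : Data} {n n' : ℕ} (h : d.RefsBelow n) (hn : n ≤ n') :
    d.RefsBelow n' := by
  induction d with
  | nil => trivial
  | ref j => exact lt_of_lt_of_le h hn
  | cons x y hx hy => exact ⟨hx h.1, hy h.2⟩

theorem Data.RefsBelow.hd {d : Data} {n : ℕ} (h : d.RefsBelow n) : d.hd.RefsBelow n := by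
  cases d with
  | cons x y => exact h.1
  | _ => trivial

theorem Data.RefsBelow.tl {d : Data} {n : ℕ} (h : d.RefsBelow n) : d.tl.RefsBelow n := by
  cases d with
  | cons x y => exact h.2
  | _ => trivial

theorem Data.depth_hd (d : Data) : d.hd.depth ≤ d.depth := by
  cases d <;> simp [Data.hd, Data.depth]; omega

theorem Data.depth_tl (d : Data) : d.tl.depth ≤ d.depth := by
  cases d <;> simp [Data.tl, Data.depth]; omega

/-- A strict upper bound for the variables of a program. -/
def Com.bound : Com → ℕ
  | .skip => 0
  | .setNil x => x + 1
  | .copy x y => max (x + 1) (y + 1)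
  | .pair x y z => max (x + 1) (max (y + 1) (z + 1))
  | .head x y => max (x + 1) (y + 1)
  | .tail x y => max (x + 1) (y + 1)
  | .seq c d => max c.bound d.bound
  | .ite x c d => max (x + 1) (max c.bound d.bound)
  | .loop x c => max (x + 1) c.bound
  | .newQubit x => x + 1
  | .gateH x => x + 1
  | .gateT x => x + 1
  | .gateCNOT x y => max (x + 1) (y + 1)
  | .measure x y => max (x + 1) (y + 1)

/-- Rename the variables of a program. -/
def Com.shift (b : ℕ) : Com → Com
  | .skip => .skip
  | .setNil x => .setNil (x + b)
  | .copy x y => .copy (x + b) (y + b)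
  | .pair x y z => .pair (x + b) (y + b) (z + b)
  | .head x y => .head (x + b) (y + b)
  | .tail x y => .tail (x + b) (y + b)
  | .seq c d => .seq (c.shift b) (d.shift b)
  | .ite x c d => .ite (x + b) (c.shift b) (d.shift b)
  | .loop x c => .loop (x + b) (c.shift b)
  | .newQubit x => .newQubit (x + b)
  | .gateH x => .gateH (x + b)
  | .gateT x => .gateT (x + b)
  | .gateCNOT x y => .gateCNOT (x + b) (y + b)
  | .measure x y => .measure (x + b) (y + b)

/-! ### Tensor products of an old and a fresh qubit register -/

/-- The members below `n₀`. -/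
def lowPart (n₀ : ℕ) (U : Finset ℕ) : Finset ℕ := U.filter (· < n₀)

/-- The members from `n₀` on, renumbered. -/
def highPart (n₀ : ℕ) (U : Finset ℕ) : Finset ℕ := (U.filter (n₀ ≤ ·)).image (· - n₀)

/-- Inverse of `lowPart` and `highPart`. -/
def joinParts (n₀ : ℕ) (S R : Finset ℕ) : Finset ℕ := S ∪ R.image (n₀ + ·)

theorem mem_highPart {n₀ : ℕ} {U : Finset ℕ} {x : ℕ} : x ∈ highPart n₀ U ↔ n₀ + x ∈ U := by
  simp only [highPart, Finset.mem_image, Finset.mem_filter]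
  constructor
  · rintro ⟨y, ⟨hy, hle⟩, rfl⟩
    rwa [Nat.add_sub_cancel' hle]
  · intro h
    exact ⟨n₀ + x, ⟨h, by omega⟩, by omega⟩

theorem mem_lowPart {n₀ : ℕ} {U : Finset ℕ} {x : ℕ} : x ∈ lowPart n₀ U ↔ x ∈ U ∧ x < n₀ := by
  simp [lowPart]

theorem joinParts_eq (n₀ : ℕ) (U : Finset ℕ) : joinParts n₀ (lowPart n₀ U) (highPart n₀ U) = U := by
  ext x
  simp only [joinParts, Finset.mem_union, mem_lowPart, Finset.mem_image, mem_highPart]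
  constructor
  · rintro (h | ⟨y, hy, rfl⟩)
    · exact h.1
    · exact hy
  · intro h
    by_cases hx : x < n₀
    · exact Or.inl ⟨h, hx⟩
    · refine Or.inr ⟨x - n₀, ?_, by omega⟩
      rwa [Nat.add_sub_cancel' (by omega)]

theorem lowPart_joinParts {n₀ : ℕ} {S R : Finset ℕ} (h : ∀ k ∈ S, k < n₀) :
    lowPart n₀ (joinParts n₀ S R) = S := by
  ext x
  simp only [joinParts, Finset.mem_union, mem_lowPart, Finset.mem_image]
  constructor
  · rintro ⟨h | ⟨y, hy, rfl⟩, hx⟩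
    · exact h
    · omega
  · intro hx
    exact ⟨Or.inl hx, h x hx⟩

theorem highPart_joinParts {n₀ : ℕ} {S R : Finset ℕ} (h : ∀ k ∈ S, k < n₀) :
    highPart n₀ (joinParts n₀ S R) = R := by
  ext x
  simp only [joinParts, Finset.mem_union, mem_highPart, Finset.mem_image]
  constructor
  · rintro (h' | ⟨y, hy, hxy⟩)
    · have := h _ h'; omega
    · have : x = y := by omega
      exact this ▸ hy
  · intro hx
    exact Or.inr ⟨x, hx, rfl⟩

/-- The product of a state of the qubits below `n₀` and a state of the remaining qubits. -/
noncomputable def tens (n₀ : ℕ) (φ ψ : QState) : QState :=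
  Finsupp.onFinset ((φ.support ×ˢ ψ.support).image fun p => joinParts n₀ p.1 p.2)
    (fun U => φ (lowPart n₀ U) * ψ (highPart n₀ U)) (by
      intro U h
      rw [Finset.mem_image]
      refine ⟨(lowPart n₀ U, highPart n₀ U), ?_, joinParts_eq n₀ U⟩
      rw [Finset.mem_product, Finsupp.mem_support_iff, Finsupp.mem_support_iff]
      exact ⟨left_ne_zero_of_mul h, right_ne_zero_of_mul h⟩)

theorem tens_apply (n₀ : ℕ) (φ ψ : QState) (U : Finset ℕ) :
    tens n₀ φ ψ U = φ (lowPart n₀ U) * ψ (highPart n₀ U) := rfl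

/-- Splitting a basis state at `n₀` inverts `joinParts` when the first factor lives below `n₀`; the
double sum then factorises. -/
theorem normSq_tens {n₀ : ℕ} {φ : QState} (hφ : QState.Below n₀ φ) (ψ : QState) :
    normSq (tens n₀ φ ψ) = normSq φ * normSq ψ := by
  rw [normSq_eq_sum (tens n₀ φ ψ) _ Finsupp.support_onFinset_subset, Finset.sum_image,
    Finset.sum_product, normSq_eq_sum φ _ subset_rfl, normSq_eq_sum ψ _ subset_rfl,
    Finset.sum_mul_sum]
  · refine Finset.sum_congr rfl fun S hS => Finset.sum_congr rfl fun R _ => ?_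
    rw [tens_apply, lowPart_joinParts (hφ S hS), highPart_joinParts (hφ S hS), norm_mul, mul_pow]
  · rintro ⟨S, R⟩ h ⟨S', R'⟩ h' heq
    simp only [Finset.coe_product, Set.mem_prod, Finset.mem_coe] at h h'
    simp only at heq
    have h1 := lowPart_joinParts (R := R) (hφ S h.1)
    have h2 := highPart_joinParts (R := R) (hφ S h.1)
    rw [heq, lowPart_joinParts (hφ S' h'.1)] at h1
    rw [heq, highPart_joinParts (hφ S' h'.1)] at h2
    rw [h1, h2]

theorem tens_zero (n₀ : ℕ) (φ : QState) : tens n₀ φ 0 = 0 := by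
  ext U
  simp [tens_apply]

/-- Starting point of a subroutine call: qubits not yet allocated are all `0`, so the present state
already is a product with the initial state of a new register. -/
theorem tens_vacuum {n₀ : ℕ} {φ : QState} (hφ : QState.Below n₀ φ) :
    tens n₀ φ (Finsupp.single ∅ 1) = φ := by
  ext U
  rw [tens_apply, Finsupp.single_apply]
  by_cases h : highPart n₀ U = ∅
  · rw [if_pos h.symm, mul_one]
    have := joinParts_eq n₀ U
    rw [h] at this
    simp only [joinParts, Finset.image_empty, Finset.union_empty] at this
    rw [this]
  · rw [if_neg (fun h' => h h'.symm), mul_zero]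
    by_contra hU
    refine h (Finset.eq_empty_of_forall_notMem fun x hx => ?_)
    have := hφ U (Finsupp.mem_support_iff.2 (Ne.symm hU)) _ (mem_highPart.1 hx)
    omega

theorem tens_below {n₀ n : ℕ} {φ ψ : QState} (hψ : QState.Below n ψ) :
    QState.Below (n₀ + n) (tens n₀ φ ψ) := by
  intro U hU x hx
  rw [Finsupp.mem_support_iff, tens_apply] at hU
  by_cases h : x < n₀
  · omega
  · have := hψ _ (Finsupp.mem_support_iff.2 (right_ne_zero_of_mul hU)) (x - n₀)
      (mem_highPart.2 (by rwa [Nat.add_sub_cancel' (by omega)]))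
    omega

theorem lowPart_congr {n₀ : ℕ} {U U' : Finset ℕ} (h : ∀ x < n₀, x ∈ U ↔ x ∈ U') :
    lowPart n₀ U = lowPart n₀ U' := by
  ext x
  simp only [mem_lowPart]
  constructor
  · exact fun hx => ⟨(h x hx.2).1 hx.1, hx.2⟩
  · exact fun hx => ⟨(h x hx.2).2 hx.1, hx.2⟩

theorem hadamard_tens (n₀ k : ℕ) (φ ψ : QState) :
    hadamard (n₀ + k) (tens n₀ φ ψ) = tens n₀ φ (hadamard k ψ) := by
  ext U
  rw [hadamard_apply, tens_apply n₀ φ (hadamard k ψ), hadamard_apply]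
  have h1 : lowPart n₀ (U.erase (n₀ + k)) = lowPart n₀ U := lowPart_congr fun x hx => by
    simp only [Finset.mem_erase, and_iff_right_iff_imp]; omega
  have h2 : lowPart n₀ (insert (n₀ + k) U) = lowPart n₀ U := lowPart_congr fun x hx => by
    simp only [Finset.mem_insert, or_iff_right_iff_imp]; omega
  have h3 : highPart n₀ (U.erase (n₀ + k)) = (highPart n₀ U).erase k := by
    ext x; simp [mem_highPart]
  have h4 : highPart n₀ (insert (n₀ + k) U) = insert k (highPart n₀ U) := by
    ext x; simp [mem_highPart]
  simp only [tens_apply, h1, h2, h3, h4, mem_highPart]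
  split_ifs <;> ring

theorem phaseT_tens (n₀ k : ℕ) (φ ψ : QState) :
    phaseT (n₀ + k) (tens n₀ φ ψ) = tens n₀ φ (phaseT k ψ) := by
  ext U
  rw [phaseT_apply, tens_apply, tens_apply, phaseT_apply]
  simp only [mem_highPart]
  ring

theorem cnot_apply (j k : ℕ) (ψ : QState) (U : Finset ℕ) : cnot j k ψ U = ψ (cnotMap j k U) := by
  rw [cnot_eq]
  conv_lhs => rw [← cnotMap_involutive j k U]
  exact Finsupp.mapDomain_apply (cnotMap_involutive j k).injective _ _

theorem cnot_tens (n₀ j k : ℕ) (φ ψ : QState) :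
    cnot (n₀ + j) (n₀ + k) (tens n₀ φ ψ) = tens n₀ φ (cnot j k ψ) := by
  ext U
  rw [cnot_apply, tens_apply, tens_apply, cnot_apply]
  have h1 : lowPart n₀ (cnotMap (n₀ + j) (n₀ + k) U) = lowPart n₀ U := lowPart_congr fun x hx => by
    have : x ≠ n₀ + k := by omega
    unfold cnotMap
    split_ifs <;> simp [Finset.mem_symmDiff, this]
  have h2 : highPart n₀ (cnotMap (n₀ + j) (n₀ + k) U) = cnotMap j k (highPart n₀ U) := by
    ext x
    rw [mem_highPart]
    simp only [cnotMap, mem_highPart, ne_eq, Nat.add_left_cancel_iff]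
    split_ifs <;> simp [Finset.mem_symmDiff, mem_highPart]
  rw [h1, h2]

theorem project_tens (n₀ k : ℕ) (b : Bool) (φ ψ : QState) :
    project (n₀ + k) b (tens n₀ φ ψ) = tens n₀ φ (project k b ψ) := by
  ext U
  simp only [project, Finsupp.filter_apply, tens_apply, mem_highPart]
  split_ifs <;> simp

theorem QState.Below.mono {n n' : ℕ} {ψ : QState} (h : QState.Below n ψ) (hn : n ≤ n') :
    QState.Below n' ψ := fun S hS k hk => (h S hS k hk).trans_le hn

theorem hadamard_below {n k : ℕ} {ψ : QState} (h : QState.Below n ψ) (hk : k < n) :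
    QState.Below n (hadamard k ψ) := by
  intro S hS x hx
  rw [Finsupp.mem_support_iff, hadamard_apply] at hS
  have hS := right_ne_zero_of_mul hS
  by_contra hxn
  have hxk : x ≠ k := by omega
  have key : ∀ R, x ∈ R → ψ R = 0 := fun R hR => by
    by_contra hne
    exact hxn (h R (Finsupp.mem_support_iff.2 hne) x hR)
  apply hS
  rw [key _ hx, key (S.erase k) (Finset.mem_erase.2 ⟨hxk, hx⟩),
    key (insert k S) (Finset.mem_insert_of_mem hx)]
  simp

theorem phaseT_below {n k : ℕ} {ψ : QState} (h : QState.Below n ψ) :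
    QState.Below n (phaseT k ψ) := by
  intro S hS
  rw [Finsupp.mem_support_iff, phaseT_apply] at hS
  exact h S (Finsupp.mem_support_iff.2 (right_ne_zero_of_mul hS))

theorem cnot_below {n j k : ℕ} {ψ : QState} (h : QState.Below n ψ) (hk : k < n) :
    QState.Below n (cnot j k ψ) := by
  intro S hS x hx
  rw [Finsupp.mem_support_iff, cnot_apply] at hS
  by_contra hxn
  have hxk : x ≠ k := by omega
  refine hxn (h _ (Finsupp.mem_support_iff.2 hS) x ?_)
  unfold cnotMap
  split_ifs
  · simp [Finset.mem_symmDiff, hx, hxk]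
  · exact hx

theorem project_below {n k : ℕ} {b : Bool} {ψ : QState} (h : QState.Below n ψ) :
    QState.Below n (project k b ψ) := by
  intro S hS
  rw [Finsupp.mem_support_iff, project, Finsupp.filter_apply] at hS
  refine h S (Finsupp.mem_support_iff.2 fun h0 => hS ?_)
  split_ifs
  · exact h0
  · rfl

/-! ### Simulation of a program with renamed variables and qubits -/

/-- A configuration `⟨K₁, σ₁, n₁, ψ₁⟩` is simulated with variables renamed by adding `b` and
qubits renamed by adding `n₀`, in a store `σ₂` that agrees with `σ₀` below `b`. -/
structure Sim (b k n₀ : ℕ) (σ₀ : ℕ → Data) (D : ℕ) (K₁ : List Com) (σ₁ : ℕ → Data) (n₁ : ℕ)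
    (ψ₁ : QState) (σ₂ : ℕ → Data) : Prop where
  code : ∀ c ∈ K₁, c.bound ≤ k
  store : ∀ x < k, σ₂ (x + b) = (σ₁ x).shift n₀
  low : ∀ i < b, σ₂ i = σ₀ i
  refs : ∀ x < k, (σ₁ x).RefsBelow n₁
  below : QState.Below n₁ ψ₁
  depth : ∀ x < k, (σ₁ x).depth ≤ D

theorem Sim.update {b k n₀ : ℕ} {σ₀ : ℕ → Data} {D : ℕ} {c : Com} {K₁ : List Com}
    {σ₁ : ℕ → Data} {n₁ : ℕ} {ψ₁ : QState} {σ₂ : ℕ → Data}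
    (h : Sim b k n₀ σ₀ D (c :: K₁) σ₁ n₁ ψ₁ σ₂) (x : ℕ) {n₂ : ℕ} {ψ₂ : QState} {v w : Data}
    (hn : n₁ ≤ n₂) (hψ : QState.Below n₂ ψ₂) (hv : v.RefsBelow n₂) (hd : v.depth ≤ D + 1)
    (hw : w = v.shift n₀) :
    Sim b k n₀ σ₀ (D + 1) K₁ (Function.update σ₁ x v) n₂ ψ₂ (Function.update σ₂ (x + b) w) where
  code c' hc' := h.code c' (List.mem_cons_of_mem _ hc')
  store y hy := by
    by_cases hyx : y = x
    · subst hyx; simp [hw]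
    · rw [Function.update_of_ne (by omega), Function.update_of_ne hyx, h.store y hy]
  low i hi := by rw [Function.update_of_ne (by omega), h.low i hi]
  refs y hy := by
    by_cases hyx : y = x
    · subst hyx; simpa using hv
    · rw [Function.update_of_ne hyx]
      exact (h.refs y hy).mono hn
  below := hψ
  depth y hy := by
    by_cases hyx : y = x
    · subst hyx; simpa using hd
    · rw [Function.update_of_ne hyx]
      exact (h.depth y hy).trans (by omega)

theorem Sim.state {b k n₀ : ℕ} {σ₀ : ℕ → Data} {D : ℕ} {K₁ K₂ : List Com}
    {σ₁ : ℕ → Data} {n₁ : ℕ} {ψ₁ : QState} {σ₂ : ℕ → Data}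
    (h : Sim b k n₀ σ₀ D K₁ σ₁ n₁ ψ₁ σ₂) (hK : ∀ c ∈ K₂, c.bound ≤ k) {ψ₂ : QState}
    (hψ : QState.Below n₁ ψ₂) :
    Sim b k n₀ σ₀ (D + 1) K₂ σ₁ n₁ ψ₂ σ₂ where
  code := hK
  store := h.store
  low := h.low
  refs := h.refs
  below := hψ
  depth y hy := (h.depth y hy).trans (by omega)

/-- The renamed program runs in lockstep with the original, acting on the second tensor factor only.
The output is seen through a finite reading `g` that ignores the numbering of qubits, as output
trees may contain qubit references. Each step raises the height of the stored trees by at most one;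
the resulting bound `D + T` limits the time needed to read the output. -/
theorem Sim.val {α : Type*} [Fintype α] {g : Data → α} (hg : ∀ n d, g (Data.shift n d) = g d)
    {b k n₀ : ℕ} (hk : 0 < k) {σ₀ : ℕ → Data} {φ : QState} (hφ : QState.Below n₀ φ)
    {K : List Com} {E : Set Data} {T' : ℕ} {G : α → ℝ} (T : ℕ) :
    ∀ {D : ℕ} {K₁ : List Com} {σ₁ : ℕ → Data} {n₁ : ℕ} {ψ₁ : QState} {σ₂ : ℕ → Data},
    Sim b k n₀ σ₀ D K₁ σ₁ n₁ ψ₁ σ₂ → HaltsWithin T ⟨K₁, σ₁, n₁, ψ₁⟩ →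
    (∀ σ' n' ψ', QState.Below n' ψ' → (∀ i < b, σ' i = σ₀ i) → (σ' b).depth ≤ D + T →
      Val E T' ⟨K, σ', n', ψ'⟩ (normSq ψ' * G (g (σ' b)))) →
    Val E (T + T') ⟨K₁.map (Com.shift b) ++ K, σ₂, n₀ + n₁, tens n₀ φ ψ₁⟩
      (normSq φ * ∑ a, G a * probWithin {x | g x = a} T ⟨K₁, σ₁, n₁, ψ₁⟩) := by
  classical
  -- A measurement outcome of amplitude zero may lead to a branch that never stops. It has value `0`
  -- under every time bound.
  have zero : ∀ (T : ℕ) {K₁ : List Com} {σ₁ : ℕ → Data} {n₁ : ℕ} {σ₂ : ℕ → Data},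
      Val E (T + T') ⟨K₁.map (Com.shift b) ++ K, σ₂, n₀ + n₁, tens n₀ φ 0⟩
      (normSq φ * ∑ a, G a * probWithin {x | g x = a} T ⟨K₁, σ₁, n₁, 0⟩) := by
    intro T K₁ σ₁ n₁ σ₂
    simp only [probWithin_of_psi (c := ⟨K₁, σ₁, n₁, 0⟩) rfl, mul_zero, Finset.sum_const_zero]
    exact Val.of_psi (tens_zero _ _)
  have halt : ∀ (T : ℕ) {D : ℕ} {σ₁ : ℕ → Data} {n₁ : ℕ} {ψ₁ : QState} {σ₂ : ℕ → Data},
      Sim b k n₀ σ₀ D [] σ₁ n₁ ψ₁ σ₂ →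
      (∀ σ' n' ψ', QState.Below n' ψ' → (∀ i < b, σ' i = σ₀ i) → (σ' b).depth ≤ D + T →
        Val E T' ⟨K, σ', n', ψ'⟩ (normSq ψ' * G (g (σ' b)))) →
      Val E (T + T') ⟨([] : List Com).map (Com.shift b) ++ K, σ₂, n₀ + n₁, tens n₀ φ ψ₁⟩
      (normSq φ * ∑ a, G a * probWithin {x | g x = a} T ⟨[], σ₁, n₁, ψ₁⟩) := by
    intro T D σ₁ n₁ ψ₁ σ₂ h hl
    have h0 : σ₂ b = (σ₁ 0).shift n₀ := by
      have := h.store 0 hk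
      rwa [zero_add] at this
    have := hl σ₂ (n₀ + n₁) (tens n₀ φ ψ₁) (tens_below h.below) h.low (by
      rw [h0, Data.shift_depth]
      exact (h.depth 0 hk).trans (by omega))
    refine Val.mono (T := T') (this.of_eq ?_) (by omega)
    rw [h0, hg, normSq_tens hφ, mul_assoc]
    congr 1
    simp only [probWithin_of_code (c := ⟨[], σ₁, n₁, ψ₁⟩) rfl]
    simp [probWithin, mul_comm]
  induction T with
  | zero =>
    intro D K₁ σ₁ n₁ ψ₁ σ₂ h hh hl
    rcases hh with hh | hh
    · simp only at hh
      subst hh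
      exact zero 0
    · simp only at hh
      subst hh
      exact halt 0 h hl
  | succ T ih =>
    intro D K₁ σ₁ n₁ ψ₁ σ₂ h hh hl
    rcases K₁ with _ | ⟨c, K₁⟩
    · exact halt _ h hl
    rcases hh with hh | hh
    · simp only at hh
      subst hh
      exact zero _
    have hl' : ∀ σ' n' ψ', QState.Below n' ψ' → (∀ i < b, σ' i = σ₀ i) →
        (σ' b).depth ≤ D + 1 + T → Val E T' ⟨K, σ', n', ψ'⟩ (normSq ψ' * G (g (σ' b))) :=
      fun σ' n' ψ' h1 h2 h3 => hl σ' n' ψ' h1 h2 (by omega)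
    have one : ∀ {K₁' : List Com} {σ₁' : ℕ → Data} {n₁' : ℕ} {ψ₁' : QState} {σ₂' : ℕ → Data},
        step ⟨c :: K₁, σ₁, n₁, ψ₁⟩ = [⟨K₁', σ₁', n₁', ψ₁'⟩] →
        step ⟨(c :: K₁).map (Com.shift b) ++ K, σ₂, n₀ + n₁, tens n₀ φ ψ₁⟩ =
          [⟨K₁'.map (Com.shift b) ++ K, σ₂', n₀ + n₁', tens n₀ φ ψ₁'⟩] →
        Sim b k n₀ σ₀ (D + 1) K₁' σ₁' n₁' ψ₁' σ₂' →
        Val E (T + 1 + T') ⟨(c :: K₁).map (Com.shift b) ++ K, σ₂, n₀ + n₁, tens n₀ φ ψ₁⟩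
        (normSq φ * ∑ a, G a * probWithin {x | g x = a} (T + 1) ⟨c :: K₁, σ₁, n₁, ψ₁⟩) := by
      intro K₁' σ₁' n₁' ψ₁' σ₂' hs1 hs2 hsim
      rw [hs1] at hh
      refine Val.mono (T := T + T' + 1) (Val.step_one hs2 ((ih hsim (hh _ (by simp)) hl').of_eq ?_))
        (by omega)
      congr 1
      refine Finset.sum_congr rfl fun a _ => ?_
      rw [probWithin_succ_of_ne (by simp), hs1]
      simp
    have hb := h.code c (by simp)
    have hK : ∀ c ∈ K₁, c.bound ≤ k := fun c' hc' => h.code c' (by simp [hc'])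
    cases c with
    | skip => exact one rfl rfl (h.state hK h.below)
    | setNil x =>
      exact one rfl rfl (h.update x le_rfl h.below trivial (Nat.zero_le _) rfl)
    | copy x y =>
      simp only [Com.bound, sup_le_iff] at hb
      exact one rfl rfl (h.update x le_rfl h.below (h.refs y (by omega))
        ((h.depth y (by omega)).trans (by omega)) (h.store y (by omega)))
    | pair x y z =>
      simp only [Com.bound, sup_le_iff] at hb
      refine one rfl rfl (h.update x le_rfl h.below
        ⟨h.refs y (by omega), h.refs z (by omega)⟩ ?_ ?_)
      · have h1 := h.depth y (by omega)
        have h2 := h.depth z (by omega)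
        simp only [Data.depth]
        omega
      · rw [h.store y (by omega), h.store z (by omega)]
        rfl
    | head x y =>
      simp only [Com.bound, sup_le_iff] at hb
      exact one rfl rfl (h.update x le_rfl h.below (h.refs y (by omega)).hd
        ((Data.depth_hd _).trans ((h.depth y (by omega)).trans (by omega)))
        (by rw [h.store y (by omega), Data.shift_hd]))
    | tail x y =>
      simp only [Com.bound, sup_le_iff] at hb
      exact one rfl rfl (h.update x le_rfl h.below (h.refs y (by omega)).tl
        ((Data.depth_tl _).trans ((h.depth y (by omega)).trans (by omega)))
        (by rw [h.store y (by omega), Data.shift_tl]))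
    | seq c d =>
      simp only [Com.bound, sup_le_iff] at hb
      refine one rfl rfl (h.state ?_ h.below)
      intro e he
      simp only [List.mem_cons] at he
      rcases he with rfl | rfl | he
      · exact hb.1
      · exact hb.2
      · exact hK e he
    | ite x c d =>
      simp only [Com.bound, sup_le_iff] at hb
      refine one rfl ?_ (h.state (K₂ := (if (σ₁ x).isPair then c else d) :: K₁) ?_ h.below)
      · simp only [List.map_cons, Com.shift, List.cons_append, step]
        rw [h.store x (by omega), Data.shift_isPair]
        split_ifs <;> rfl
      · intro e he
        simp only [List.mem_cons] at he
        rcases he with rfl | he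
        · split_ifs
          · exact hb.2.1
          · exact hb.2.2
        · exact hK e he
    | loop x c =>
      simp only [Com.bound, sup_le_iff] at hb
      refine one rfl ?_
        (h.state (K₂ := if (σ₁ x).isPair then c :: .loop x c :: K₁ else K₁) ?_ h.below)
      · simp only [List.map_cons, Com.shift, List.cons_append, step]
        rw [h.store x (by omega), Data.shift_isPair]
        split_ifs <;> rfl
      · intro e he
        split_ifs at he
        · simp only [List.mem_cons] at he
          rcases he with rfl | rfl | he
          · exact hb.2
          · simp only [Com.bound, sup_le_iff]
            exact hb
          · exact hK e he
        · exact hK e he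
    | newQubit x =>
      exact one rfl rfl (h.update x (Nat.le_succ _) (h.below.mono (Nat.le_succ _))
        (Nat.lt_succ_self n₁) (Nat.zero_le _) rfl)
    | gateH x =>
      simp only [Com.bound] at hb
      have hx := h.store x (by omega)
      have hr := h.refs x (by omega)
      cases hσ : σ₁ x with
      | ref j =>
        rw [hσ] at hx hr
        -- `hr` says that the qubit has been allocated by the simulated program. A gate on an
        -- unallocated qubit could break the bound on the qubits that are `1`.
        refine one (ψ₁' := hadamard j ψ₁) (by simp only [step, hσ]) ?_
          (h.state hK (hadamard_below h.below hr))
        simp only [List.map_cons, Com.shift, List.cons_append, step, hx, Data.shift,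
          hadamard_tens]
      | nil =>
        rw [hσ] at hx
        exact one (by simp only [step, hσ]) (by
          simp only [List.map_cons, Com.shift, List.cons_append, step, hx, Data.shift])
          (h.state hK h.below)
      | cons u v =>
        rw [hσ] at hx
        exact one (by simp only [step, hσ]) (by
          simp only [List.map_cons, Com.shift, List.cons_append, step, hx, Data.shift])
          (h.state hK h.below)
    | gateT x =>
      simp only [Com.bound] at hb
      have hx := h.store x (by omega)
      cases hσ : σ₁ x with
      | ref j =>
        rw [hσ] at hx
        refine one (ψ₁' := phaseT j ψ₁) (by simp only [step, hσ]) ?_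
          (h.state hK (phaseT_below h.below))
        simp only [List.map_cons, Com.shift, List.cons_append, step, hx, Data.shift,
          phaseT_tens]
      | nil =>
        rw [hσ] at hx
        exact one (by simp only [step, hσ]) (by
          simp only [List.map_cons, Com.shift, List.cons_append, step, hx, Data.shift])
          (h.state hK h.below)
      | cons u v =>
        rw [hσ] at hx
        exact one (by simp only [step, hσ]) (by
          simp only [List.map_cons, Com.shift, List.cons_append, step, hx, Data.shift])
          (h.state hK h.below)
    | gateCNOT x y =>
      simp only [Com.bound, sup_le_iff] at hb
      have hx := h.store x (by omega)
      have hy := h.store y (by omega)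
      have hr := h.refs y (by omega)
      cases hσ : σ₁ x <;> cases hσ' : σ₁ y <;> rw [hσ] at hx <;> rw [hσ'] at hy hr
      case ref.ref j k' =>
        refine one (ψ₁' := cnot j k' ψ₁) (by simp only [step, hσ, hσ']) ?_
          (h.state hK (cnot_below h.below hr))
        simp only [List.map_cons, Com.shift, List.cons_append, step, hx, hy, Data.shift,
          cnot_tens]
      all_goals
        exact one (by simp only [step, hσ, hσ']) (by
          simp only [List.map_cons, Com.shift, List.cons_append, step, hx, hy, Data.shift])
          (h.state hK h.below)
    | measure x y =>
      simp only [Com.bound, sup_le_iff] at hb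
      have hy := h.store y (by omega)
      cases hσ : σ₁ y with
      | ref j =>
        rw [hσ] at hy
        have hs1 : step ⟨.measure x y :: K₁, σ₁, n₁, ψ₁⟩ =
            [⟨K₁, Function.update σ₁ x (encBool false), n₁, project j false ψ₁⟩,
             ⟨K₁, Function.update σ₁ x (encBool true), n₁, project j true ψ₁⟩] := by
          simp only [step, hσ]
        have hs2 : step ⟨(Com.measure x y :: K₁).map (Com.shift b) ++ K, σ₂, n₀ + n₁,
              tens n₀ φ ψ₁⟩ =
            [⟨K₁.map (Com.shift b) ++ K, Function.update σ₂ (x + b) (encBool false), n₀ + n₁,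
              tens n₀ φ (project j false ψ₁)⟩,
             ⟨K₁.map (Com.shift b) ++ K, Function.update σ₂ (x + b) (encBool true), n₀ + n₁,
              tens n₀ φ (project j true ψ₁)⟩] := by
          simp only [List.map_cons, Com.shift, List.cons_append, step, hy, Data.shift,
            project_tens]
        rw [hs1] at hh
        have v1 := ih (h.update x (v := encBool false) le_rfl (project_below h.below) trivial
          (Nat.zero_le _) rfl) (hh _ List.mem_cons_self) hl'
        have v2 := ih (h.update x (v := encBool true) le_rfl (project_below h.below)
          ⟨trivial, trivial⟩ (by simp [encBool, Data.depth]) rfl)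
          (hh _ (List.mem_cons_of_mem _ List.mem_cons_self)) hl'
        refine Val.mono (T := T + T' + 1) ((Val.step_two hs2 v1 v2).of_eq ?_) (by omega)
        rw [← mul_add, ← Finset.sum_add_distrib]
        congr 1
        refine Finset.sum_congr rfl fun a _ => ?_
        rw [probWithin_succ_of_ne (by simp), hs1]
        simp [mul_add]
      | nil =>
        rw [hσ] at hy
        exact one (by simp only [step, hσ]) (by
          simp only [List.map_cons, Com.shift, List.cons_append, step, hy, Data.shift])
          (h.state hK h.below)
      | cons u v =>
        rw [hσ] at hy
        exact one (by simp only [step, hσ]) (by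
          simp only [List.map_cons, Com.shift, List.cons_append, step, hy, Data.shift])
          (h.state hK h.below)

/-- Set `k` variables, from `s` on, to `nil`. -/
def clear (s : ℕ) : ℕ → Com
  | 0 => .skip
  | k + 1 => .seq (.setNil (s + k)) (clear s k)

theorem val_clear {E : Set Data} {T s : ℕ} {K : List Com} {n : ℕ} {ψ : QState} {v : ℝ} (k : ℕ) :
    ∀ {σ : ℕ → Data},
    Val E T ⟨K, fun i => if s ≤ i ∧ i < s + k then .nil else σ i, n, ψ⟩ v →
    Val E (T + 2 * k + 1) ⟨clear s k :: K, σ, n, ψ⟩ v := by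
  induction k with
  | zero =>
    intro σ h
    have : (fun i => if s ≤ i ∧ i < s + 0 then Data.nil else σ i) = σ := by
      funext i
      rw [if_neg (by omega)]
    rw [this] at h
    exact Val.step_one rfl h
  | succ k ih =>
    intro σ h
    refine Val.mono (T := T + 2 * k + 1 + 1 + 1) ?_ (by omega)
    refine Val.step_one rfl (Val.step_one rfl (ih ?_))
    convert h using 2
    funext i
    by_cases hi : i = s + k
    · subst hi; simp
    · rw [Function.update_of_ne hi]
      by_cases h' : s ≤ i ∧ i < s + k
      · rw [if_pos h', if_pos (by omega)]
      · rw [if_neg h', if_neg (by omega)]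

/-- Run `A` on the content of variable `b`, then `norm`. -/
def callProg (A : Com) (norm : ℕ → Com) : ℕ → Com := fun b =>
  .seq (clear (b + 1) A.bound) (.seq (A.shift b) (norm b))

/-- Clearing the variables from `b + 1` on recreates the initial store of `A`, and an input without
qubit references is not affected by renaming. Afterwards `norm` replaces the raw output by the
canonical tree `enc (g x)`, so that later code never meets foreign data. -/
theorem runs_callProg {α : Type*} [Fintype α] {A : Com} {g : Data → α}
    (hg : ∀ n d, g (Data.shift n d) = g d) {norm : ℕ → Com} {enc : α → Data} {d : Data}
    {T Tn D : ℕ} (hd : d.RefsBelow 0) (hD : d.depth ≤ D) (hA : HaltsWithin T (start A d))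
    (hnorm : ∀ x : Data, x.depth ≤ D + T → Runs norm x Tn (pure (enc (g x)))) :
    Runs (callProg A norm) d (T + Tn + 2 * A.bound + 3)
      (ofWeights (fun a => (prob A d {x | g x = a}).toNNReal) enc) := by
  intro b σ K n ψ E T' F hb hψ hl
  refine Val.mono (T := T + (Tn + T') + 1 + 2 * A.bound + 1 + 1) ?_ (by omega)
  refine Val.step_one rfl (val_clear _ (Val.step_one rfl ?_))
  have hsim : Sim b (A.bound + 1) n σ D [A] (Function.update (fun _ => Data.nil) 0 d) 0
      (Finsupp.single ∅ 1) (fun i => if b + 1 ≤ i ∧ i < b + 1 + A.bound then .nil else σ i) := by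
    refine ⟨?_, ?_, ?_, ?_, ?_, ?_⟩
    · intro c hc
      rw [List.mem_singleton] at hc
      subst hc
      omega
    · intro x hx
      by_cases hx0 : x = 0
      · subst hx0
        simp only [zero_add, Function.update_self]
        rw [if_neg (by omega), hb, hd.shift_eq]
      · rw [if_pos (by omega), Function.update_of_ne hx0]
        rfl
    · intro i hi
      rw [if_neg (by omega)]
    · intro x _
      by_cases hx0 : x = 0
      · subst hx0
        simpa using hd
      · rw [Function.update_of_ne hx0]
        trivial
    · intro S hS
      have : S = ∅ := by
        have h := Finsupp.support_single_subset hS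
        simpa using h
      subst this
      simp
    · intro x _
      by_cases hx0 : x = 0
      · subst hx0
        simpa using hD
      · rw [Function.update_of_ne hx0]
        exact Nat.zero_le _
  have key := Sim.val hg (Nat.succ_pos _) hψ (K := norm b :: K) (E := E) (T' := Tn + T')
    (G := fun a => F (enc a)) T hsim hA ?_
  · rw [tens_vacuum hψ] at key
    refine Val.of_eq key ?_
    rw [ex_ofWeights]
    congr 1
    refine Finset.sum_congr rfl fun a _ => ?_
    rw [Real.coe_toNNReal _ (prob_nonneg _ _ _), prob_eq_of_haltsWithin hA, mul_comm]
    rfl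
  · intro σ' n' ψ' hψ' hσ' hdep
    rw [← ex_pure (enc (g (σ' b))) F]
    refine hnorm (σ' b) hdep b σ' K n' ψ' E T' F rfl hψ' fun y hy σ₃ n₃ ψ₃ hψ₃ h₃ hσ₃ => ?_
    refine hl y ?_ σ₃ n₃ ψ₃ hψ₃ h₃ fun i hi => by rw [hσ₃ i hi, hσ' i hi]
    rw [supp_pure] at hy
    exact (supp_ofWeights _ _ _).2 ⟨_, hy.symm⟩


open scoped NNReal
open Distr

/-! ### A language of deterministic programs -/

/-- Expressions denoting functions of an environment `arg`. In `letE e f` the environment of `f`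
is extended by the value of `e`; in `fold f l a` the environment of `f` is extended by a member
of the list `l` and the accumulator, which starts as `a`; `app f e` evaluates `f` in the
environment `e`. -/
inductive Ex : Type
  | arg : Ex
  | nil : Ex
  | hd : Ex → Ex
  | tl : Ex → Ex
  | cons : Ex → Ex → Ex
  | ite : Ex → Ex → Ex → Ex
  | app : Ex → Ex → Ex
  | letE : Ex → Ex → Ex
  | fold : Ex → Ex → Ex → Ex

/-- Left fold over the members of a list. -/
def foldD (g : Data → Data → Data) : Data → Data → Data
  | .cons x l, acc => foldD g l (g x acc)
  | .nil, acc => acc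
  | .ref _, acc => acc

/-- `P` holds at every call of the step function of `foldD`. -/
def FoldAllD (g : Data → Data → Data) (P : Data → Data → Prop) : Data → Data → Prop
  | .cons x l, acc => P x acc ∧ FoldAllD g P l (g x acc)
  | .nil, _ => True
  | .ref _, _ => True

namespace Ex

/-- The value of an expression. -/
def ev : Ex → Data → Data
  | arg, d => d
  | nil, _ => .nil
  | hd e, d => (ev e d).hd
  | tl e, d => (ev e d).tl
  | cons e f, d => .cons (ev e d) (ev f d)
  | ite c e f, d => if (ev c d).isPair then ev e d else ev f d
  | app f e, d => ev f (ev e d)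
  | letE e f, d => ev f (.cons (ev e d) d)
  | fold f l a, d => foldD (fun x acc => ev f (.cons x (.cons acc d))) (ev l d) (ev a d)

/-- The evaluation of the expression only folds over lists of length at most `X`. -/
def Ok (X : ℕ) : Ex → Data → Prop
  | arg, _ => True
  | nil, _ => True
  | hd e, d => Ok X e d
  | tl e, d => Ok X e d
  | cons e f, d => Ok X e d ∧ Ok X f d
  | ite c e f, d => Ok X c d ∧ if (ev c d).isPair then Ok X e d else Ok X f d
  | app f e, d => Ok X e d ∧ Ok X f (ev e d)
  | letE e f, d => Ok X e d ∧ Ok X f (.cons (ev e d) d)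
  | fold f l a, d => Ok X l d ∧ Ok X a d ∧ (ev l d).len ≤ X ∧
      FoldAllD (fun x acc => ev f (.cons x (.cons acc d)))
        (fun x acc => Ok X f (.cons x (.cons acc d))) (ev l d) (ev a d)

/-- Time bound, if all folds are over lists of length at most `X`. -/
def tm (X : ℕ) : Ex → ℕ
  | arg => 1
  | nil => 1
  | hd e => tm X e + 2
  | tl e => tm X e + 2
  | cons e f => tm X e + tm X f + 7
  | ite c e f => tm X c + (tm X e + tm X f) + 5
  | app f e => tm X e + tm X f + 1
  | letE e f => tm X e + tm X f + 5
  | fold f l a => tm X l + tm X a + X * (tm X f + 12) + 9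

/-- The program computing an expression. -/
def compile : Ex → ℕ → Com
  | arg => fun _ => .skip
  | nil => fun b => .setNil b
  | hd e => fun b => .seq (compile e b) (.head b b)
  | tl e => fun b => .seq (compile e b) (.tail b b)
  | cons e f => consProg (compile e) (compile f)
  | ite c e f => iteProg (compile c) (compile e) (compile f)
  | app f e => fun b => .seq (compile e b) (compile f b)
  | letE e f => letProg (compile e) (compile f)
  | fold f l a => foldProg (compile f) (compile l) (compile a)

theorem classical_compile (e : Ex) : ∀ b, (compile e b).Classical := by
  induction e <;>
    simp_all [compile, Com.Classical, consProg, iteProg, letProg, foldProg]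

end Ex

theorem foldDist_pure (g : Data → Data → Data) (l : Data) :
    ∀ acc, foldDist (fun x acc => pure (g x acc)) l acc = pure (foldD g l acc) := by
  induction l with
  | nil => intro acc; rfl
  | ref j => intro acc; rfl
  | cons x l _ ih => intro acc; simp [foldDist, foldD, ih]

theorem FoldAllD.foldAll {g : Data → Data → Data} {P Q : Data → Data → Prop}
    (hPQ : ∀ x acc, P x acc → Q x acc) (l : Data) :
    ∀ acc, FoldAllD g P l acc → FoldAll (fun x acc => pure (g x acc)) Q l acc := by
  induction l with
  | nil => intro acc _; trivial
  | ref j => intro acc _; trivial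
  | cons x l _ ih =>
    intro acc h
    refine ⟨hPQ _ _ h.1, fun acc' hacc' => ?_⟩
    rw [supp_pure] at hacc'
    subst hacc'
    exact ih _ h.2

theorem Ex.runs_compile {X : ℕ} (e : Ex) :
    ∀ {d : Data}, e.Ok X d → Runs e.compile d (e.tm X) (pure (e.ev d)) := by
  induction e with
  | arg => intro d _; exact runs_skip d
  | nil => intro d _; exact runs_setNil d
  | hd e ih =>
    intro d h
    have := (ih h).seq (T₂ := 1) (k := fun x => pure x.hd) (r := fun b => .head b b)
      fun x _ => runs_head x
    rw [pure_bind] at this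
    exact this
  | tl e ih =>
    intro d h
    have := (ih h).seq (T₂ := 1) (k := fun x => pure x.tl) (r := fun b => .tail b b)
      fun x _ => runs_tail x
    rw [pure_bind] at this
    exact this
  | cons e f he hf => intro d h; exact (he h.1).consProg (hf h.2)
  | ite c e f hc he hf =>
    intro d h
    refine (hc h.1).iteProg (fun hx => ?_) fun hx => ?_
    · have h2 := h.2
      simp only [hx, if_true] at h2
      simp only [ev, hx, if_true]
      exact (he h2).mono (by omega)
    · have h2 := h.2
      simp only [hx] at h2
      simp only [ev, hx]
      exact (hf h2).mono (by omega)
  | app f e hf he =>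
    intro d h
    have := (he h.1).seq (r := f.compile) (T₂ := f.tm X) (k := fun x => pure (f.ev x)) (by
      intro x hx
      rw [supp_pure] at hx
      subst hx
      exact hf h.2)
    rw [pure_bind] at this
    exact this
  | letE e f he hf =>
    intro d h
    have := (he h.1).letProg (r := f.compile) (T₂ := f.tm X)
      (k := fun x => pure (f.ev (.cons x d))) (by
      intro x hx
      rw [supp_pure] at hx
      subst hx
      exact hf h.2)
    rw [pure_bind] at this
    exact this
  | fold f l a hf hl ha =>
    intro d h
    obtain ⟨h1, h2, h3, h4⟩ := h
    have := (hl h1).foldProg (ha h2) (f := f.compile) (T := f.tm X)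
      (k := fun x acc => pure (f.ev (.cons x (.cons acc d))))
      (h4.foldAll (fun x acc => hf) _ _)
    rw [foldDist_pure] at this
    refine this.mono ?_
    simp only [tm]
    have := Nat.mul_le_mul_right (f.tm X + 12) h3
    omega

/-! ### Polynomial growth and evaluation within bounded resources -/

/-- Functions bounded by a polynomial. -/
def PolyBdd (T : ℕ → ℕ) : Prop := ∃ C c : ℕ, ∀ X, 1 ≤ X → T X ≤ C * X ^ c

theorem PolyBdd.const (a : ℕ) : PolyBdd fun _ => a := ⟨a, 0, fun X _ => by simp⟩

theorem PolyBdd.id : PolyBdd fun X => X := ⟨1, 1, fun X _ => by simp⟩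

theorem PolyBdd.add {f g : ℕ → ℕ} (hf : PolyBdd f) (hg : PolyBdd g) :
    PolyBdd fun X => f X + g X := by
  obtain ⟨C, c, hf⟩ := hf
  obtain ⟨D, d, hg⟩ := hg
  refine ⟨C + D, c + d, fun X hX => ?_⟩
  rw [add_mul]
  refine add_le_add ((hf X hX).trans ?_) ((hg X hX).trans ?_)
  · exact Nat.mul_le_mul_left _ (Nat.pow_le_pow_right hX (by omega))
  · exact Nat.mul_le_mul_left _ (Nat.pow_le_pow_right hX (by omega))

theorem PolyBdd.mul {f g : ℕ → ℕ} (hf : PolyBdd f) (hg : PolyBdd g) :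
    PolyBdd fun X => f X * g X := by
  obtain ⟨C, c, hf⟩ := hf
  obtain ⟨D, d, hg⟩ := hg
  refine ⟨C * D, c + d, fun X hX => ?_⟩
  calc f X * g X ≤ (C * X ^ c) * (D * X ^ d) := Nat.mul_le_mul (hf X hX) (hg X hX)
    _ = C * D * X ^ (c + d) := by ring

theorem PolyBdd.comp_mul {f : ℕ → ℕ} (hf : PolyBdd f) (a : ℕ) (ha : 1 ≤ a) :
    PolyBdd fun X => f (a * X) := by
  obtain ⟨C, c, hf⟩ := hf
  refine ⟨C * a ^ c, c, fun X hX => (hf _ (Nat.mul_pos ha hX)).trans ?_⟩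
  rw [mul_pow, mul_assoc]

/-- The expression is fixed while `X` grows, and its only loops are folds over lists of length at
most `X`; each level of nesting contributes one factor `X`. -/
theorem Ex.polyBdd_tm (e : Ex) : PolyBdd fun X => e.tm X := by
  induction e with
  | arg => exact .const 1
  | nil => exact .const 1
  | hd e ih => exact ih.add (.const 2)
  | tl e ih => exact ih.add (.const 2)
  | cons e f he hf => exact (he.add hf).add (.const 7)
  | ite c e f hc he hf => exact (hc.add (he.add hf)).add (.const 5)
  | app f e hf he => exact (he.add hf).add (.const 1)
  | letE e f he hf => exact (he.add hf).add (.const 5)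
  | fold f l a hf hl ha => exact ((hl.add ha).add (PolyBdd.id.mul (hf.add (.const 12)))).add (.const 9)

/-- `e` evaluates to `r` in the environment `d`, folding over lists of length at most `X`
only. -/
def Evals (X : ℕ) (e : Ex) (d r : Data) : Prop := e.ev d = r ∧ e.Ok X d

theorem len_encList (l : List Data) : (encList l).len = l.length := by
  induction l with
  | nil => rfl
  | cons a l ih => simp [encList, Data.len, ih]

/-- Rule for folds over encoded lists, with an invariant that depends on the remaining list. -/
theorem Evals.fold_rem {α β : Type*} {X : ℕ} {f l a : Ex} {d : Data} {ys : List α} {eα : α → Data}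
    {eβ : β → Data} {b₀ : β} {g : β → α → β} (inv : List α → β → Prop)
    (hl : Evals X l d (encList (ys.map eα))) (ha : Evals X a d (eβ b₀)) (hlen : ys.length ≤ X)
    (h0 : inv ys b₀)
    (hs : ∀ y ys b, inv (y :: ys) b → inv ys (g b y) ∧
      Evals X f (.cons (eα y) (.cons (eβ b) d)) (eβ (g b y))) :
    Evals X (.fold f l a) d (eβ (ys.foldl g b₀)) := by
  have key : ∀ (ys : List α) (b : β), inv ys b →
      foldD (fun x acc => f.ev (.cons x (.cons acc d))) (encList (ys.map eα)) (eβ b) =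
        eβ (ys.foldl g b) ∧
      FoldAllD (fun x acc => f.ev (.cons x (.cons acc d)))
        (fun x acc => f.Ok X (.cons x (.cons acc d))) (encList (ys.map eα)) (eβ b) := by
    intro ys
    induction ys with
    | nil => intro b _; exact ⟨rfl, trivial⟩
    | cons y ys ih =>
      intro b hb
      obtain ⟨h1, h2, h3⟩ := hs y ys b hb
      have := ih (g b y) h1
      simp only [List.map_cons, encList, foldD, FoldAllD, h2, List.foldl_cons]
      exact ⟨this.1, h3, this.2⟩
  obtain ⟨k1, k2⟩ := key ys b₀ h0
  refine ⟨?_, hl.2, ha.2, ?_, ?_⟩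
  · simp only [Ex.ev, hl.1, ha.1]
    exact k1
  · rw [hl.1, len_encList, List.length_map]
    exact hlen
  · rw [hl.1, ha.1]
    exact k2

/-- Rule for folds over encoded lists. -/
theorem Evals.fold {α β : Type*} {X : ℕ} {f l a : Ex} {d : Data} {ys : List α} {eα : α → Data}
    {eβ : β → Data} {b₀ : β} {g : β → α → β} (inv : β → Prop)
    (hl : Evals X l d (encList (ys.map eα))) (ha : Evals X a d (eβ b₀)) (hlen : ys.length ≤ X)
    (h0 : inv b₀)
    (hs : ∀ y ∈ ys, ∀ b, inv b → inv (g b y) ∧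
      Evals X f (.cons (eα y) (.cons (eβ b) d)) (eβ (g b y))) :
    Evals X (.fold f l a) d (eβ (ys.foldl g b₀)) :=
  Evals.fold_rem (fun zs b => inv b ∧ ∀ y ∈ zs, y ∈ ys) hl ha hlen ⟨h0, fun _ h => h⟩
    fun y zs b hb => by
      obtain ⟨h1, h2⟩ := hs y (hb.2 y (by simp)) b hb.1
      exact ⟨⟨h1, fun z hz => hb.2 z (by simp [hz])⟩, h2⟩


open scoped NNReal
open Distr

/-! ### Scalars -/

namespace Ex

/-- Iterated `tl`. -/
def tls : ℕ → Ex → Ex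
  | 0, e => e
  | k + 1, e => tl (tls k e)

/-- The `i`-th entry of the environment. -/
def var (i : ℕ) : Ex := hd (tls i arg)

/-- Successor modulo `q`. -/
def inc (q : ℕ) : Ex := letE (cons nil arg) (ite (tls (q - 1) (var 0)) nil (var 0))

/-- A constant without references. -/
def const : Data → Ex
  | .cons x y => cons (const x) (const y)
  | _ => nil

/-- Sum modulo `q`. -/
def addS (q : ℕ) : Ex := fold (app (inc q) (var 1)) (hd arg) (tl arg)

/-- The length of a list, plus `u`, modulo `q`. -/
def lenMod (q : ℕ) (u : ℕ) : Ex := fold (app (inc q) (var 1)) arg (const (encNat u))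

theorem ev_tls (k : ℕ) (e : Ex) (d : Data) : (tls k e).ev d = Data.tl^[k] (e.ev d) := by
  induction k with
  | zero => rfl
  | succ k ih => simp [tls, ev, ih, Function.iterate_succ_apply']

@[simp] theorem ok_tls (X k : ℕ) (e : Ex) (d : Data) : (tls k e).Ok X d ↔ e.Ok X d := by
  induction k with
  | zero => rfl
  | succ k ih => simp [tls, Ok, ih]

@[simp] theorem ok_var (X k : ℕ) (d : Data) : (var k).Ok X d := by
  simp [var, Ok]

@[simp] theorem ok_const (X : ℕ) (c d : Data) : (const c).Ok X d := by
  induction c <;> simp_all [const, Ok]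

theorem ev_const {c : Data} (hc : c.RefsBelow 0) (d : Data) : (const c).ev d = c := by
  induction c with
  | nil => rfl
  | ref j => exact absurd hc (Nat.not_lt_zero _)
  | cons x y hx hy => simp [const, ev, hx hc.1, hy hc.2]

end Ex

@[simp] theorem Data.hd_cons (x y : Data) : (Data.cons x y).hd = x := rfl
@[simp] theorem Data.tl_cons (x y : Data) : (Data.cons x y).tl = y := rfl
@[simp] theorem Data.hd_nil : Data.nil.hd = .nil := rfl
@[simp] theorem Data.tl_nil : Data.nil.tl = .nil := rfl
@[simp] theorem Data.isPair_cons (x y : Data) : (Data.cons x y).isPair = true := rfl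
@[simp] theorem Data.isPair_nil : Data.nil.isPair = false := rfl

theorem encNat_zero : encNat 0 = .nil := rfl
theorem encNat_succ (k : ℕ) : encNat (k + 1) = .cons .nil (encNat k) := rfl

theorem isPair_encNat (k : ℕ) : (encNat k).isPair = decide (0 < k) := by
  cases k <;> simp [encNat_zero, encNat_succ]

theorem tl_encNat (k : ℕ) : (encNat k).tl = encNat (k - 1) := by
  cases k <;> simp [encNat_zero, encNat_succ]

theorem iterate_tl_encNat (j k : ℕ) : Data.tl^[j] (encNat k) = encNat (k - j) := by
  induction j with
  | zero => rfl
  | succ j ih => rw [Function.iterate_succ_apply', ih, tl_encNat, Nat.sub_sub]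

theorem refsBelow_encList {l : List Data} (h : ∀ x ∈ l, x.RefsBelow 0) :
    (encList l).RefsBelow 0 := by
  induction l with
  | nil => trivial
  | cons a l ih => exact ⟨h a (by simp), ih fun x hx => h x (by simp [hx])⟩

theorem refsBelow_encNat (k : ℕ) : (encNat k).RefsBelow 0 :=
  refsBelow_encList fun x hx => by rw [List.eq_of_mem_replicate hx]; trivial

section Scalars

variable {q : ℕ} [Fact q.Prime]

theorem val_add_one (a : ZMod q) : (a + 1).val = if a.val + 1 = q then 0 else a.val + 1 := by
  have hlt := ZMod.val_lt a
  rw [ZMod.val_add, ZMod.val_one]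
  split_ifs with h
  · rw [h, Nat.mod_self]
  · exact Nat.mod_eq_of_lt (by omega)

theorem evals_inc (X : ℕ) (a : ZMod q) : Evals X (Ex.inc q) (encField a) (encField (a + 1)) := by
  have hq := (Fact.out : q.Prime).two_le
  have hlt := ZMod.val_lt a
  constructor
  · simp only [Ex.inc, Ex.ev, Ex.var, Ex.ev_tls, Function.iterate_zero, id, Data.hd_cons]
    -- Removing `q - 1` members from the unary `a + 1` leaves something exactly if `a + 1 = q`,
    -- which is the case where the value wraps around to `0`.
    have : Data.cons .nil (encField a) = encNat (a.val + 1) := rfl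
    rw [this, iterate_tl_encNat, isPair_encNat]
    unfold encField
    rw [val_add_one]
    by_cases h : a.val + 1 = q
    · rw [if_pos h, if_pos (by simp; omega)]
      rfl
    · rw [if_neg h, if_neg (by simp; omega)]
  · simp [Ex.inc, Ex.Ok]

theorem foldl_add_one {α : Type*} (l : List α) (a : ZMod q) :
    l.foldl (fun b _ => b + 1) a = a + l.length := by
  induction l generalizing a with
  | nil => simp
  | cons x l ih =>
    rw [List.foldl_cons, ih, List.length_cons]
    push_cast
    ring

theorem evals_addS {X : ℕ} (hX : q ≤ X) (a b : ZMod q) :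
    Evals X (Ex.addS q) (.cons (encField a) (encField b)) (encField (a + b)) := by
  have h := Evals.fold (X := X) (f := .app (Ex.inc q) (Ex.var 1)) (l := .hd .arg) (a := .tl .arg)
    (d := .cons (encField a) (encField b)) (ys := List.replicate a.val ()) (eα := fun _ => .nil)
    (eβ := encField (q := q)) (b₀ := b) (g := fun b _ => b + 1) (fun _ => True)
    ⟨by simp [Ex.ev, encField, encNat], trivial⟩ ⟨rfl, trivial⟩
    (by simpa using (ZMod.val_lt a).le.trans hX) trivial
    (fun y _ b _ => ⟨trivial, by
      have := evals_inc X b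
      exact ⟨this.1, ⟨Ex.ok_var _ _ _, this.2⟩⟩⟩)
  rw [foldl_add_one, List.length_replicate, ZMod.natCast_zmod_val, add_comm b a] at h
  exact h

/-- Arbitrary trees are admitted because the output of a predictor need not be a numeral. Only the
length of the right spine counts, and a qubit reference ends it like `nil`. -/
theorem ev_lenMod (u : ZMod q) (d : Data) :
    (Ex.lenMod q u.val).ev d = encField (readField q d + u) := by
  simp only [Ex.lenMod, Ex.ev, Ex.ev_const (refsBelow_encNat _)]
  have key : ∀ (d e : Data) (b : ZMod q), foldD (fun x acc =>
      (Ex.inc q).ev ((Ex.var 1).ev (.cons x (.cons acc e)))) d (encField b) =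
      encField (readField q d + b) := by
    intro d e
    induction d with
    | nil => intro b; simp [foldD, readField, Data.len]
    | ref j => intro b; simp [foldD, readField, Data.len]
    | cons x l _ ih =>
      intro b
      have h1 : (Ex.inc q).ev ((Ex.var 1).ev (.cons x (.cons (encField b) e))) =
        encField (b + 1) := (evals_inc 0 b).1
      simp only [foldD]
      rw [h1, ih]
      simp only [readField, Data.len]
      push_cast
      ring_nf
  exact key d d u

theorem ok_lenMod {X : ℕ} (u : ZMod q) {d : Data} (hd : d.len ≤ X) :
    (Ex.lenMod q u.val).Ok X d := by
  refine ⟨trivial, Ex.ok_const _ _ _, hd, ?_⟩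
  rw [Ex.ev_const (refsBelow_encNat _)]
  have key : ∀ (d e : Data) (b : ZMod q), FoldAllD (fun x acc =>
      (Ex.app (Ex.inc q) (Ex.var 1)).ev (.cons x (.cons acc e)))
      (fun x acc => (Ex.app (Ex.inc q) (Ex.var 1)).Ok X (.cons x (.cons acc e))) d
      (encField b) := by
    intro d e
    induction d with
    | nil => intro b; trivial
    | ref j => intro b; trivial
    | cons x l _ ih =>
      intro b
      refine ⟨⟨Ex.ok_var _ _ _, (evals_inc X b).2⟩, ?_⟩
      have h1 : (Ex.inc q).ev ((Ex.var 1).ev (.cons x (.cons (encField b) e))) =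
        encField (b + 1) := (evals_inc 0 b).1
      simp only [Ex.ev] at ih ⊢
      rw [h1]
      exact ih _
  exact key d d u

end Scalars

/-! ### A language of randomized programs with oracle calls -/

/-- Randomized expressions. In `call A u e` the program `A` is run on the value of `e`, and `u`
is added to its output. -/
inductive RX (q : ℕ) : Type
  | det : Ex → RX q
  | call : Com → ZMod q → Ex → RX q
  | letR : RX q → RX q → RX q
  | ite : Ex → RX q → RX q → RX q
  | app : RX q → Ex → RX q
  | fold : RX q → Ex → Ex → RX q

namespace RX

variable {q : ℕ}

/-- Time bound. -/
def tm (X : ℕ) : RX q → ℕ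
  | det e => e.tm X
  | call A u e => e.tm X + (X + (Ex.lenMod q u.val).tm (2 * X) + 2 * A.bound + 3) + 1
  | letR r s => tm X r + tm X s + 5
  | ite c r s => c.tm X + (tm X r + tm X s) + 5
  | app r e => e.tm X + tm X r + 1
  | fold f l a => l.tm X + a.tm X + X * (tm X f + 12) + 9

theorem polyBdd_tm (r : RX q) : PolyBdd fun X => r.tm X := by
  induction r with
  | det e => exact e.polyBdd_tm
  | call A u e =>
    exact (e.polyBdd_tm.add (((PolyBdd.id.add
      ((Ex.lenMod q u.val).polyBdd_tm.comp_mul 2 (by norm_num))).add (.const _)).add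
      (.const 3))).add (.const 1)
  | letR r s hr hs => exact (hr.add hs).add (.const 5)
  | ite c r s hr hs => exact (c.polyBdd_tm.add (hr.add hs)).add (.const 5)
  | app r e hr => exact (e.polyBdd_tm.add hr).add (.const 1)
  | fold f l a hf =>
    exact ((l.polyBdd_tm.add a.polyBdd_tm).add (PolyBdd.id.mul (hf.add (.const 12)))).add (.const 9)

end RX

section

variable {q : ℕ} [Fact q.Prime]

/-- The distribution of the (shifted) outputs of `A`. -/
noncomputable def answer (A : Com) (u : ZMod q) (d : Data) (a : ZMod q) : ℝ :=
  prob A d {x | readField q x + u = a}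

namespace RX

/-- The distribution of the value. -/
noncomputable def sem : RX q → Data → Distr Data
  | det e, d => pure (e.ev d)
  | call A u e, d => ofWeights (fun a => (answer A u (e.ev d) a).toNNReal) encField
  | letR r s, d => bind (sem r d) fun x => sem s (.cons x d)
  | ite c r s, d => if (c.ev d).isPair then sem r d else sem s d
  | app r e, d => sem r (e.ev d)
  | fold f l a, d => foldDist (fun x acc => sem f (.cons x (.cons acc d))) (l.ev d) (a.ev d)

/-- All folds are over lists of length at most `X`, and all programs are called on inputs of
height at most `X` on which they halt within `X` steps. -/
def Ok (X : ℕ) : RX q → Data → Prop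
  | det e, d => e.Ok X d
  | call A _ e, d => e.Ok X d ∧ (e.ev d).RefsBelow 0 ∧ (e.ev d).depth ≤ X ∧
      HaltsWithin X (start A (e.ev d))
  | letR r s, d => Ok X r d ∧ ∀ x, Supp (sem r d) x → Ok X s (.cons x d)
  | ite c r s, d => c.Ok X d ∧ if (c.ev d).isPair then Ok X r d else Ok X s d
  | app r e, d => e.Ok X d ∧ Ok X r (e.ev d)
  | fold f l a, d => l.Ok X d ∧ a.Ok X d ∧ (l.ev d).len ≤ X ∧
      FoldAll (fun x acc => sem f (.cons x (.cons acc d)))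
        (fun x acc => Ok X f (.cons x (.cons acc d))) (l.ev d) (a.ev d)

/-- The program. -/
def compile : RX q → ℕ → Com
  | det e => e.compile
  | call A u e => fun b => .seq (e.compile b) (callProg A (Ex.lenMod q u.val).compile b)
  | letR r s => letProg (compile r) (compile s)
  | ite c r s => iteProg c.compile (compile r) (compile s)
  | app r e => fun b => .seq (e.compile b) (compile r b)
  | fold f l a => foldProg (compile f) l.compile a.compile

theorem foldAll_imp {k : Data → Data → Distr Data} {P Q : Data → Data → Prop}
    (hPQ : ∀ x acc, P x acc → Q x acc) (l : Data) :
    ∀ acc, FoldAll k P l acc → FoldAll k Q l acc := by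
  induction l with
  | nil => intro acc _; trivial
  | ref j => intro acc _; trivial
  | cons x l _ ih => exact fun acc h => ⟨hPQ _ _ h.1, fun acc' hacc' => ih _ (h.2 acc' hacc')⟩

theorem runs_compile {X : ℕ} (r : RX q) :
    ∀ {d : Data}, r.Ok X d → Runs r.compile d (r.tm X) (r.sem d) := by
  induction r with
  | det e => intro d h; exact e.runs_compile h
  | call A u e =>
    intro d h
    obtain ⟨h1, h2, h3, h4⟩ := h
    have := (e.runs_compile h1).seq (k := fun x => (call A u .arg).sem x)
      (r := callProg A (Ex.lenMod q u.val).compile)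
      (T₂ := X + (Ex.lenMod q u.val).tm (2 * X) + 2 * A.bound + 3) (by
      intro x hx
      rw [supp_pure] at hx
      subst hx
      exact runs_callProg (g := fun x => readField q x + u) (enc := encField)
        (fun n d => by simp only [readField, Data.shift_len]) h2 h3 h4 fun x hx => by
          rw [← ev_lenMod]
          -- The output is no longer than its height, which is at most the height `X` of the input
          -- plus the `X` steps made; hence `2 * X`.
          exact Ex.runs_compile _ (ok_lenMod u ((Data.len_le_depth x).trans (by omega))))
    rw [pure_bind] at this
    exact this
  | letR r s hr hs => intro d h; exact (hr h.1).letProg fun x hx => hs (h.2 x hx)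
  | ite c r s hr hs =>
    intro d h
    refine (c.runs_compile h.1).iteProg (fun hx => ?_) fun hx => ?_
    · have h2 := h.2
      simp only [hx, if_true] at h2
      simp only [sem, hx, if_true]
      exact (hr h2).mono (by omega)
    · have h2 := h.2
      simp only [hx] at h2
      simp only [sem, hx]
      exact (hs h2).mono (by omega)
  | app r e hr =>
    intro d h
    have := (e.runs_compile h.1).seq (r := r.compile) (T₂ := r.tm X) (k := fun x => r.sem x) (by
      intro x hx
      rw [supp_pure] at hx
      subst hx
      exact hr h.2)
    rw [pure_bind] at this
    exact this
  | fold f l a hf =>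
    intro d h
    obtain ⟨h1, h2, h3, h4⟩ := h
    have := (l.runs_compile h1).foldProg (a.runs_compile h2) (f := f.compile) (T := f.tm X)
      (k := fun x acc => f.sem (.cons x (.cons acc d))) (foldAll_imp (fun x acc => hf) _ _ h4)
    refine this.mono ?_
    simp only [tm]
    have := Nat.mul_le_mul_right (f.tm X + 12) h3
    omega

end RX

end

theorem Runs.val_start {p : ℕ → Com} {d : Data} {T : ℕ} {μ : Distr Data} (h : Runs p d T μ)
    (E : Set Data) [DecidablePred (· ∈ E)] :
    Val E T (start (p 0) d) (ex μ fun x => if x ∈ E then 1 else 0) := by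
  have := h 0 (Function.update (fun _ => Data.nil) 0 d) [] 0 (Finsupp.single ∅ 1) E 0
    (fun x => if x ∈ E then 1 else 0) (by simp) (by
      intro S hS
      have : S = ∅ := by
        have h := Finsupp.support_single_subset hS
        simpa using h
      subst this
      simp) (by
      intro x _ σ' n' ψ' _ hx _
      subst hx
      exact Val.halted)
  rw [normSq_single] at this
  simpa [start] using this

/-! ### Coins -/

/-- Toss a coin. -/
def coinCom : Com := .seq (.newQubit 0) (.seq (.gateH 0) (.measure 0 0))

theorem hadamard_vacuum : hadamard 0 (Finsupp.single ∅ 1) =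
    Finsupp.single ∅ (((Real.sqrt 2)⁻¹ : ℝ) : ℂ) +
      Finsupp.single {0} (((Real.sqrt 2)⁻¹ : ℝ) : ℂ) := by
  simp [hadamard]

theorem normSq_coin (b : Bool) : normSq (project 0 b (hadamard 0 (Finsupp.single ∅ 1))) = 1 / 2 := by
  have h2 : ‖(((Real.sqrt 2)⁻¹ : ℝ) : ℂ)‖ ^ 2 = 1 / 2 := by
    rw [Complex.norm_real, Real.norm_eq_abs, sq_abs, inv_pow, Real.sq_sqrt (by norm_num)]
    norm_num
  have h : project 0 b (hadamard 0 (Finsupp.single ∅ 1)) =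
      Finsupp.single (if b then {0} else ∅) (((Real.sqrt 2)⁻¹ : ℝ) : ℂ) := by
    rw [hadamard_vacuum, project, Finsupp.filter_add]
    cases b
    · rw [Finsupp.filter_single_of_pos, Finsupp.filter_single_of_neg] <;> simp
    · rw [Finsupp.filter_single_of_neg, Finsupp.filter_single_of_pos] <;> simp
  rw [h, normSq_single, h2]

theorem val_coinCom (E : Set Data) [DecidablePred (· ∈ E)] : Val E 5 (start coinCom .nil)
    (1 / 2 * (if encBool false ∈ E then 1 else 0) + 1 / 2 * (if encBool true ∈ E then 1 else 0)) := by
  refine Val.step_one rfl (Val.step_one rfl (Val.step_one rfl (Val.step_one rfl ?_)))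
  have h : ∀ b, Val E 0 ⟨[], Function.update (Function.update (Function.update
      (fun _ => Data.nil) 0 .nil) 0 (.ref 0)) 0 (encBool b), 0 + 1,
      project 0 b (hadamard 0 (Finsupp.single ∅ 1))⟩ (1 / 2 * if encBool b ∈ E then 1 else 0) := by
    intro b
    refine Val.halted.of_eq ?_
    rw [normSq_coin, Function.update_self]
  exact Val.step_two rfl (h false) (h true)

section

variable {q : ℕ} [Fact q.Prime]

/-- A random bit. -/
def RX.coin (q : ℕ) : RX q := .call coinCom 0 .nil

/-- `encBool false` and `encBool true` are lists of length `0` and `1` and are read as these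
scalars; both outcomes have squared amplitude `1/2`. -/
theorem answer_coin (a : ZMod q) : answer coinCom (0 : ZMod q) .nil a =
    1 / 2 * (if a = 0 then 1 else 0) + 1 / 2 * if a = 1 then 1 else 0 := by
  classical
  rw [answer, (val_coinCom _).prob]
  simp [readField, encBool, Data.len, eq_comm]

theorem RX.tm_compile_bound {X : ℕ} {r : RX q} {d : Data} (h : r.Ok X d) :
    HaltsWithin (r.tm X) (start (r.compile 0) d) := by
  classical
  exact ((r.runs_compile h).val_start ∅).1

theorem RX.prob_compile {X : ℕ} {r : RX q} {d : Data} (h : r.Ok X d) (E : Set Data)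
    [DecidablePred (· ∈ E)] :
    prob (r.compile 0) d E = ex (r.sem d) fun x => if x ∈ E then 1 else 0 :=
  ((r.runs_compile h).val_start E).prob

end


open scoped NNReal
open Distr

/-! ### Programs for lists, vectors and matrices -/

namespace Ex

/-- Reversal of a list. -/
def rev : Ex := fold (cons (var 0) (var 1)) arg nil

/-- Apply `f` to the pairs of corresponding members of two lists. -/
def zipE (f : Ex) : Ex :=
  app rev (tl (fold (cons (tl (hd (var 1)))
    (cons (app f (cons (var 0) (hd (hd (var 1))))) (tl (var 1)))) (hd arg) (cons (tl arg) nil)))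

/-- Apply `f` to the members of the list `l`; the environment of `f` is extended by the member. -/
def mapE (f l : Ex) : Ex :=
  app rev (fold (cons (app f (cons (var 0) (tl (tl arg)))) (var 1)) l nil)

/-- Sum of vectors. -/
def addV (q : ℕ) : Ex := zipE (addS q)

/-- Sum of matrices. -/
def addM (q : ℕ) : Ex := zipE (addV q)

/-- Trace of a matrix. -/
def trace (q : ℕ) : Ex :=
  hd (fold (cons (app (addS q) (cons (hd (fold (tl (var 1)) (tl (var 1)) (var 0))) (hd (var 1))))
    (cons nil (tl (var 1)))) arg (cons nil nil))

@[simp] theorem ev_var_zero (x d : Data) : (var 0).ev (.cons x d) = x := rfl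
@[simp] theorem ev_var_one (x y d : Data) : (var 1).ev (.cons x (.cons y d)) = y := rfl

end Ex

section

variable {X : ℕ}

theorem Evals.app {f e : Ex} {d x y : Data} (he : Evals X e d x) (hf : Evals X f x y) :
    Evals X (.app f e) d y := by
  obtain ⟨rfl, h1⟩ := he
  exact ⟨hf.1, h1, hf.2⟩

theorem Evals.letE {f e : Ex} {d x y : Data} (he : Evals X e d x) (hf : Evals X f (.cons x d) y) :
    Evals X (.letE e f) d y := by
  obtain ⟨rfl, h1⟩ := he
  exact ⟨hf.1, h1, hf.2⟩

theorem Evals.cons {f e : Ex} {d x y : Data} (he : Evals X e d x) (hf : Evals X f d y) :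
    Evals X (.cons e f) d (.cons x y) := by
  obtain ⟨rfl, h1⟩ := he
  obtain ⟨rfl, h2⟩ := hf
  exact ⟨rfl, h1, h2⟩

theorem Evals.hd {e : Ex} {d x : Data} (he : Evals X e d x) : Evals X (.hd e) d x.hd := by
  obtain ⟨rfl, h1⟩ := he
  exact ⟨rfl, h1⟩

theorem Evals.tl {e : Ex} {d x : Data} (he : Evals X e d x) : Evals X (.tl e) d x.tl := by
  obtain ⟨rfl, h1⟩ := he
  exact ⟨rfl, h1⟩

theorem Evals.arg (d : Data) : Evals X .arg d d := ⟨rfl, trivial⟩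

theorem Evals.nil (d : Data) : Evals X .nil d .nil := ⟨rfl, trivial⟩

theorem Evals.ite_true {c e f : Ex} {d x y : Data} (hc : Evals X c d x) (hx : x.isPair = true)
    (he : Evals X e d y) : Evals X (.ite c e f) d y := by
  obtain ⟨rfl, h1⟩ := hc
  refine ⟨?_, h1, ?_⟩
  · simp [Ex.ev, hx, he.1]
  · simpa [hx] using he.2

theorem Evals.ite_false {c e f : Ex} {d x y : Data} (hc : Evals X c d x) (hx : x.isPair = false)
    (he : Evals X f d y) : Evals X (.ite c e f) d y := by
  obtain ⟨rfl, h1⟩ := hc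
  refine ⟨?_, h1, ?_⟩
  · simp [Ex.ev, hx, he.1]
  · simpa [hx] using he.2

theorem Evals.var (k : ℕ) (d : Data) : Evals X (.var k) d ((Ex.var k).ev d) :=
  ⟨rfl, Ex.ok_var _ _ _⟩

theorem Evals.const {c : Data} (hc : c.RefsBelow 0) (d : Data) : Evals X (.const c) d c :=
  ⟨Ex.ev_const hc d, Ex.ok_const _ _ _⟩

theorem evals_rev {l : List Data} (hl : l.length ≤ X) :
    Evals X Ex.rev (encList l) (encList l.reverse) := by
  have := Evals.fold (X := X) (f := .cons (.var 0) (.var 1)) (l := .arg) (a := .nil)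
    (d := encList l) (ys := l) (eα := id) (eβ := encList) (b₀ := []) (g := fun b y => y :: b)
    (fun _ => True) (by rw [List.map_id]; exact .arg _) (.nil _) hl trivial
    (fun y _ b _ => ⟨trivial, (Evals.var _ _).cons (.var _ _)⟩)
  simpa [Ex.rev] using this

/-- The accumulator is a pair: the unread rest of the second list and the results so far in reverse.
Equal lengths keep the two lists in step, so the case of an exhausted second list never occurs. -/
theorem evals_zipE {α β γ : Type*} {f : Ex} {ys : List α} {zs : List β} {h : α → β → γ}
    {eα : α → Data} {eβ : β → Data} {eγ : γ → Data}
    (hs : ∀ y ∈ ys, ∀ z ∈ zs, Evals X f (.cons (eα y) (eβ z)) (eγ (h y z)))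
    (hlen : zs.length = ys.length) (hX : ys.length ≤ X) :
    Evals X (Ex.zipE f) (.cons (encList (ys.map eα)) (encList (zs.map eβ)))
      (encList ((List.zipWith h ys zs).map eγ)) := by
  have key := Evals.fold_rem (X := X) (f := .cons (.tl (.hd (.var 1)))
    (.cons (.app f (.cons (.var 0) (.hd (.hd (.var 1))))) (.tl (.var 1)))) (l := .hd .arg)
    (a := .cons (.tl .arg) .nil) (d := .cons (encList (ys.map eα)) (encList (zs.map eβ)))
    (ys := ys) (eα := eα)
    (eβ := fun p : List β × List γ => .cons (encList (p.1.map eβ)) (encList (p.2.map eγ)))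
    (b₀ := (zs, []))
    (g := fun p y => (p.1.tail, (match p.1 with | z :: _ => [h y z] | [] => []) ++ p.2))
    (fun ys' p => p.1.length = ys'.length ∧ (∀ y ∈ ys', y ∈ ys) ∧ ∀ z ∈ p.1, z ∈ zs)
    ((Evals.arg _).hd) ((Evals.arg _).tl.cons (.nil _)) hX ⟨hlen, fun _ h => h, fun _ h => h⟩
    (by
      rintro y ys' ⟨zs', out⟩ ⟨h1, h2, h3⟩
      rcases zs' with _ | ⟨z, zs'⟩
      · simp at h1
      · refine ⟨⟨by simpa using h1, fun y' hy' => h2 y' (by simp [hy']),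
          fun z' hz' => h3 z' (by simp at hz'; simp [hz'])⟩, ?_⟩
        have := hs y (h2 y (by simp)) z (h3 z (by simp))
        exact ((Evals.var 1 _).hd.tl).cons
          ((((Evals.var 0 _).cons (Evals.var 1 _).hd.hd).app this).cons (Evals.var 1 _).tl))
  have hfold : ∀ (ys : List α) (zs : List β) (out : List γ), zs.length = ys.length →
      ys.foldl (fun p y => (p.1.tail, (match p.1 with | z :: _ => [h y z] | [] => []) ++ p.2))
        (zs, out) = (([] : List β), (List.zipWith h ys zs).reverse ++ out) := by
    intro ys
    induction ys with
    | nil =>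
      intro zs out hz
      rw [List.length_nil, List.length_eq_zero_iff] at hz
      subst hz
      rfl
    | cons y ys ih =>
      intro zs out hz
      rcases zs with _ | ⟨z, zs⟩
      · simp at hz
      · rw [List.foldl_cons]
        have := ih zs ([h y z] ++ out) (by simpa using hz)
        simp only [List.tail_cons]
        rw [this]
        simp
  rw [hfold ys zs [] hlen] at key
  have h2 := key.tl.app (evals_rev (by simp; omega))
  rw [Ex.zipE]
  convert h2 using 2
  simp

theorem evals_mapE {α β : Type*} {f l : Ex} {d : Data} {ys : List α} {h : α → β}
    {eα : α → Data} {eβ : β → Data} (hl : Evals X l d (encList (ys.map eα)))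
    (hs : ∀ y ∈ ys, Evals X f (.cons (eα y) d) (eβ (h y))) (hX : ys.length ≤ X) :
    Evals X (Ex.mapE f l) d (encList ((ys.map h).map eβ)) := by
  have key := Evals.fold (X := X) (f := .cons (.app f (.cons (.var 0) (.tl (.tl .arg)))) (.var 1))
    (l := l) (a := .nil) (d := d) (ys := ys) (eα := eα)
    (eβ := fun p : List β => encList (p.map eβ)) (b₀ := []) (g := fun p y => h y :: p)
    (fun _ => True) hl (.nil _) hX trivial
    (fun y hy p _ => ⟨trivial,
      (((Evals.var 0 _).cons (Evals.arg _).tl.tl).app (hs y hy)).cons (Evals.var 1 _)⟩)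
  have hfold : ∀ (ys : List α) (p : List β), ys.foldl (fun p y => h y :: p) p =
      (ys.map h).reverse ++ p := by
    intro ys
    induction ys with
    | nil => intro p; rfl
    | cons y ys ih => intro p; rw [List.foldl_cons, ih]; simp
  rw [hfold] at key
  have h2 := key.app (evals_rev (by simpa using hX))
  rw [Ex.mapE]
  convert h2 using 2
  simp

end

section

variable {q : ℕ}

/-! ### Rows, vectors and matrices as trees; the trace -/

/-- Lists of scalars as trees. -/
def encRow (r : List (ZMod q)) : Data := encList (r.map encField)

/-- Lists of lists of scalars as trees. -/
def encRows (rs : List (List (ZMod q))) : Data := encList (rs.map encRow)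

theorem encVec_eq {n : ℕ} (v : Fin n → ZMod q) : encVec v = encRow (List.ofFn v) := by
  simp only [encVec, encRow, List.map_ofFn]
  rfl

theorem encMat_eq {n : ℕ} (M : Matrix (Fin n) (Fin n) (ZMod q)) :
    encMat M = encList ((List.ofFn fun i => M i).map encVec) := by
  simp only [encMat, List.map_ofFn]
  rfl

theorem zipWith_ofFn {α β γ : Type*} (h : α → β → γ) {n : ℕ} (a : Fin n → α) (b : Fin n → β) :
    List.zipWith h (List.ofFn a) (List.ofFn b) = List.ofFn fun i => h (a i) (b i) := by
  apply List.ext_getElem <;> simp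

variable [Fact q.Prime] {X : ℕ}

theorem evals_addRow (hq : q ≤ X) {r s : List (ZMod q)} (hrs : s.length = r.length)
    (hr : r.length ≤ X) :
    Evals X (Ex.addV q) (.cons (encRow r) (encRow s)) (encRow (List.zipWith (· + ·) r s)) :=
  evals_zipE (fun _ _ _ _ => evals_addS hq _ _) hrs hr

theorem evals_addV (hq : q ≤ X) {n : ℕ} (hn : n ≤ X) (v w : Fin n → ZMod q) :
    Evals X (Ex.addV q) (.cons (encVec v) (encVec w)) (encVec (v + w)) := by
  have := evals_addRow hq (r := List.ofFn v) (s := List.ofFn w) (by simp) (by simpa using hn)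
  rw [zipWith_ofFn] at this
  simp only [encVec_eq]
  exact this

theorem evals_addM (hq : q ≤ X) {n : ℕ} (hn : n ≤ X) (M N : Matrix (Fin n) (Fin n) (ZMod q)) :
    Evals X (Ex.addM q) (.cons (encMat M) (encMat N)) (encMat (M + N)) := by
  have := evals_zipE (X := X) (f := Ex.addV q) (ys := List.ofFn fun i => M i)
    (zs := List.ofFn fun i => N i) (h := fun v w : Fin n → ZMod q => v + w) (eα := encVec)
    (eβ := encVec) (eγ := encVec) (fun v _ w _ => evals_addV hq hn v w) (by simp) (by simpa using hn)
  rw [zipWith_ofFn] at this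
  simp only [encMat_eq]
  exact this

/-- This is random access with a unary index. Applied to a numeral it is truncated subtraction, and
so also the test for strict inequality. -/
theorem evals_drop {l : List Data} {d : Data} {e c : Ex} {k : ℕ} (hc : Evals X c d (encNat k))
    (he : Evals X e d (encList l)) (hk : k ≤ X) :
    Evals X (.fold (.tl (.var 1)) c e) d (encList (l.drop k)) := by
  have := Evals.fold (X := X) (f := .tl (.var 1)) (l := c) (a := e)
    (d := d) (ys := List.replicate k ()) (eα := fun _ => .nil) (eβ := encList) (b₀ := l)
    (g := fun b _ => b.tail) (fun _ => True) (by simpa [encNat] using hc) he (by simpa using hk)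
    trivial (fun y _ b _ => ⟨trivial, by
      have := (Evals.var (X := X) 1 (.cons .nil (.cons (encList b) d))).tl
      convert this using 1
      cases b <;> rfl⟩)
  convert this using 2
  clear hc hk this he
  induction k generalizing l with
  | zero => rfl
  | succ k ih => rw [List.replicate_succ, List.foldl_cons, ← ih, List.drop_tail]

theorem evals_trace (hq : q ≤ X) {n : ℕ} (hn : n ≤ X) (M : Matrix (Fin n) (Fin n) (ZMod q)) :
    Evals X (Ex.trace q) (encMat M) (encField M.trace) := by
  have key := Evals.fold_rem (X := X) (f := (.cons (.app (.addS q)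
      (.cons (.hd (.fold (.tl (.var 1)) (.tl (.var 1)) (.var 0))) (.hd (.var 1))))
      (.cons .nil (.tl (.var 1))))) (l := .arg) (a := .cons .nil .nil) (d := encMat M)
    (ys := List.finRange n) (eα := fun i => encVec (M i))
    (eβ := fun p : ZMod q × ℕ => .cons (encField p.1) (encNat p.2)) (b₀ := (0, 0))
    (g := fun p i => (M i i + p.1, p.2 + 1))
    -- The counter must agree with the index of the current row, since it selects the diagonal entry
    -- within that row.
    (fun ys p => ys = (List.finRange n).drop p.2)
    (by convert Evals.arg _; rw [encMat, List.ofFn_eq_map])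
    (by
      have : encField (0 : ZMod q) = .nil := by simp [encField, encNat_zero]
      rw [this]
      exact (Evals.nil _).cons (.nil _))
    (by simpa using hn) rfl
    (by
      rintro i ys ⟨s, k⟩ hys
      simp only at hys
      have hk : k < n := by
        by_contra h
        rw [List.drop_eq_nil_of_le (by simpa using h)] at hys
        simp at hys
      rw [List.drop_eq_getElem_cons (by simpa using hk)] at hys
      simp only [List.getElem_finRange, List.cons.injEq] at hys
      obtain ⟨rfl, rfl⟩ := hys
      refine ⟨rfl, ?_⟩
      set i : Fin n := Fin.cast (by simp) (⟨k, by simpa using hk⟩ : Fin (List.finRange n).length)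
      have hd : Evals X (.hd (.fold (.tl (.var 1)) (.tl (.var 1)) (.var 0)))
          (.cons (encVec (M i)) (.cons (.cons (encField s) (encNat k)) (encMat M)))
          (encField (M i i)) := by
        have := (evals_drop (X := X) (k := k) (e := .var 0) (c := .tl (.var 1))
          (d := .cons (encVec (M i)) (.cons (.cons (encField s) (encNat k)) (encMat M)))
          (l := List.ofFn fun j => encField (M i j)) (Evals.var 1 _).tl (Evals.var 0 _)
          (by omega)).hd
        convert this using 1
        rw [List.drop_eq_getElem_cons (by simpa using hk)]
        simp only [encList, Data.hd_cons, List.getElem_ofFn]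
        rfl
      exact (((hd.cons (Evals.var 1 _).hd).app (evals_addS hq _ _)).cons
        ((Evals.nil _).cons (Evals.var 1 _).tl)))
  have hfold : ∀ (l : List (Fin n)) (s : ZMod q) (k : ℕ),
      (l.foldl (fun (p : ZMod q × ℕ) i => (M i i + p.1, p.2 + 1)) (s, k)).1 =
        s + (l.map fun i => M i i).sum := by
    intro l
    induction l with
    | nil => intro s k; simp
    | cons i l ih => intro s k; rw [List.foldl_cons, ih]; simp; ring
  have h2 := key.hd
  rw [Data.hd_cons, hfold, zero_add] at h2
  have : Matrix.trace M = ((List.finRange n).map fun i => M i i).sum := by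
    rw [Matrix.trace, ← List.ofFn_eq_map, List.sum_ofFn]
    rfl
  rw [this]
  exact h2

end


open scoped NNReal
open Distr

/-! ### Gauss–Jordan elimination on lists -/

section Gauss

variable {F : Type*} [Field F]

/-- Dot product of lists. -/
def dot (r w : List F) : F := (List.zipWith (· * ·) r w).sum

/-- Subtract a multiple of a row `p` with head `1` so that the head vanishes, and remove the
head. -/
def elimRow (p r : List F) : List F := (List.zipWith (fun a b => a - r.headD 0 * b) r p).tail

/-- The multiple with head `1`. -/
def normRow (p : List F) : List F := p.map fun a => (p.headD 0)⁻¹ * a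

@[simp] theorem dot_cons (a y : F) (r w : List F) : dot (a :: r) (y :: w) = a * y + dot r w := by
  simp [dot]

@[simp] theorem dot_nil (w : List F) : dot [] w = 0 := by simp [dot]

theorem dot_append {r r' w w' : List F} (h : r.length = w.length) :
    dot (r ++ r') (w ++ w') = dot r w + dot r' w' := by
  simp [dot, List.zipWith_append h]

theorem dot_reverse {r w : List F} (h : r.length = w.length) :
    dot r.reverse w.reverse = dot r w := by
  rw [dot, ← List.reverse_zipWith h, List.sum_reverse, dot]

theorem dot_sub_mul (c : F) : ∀ (r t w : List F), r.length = t.length →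
    dot (List.zipWith (fun a b => a - c * b) r t) w = dot r w - c * dot t w
  | [], [], w, _ => by simp
  | a :: r, b :: t, [], _ => by simp [dot]
  | a :: r, b :: t, y :: w, h => by
    rw [List.zipWith_cons_cons, dot_cons, dot_cons, dot_cons, dot_sub_mul c r t w (by simpa using h)]
    ring

/-- The equations for the remaining unknowns (and `-1`) `w` and the eliminated unknowns `zs`. -/
def Solves (solved rows : List (List F)) (zs w : List F) : Prop :=
  (∀ r ∈ rows, dot r w = 0) ∧ List.Forall₂ (fun r z => z + dot r w = 0) solved zs

theorem length_elimRow {p r : List F} (h : p.length = r.length) :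
    (elimRow p r).length = r.length - 1 := by
  simp [elimRow, h]

/-- The hypothesis gives `y = -dot t w`, and elimination is the substitution of this value for the
leading unknown. -/
theorem dot_elimRow {t r w : List F} {y : F} (h : r.length = t.length + 1) (hy : y + dot t w = 0) :
    dot (elimRow (1 :: t) r) w = dot r (y :: w) := by
  rcases r with _ | ⟨a, r⟩
  · simp at h
  · simp only [elimRow, List.headD_cons, List.zipWith_cons_cons, List.tail_cons, dot_cons]
    rw [dot_sub_mul a r t w (by simpa using h)]
    linear_combination -a * hy

theorem dot_normRow (p w : List F) : dot (normRow p) w = (p.headD 0)⁻¹ * dot p w := by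
  unfold normRow dot
  generalize (p.headD 0)⁻¹ = c
  induction p generalizing w with
  | nil => simp
  | cons a p ih =>
    cases w with
    | nil => simp
    | cons y w =>
      simp only [List.map_cons, List.zipWith_cons_cons, List.sum_cons, ih]
      ring

theorem normRow_eq {p : List F} (h : p.headD 0 ≠ 0) : normRow p = 1 :: (normRow p).tail := by
  cases p with
  | nil => simp at h
  | cons a p =>
    simp only [List.headD_cons] at h
    simp [normRow, h]

/-- The rows of the system `R x = v`, with the unknowns in reverse order. -/
def systemRows {n : ℕ} (R : Matrix (Fin n) (Fin n) F) (v : Fin n → F) : List (List F) :=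
  List.ofFn fun i => (List.ofFn (R i)).reverse ++ [v i]

/-- The right-hand side is the coefficient of an extra unknown fixed at `-1`, which makes the
equations homogeneous. Unknowns are listed backwards because solved rows are pushed to the front:
the last unknown eliminated is the first coordinate. -/
theorem solves_systemRows {n : ℕ} (R : Matrix (Fin n) (Fin n) F) (v x : Fin n → F) :
    Solves [] (systemRows R v) [] ((List.ofFn x).reverse ++ [-1]) ↔ R.mulVec x = v := by
  simp only [Solves, systemRows, List.forall₂_nil_left_iff, and_true, List.forall_mem_ofFn_iff]
  rw [funext_iff]
  refine forall_congr' fun i => ?_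
  rw [dot_append (by simp), dot_reverse (by simp)]
  have : dot (List.ofFn (R i)) (List.ofFn x) = R.mulVec x i := by
    rw [dot, zipWith_ofFn, List.sum_ofFn]
    rfl
  rw [this, dot_cons, dot_nil]
  constructor
  · intro h; linear_combination h
  · intro h; linear_combination h

variable [DecidableEq F]

/-- Accumulating the result of `findPivot`. -/
def pivotStep (s : Option (List F) × List (List F)) (r : List F) :
    Option (List F) × List (List F) :=
  match s.1 with
  | some p => (some p, r :: s.2)
  | none => if r.headD 0 = 0 then (none, r :: s.2) else (some r, s.2)

/-- The first row with nonzero head, and the other rows. -/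
def findPivot (rows : List (List F)) : Option (List F) × List (List F) :=
  rows.foldl pivotStep (none, [])

/-- Eliminate one unknown. The first component of the state consists of rows solved for the
unknowns that have been eliminated; it is emptied if there is no pivot. -/
def gaussStep (s : List (List F) × List (List F)) : List (List F) × List (List F) :=
  match findPivot s.2 with
  | (some p, rest) =>
    ((normRow p).tail :: s.1.map (elimRow (normRow p)), rest.map (elimRow (normRow p)))
  | (none, _) => ([], [])

theorem foldl_pivotStep (l : List (List F)) : ∀ s : Option (List F) × List (List F),
    (∀ p, s.1 = some p → p.headD 0 ≠ 0) → (s.1 = none → ∀ r ∈ s.2, r.headD 0 = 0) →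
    (s.1.toList ++ s.2 ++ l).Perm
      ((l.foldl pivotStep s).1.toList ++ (l.foldl pivotStep s).2) ∧
    (∀ p, (l.foldl pivotStep s).1 = some p → p.headD 0 ≠ 0) ∧
    ((l.foldl pivotStep s).1 = none → ∀ r ∈ (l.foldl pivotStep s).2, r.headD 0 = 0) := by
  induction l with
  | nil => intro s h1 h2; exact ⟨by simp, h1, h2⟩
  | cons r l ih =>
    rintro ⟨o, acc⟩ h1 h2
    rw [List.foldl_cons]
    have hperm : (o.toList ++ acc ++ r :: l).Perm
        ((pivotStep (o, acc) r).1.toList ++ (pivotStep (o, acc) r).2 ++ l) := by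
      cases o with
      | some p =>
        simp only [pivotStep, Option.toList_some, List.cons_append, List.nil_append]
        exact List.Perm.cons _ List.perm_middle
      | none =>
        simp only [pivotStep]
        split_ifs <;> simp [List.perm_middle]
    have h1' : ∀ p, (pivotStep (o, acc) r).1 = some p → p.headD 0 ≠ 0 := by
      cases o with
      | some p => exact h1
      | none =>
        intro p hp
        simp only [pivotStep] at hp
        split_ifs at hp with h
        simp only [Option.some.injEq] at hp
        exact hp ▸ h
    have h2' : (pivotStep (o, acc) r).1 = none →
        ∀ r' ∈ (pivotStep (o, acc) r).2, r'.headD 0 = 0 := by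
      cases o with
      | some p => intro h; simp [pivotStep] at h
      | none =>
        intro hp
        simp only [pivotStep] at hp ⊢
        split_ifs at hp ⊢ with h
        intro r' hr'
        rcases List.mem_cons.1 hr' with rfl | hr'
        · exact h
        · exact h2 rfl r' hr'
    obtain ⟨k1, k2, k3⟩ := ih _ h1' h2'
    exact ⟨hperm.trans k1, k2, k3⟩

theorem findPivot_some {rows rest : List (List F)} {p : List F}
    (h : findPivot rows = (some p, rest)) : p.headD 0 ≠ 0 ∧ rows.Perm (p :: rest) := by
  obtain ⟨h1, h2, -⟩ := foldl_pivotStep rows (none, []) (by simp) (by simp)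
  unfold findPivot at h
  rw [h] at h1 h2
  exact ⟨h2 p rfl, by simpa using h1⟩

theorem findPivot_none {rows rest : List (List F)} (h : findPivot rows = (none, rest)) :
    ∀ r ∈ rows, r.headD 0 = 0 := by
  obtain ⟨h1, -, h3⟩ := foldl_pivotStep rows (none, []) (by simp) (by simp)
  unfold findPivot at h
  rw [h] at h1 h3
  intro r hr
  exact h3 rfl r (by simpa using h1.subset (by simpa using hr))

/-- Given the pivot equation, an eliminated row and the original row say the same; the pivot
equation itself moves to the solved rows. -/
theorem solves_gaussStep {solved rows rest : List (List F)} {p : List F} {k : ℕ}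
    (hp : findPivot rows = (some p, rest)) (hlen : ∀ r ∈ solved ++ rows, r.length = k + 1)
    (zs w : List F) (y : F) :
    Solves solved rows zs (y :: w) ↔
      Solves ((normRow p).tail :: solved.map (elimRow (normRow p)))
        (rest.map (elimRow (normRow p))) (y :: zs) w := by
  obtain ⟨h0, hperm⟩ := findPivot_some hp
  have hpl : p.length = k + 1 := hlen p (by simp [hperm.mem_iff])
  have hn := normRow_eq h0
  set t := (normRow p).tail with ht
  have htl : t.length + 1 = k + 1 := by
    rw [← hpl]
    have : (normRow p).length = p.length := by simp [normRow]
    rw [← this, hn]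
    simp
  have hpivot : dot p (y :: w) = 0 ↔ y + dot t w = 0 := by
    have := dot_normRow p (y :: w)
    rw [hn, dot_cons, one_mul] at this
    rw [this]
    simp [mul_eq_zero]
    exact fun h => absurd h (by simpa using h0)
  have hrest : ∀ r ∈ rest, r.length = t.length + 1 := fun r hr => by
    rw [htl]
    exact hlen r (by simp [hperm.mem_iff, hr])
  have hsolved : ∀ r ∈ solved, r.length = t.length + 1 := fun r hr => by
    rw [htl]
    exact hlen r (by simp [hr])
  unfold Solves
  rw [List.forall₂_cons, hn]
  have h1 : (∀ r ∈ rows, dot r (y :: w) = 0) ↔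
      dot p (y :: w) = 0 ∧ ∀ r ∈ rest, dot r (y :: w) = 0 := by
    simp [hperm.mem_iff]
  rw [h1, hpivot, List.forall₂_map_left_iff]
  constructor
  · rintro ⟨⟨hy, hr⟩, hs⟩
    refine ⟨?_, hy, ?_⟩
    · intro r' hr'
      obtain ⟨r, hrr, rfl⟩ := List.mem_map.1 hr'
      rw [dot_elimRow (hrest r hrr) hy]
      exact hr r hrr
    · refine (List.forall₂_iff_zip.2 ⟨hs.length_eq, fun {r z} hz => ?_⟩)
      rw [dot_elimRow (hsolved r (List.of_mem_zip hz).1) hy]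
      exact (List.forall₂_iff_zip.1 hs).2 hz
  · rintro ⟨hr, hy, hs⟩
    refine ⟨⟨hy, ?_⟩, ?_⟩
    · intro r hrr
      rw [← dot_elimRow (hrest r hrr) hy]
      exact hr _ (List.mem_map.2 ⟨r, hrr, rfl⟩)
    · refine (List.forall₂_iff_zip.2 ⟨hs.length_eq, fun {r z} hz => ?_⟩)
      rw [← dot_elimRow (hsolved r (List.of_mem_zip hz).1) hy]
      exact (List.forall₂_iff_zip.1 hs).2 hz

theorem gaussStep_length {solved rows rest : List (List F)} {p : List F} {k : ℕ}
    (hp : findPivot rows = (some p, rest)) (hlen : ∀ r ∈ solved ++ rows, r.length = k + 2) :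
    rest.length + 1 = rows.length ∧
    ∀ r ∈ ((normRow p).tail :: solved.map (elimRow (normRow p))) ++
      rest.map (elimRow (normRow p)), r.length = k + 1 := by
  obtain ⟨h0, hperm⟩ := findPivot_some hp
  refine ⟨by simpa using hperm.length_eq.symm, ?_⟩
  have hpl : p.length = k + 2 := hlen p (by simp [hperm.mem_iff])
  have hnl : (normRow p).length = k + 2 := by simp [normRow, hpl]
  intro r hr
  simp only [List.cons_append, List.mem_cons, List.mem_append, List.mem_map] at hr
  rcases hr with rfl | ⟨r, hr, rfl⟩ | ⟨r, hr, rfl⟩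
  · simp [hnl]
  · have := hlen r (by simp [hr])
    rw [length_elimRow (by omega), this]; rfl
  · have := hlen r (by simp [hperm.mem_iff, hr])
    rw [length_elimRow (by omega), this]; rfl

/-- If every column has a pivot, the solved rows end as constants and the solution is read off. If
some column has none, its unknown is free in the remaining rows and no solution is unique; whether
one exists is left open. In that case the state becomes empty, and it stays so. -/
theorem iterate_gaussStep (k : ℕ) : ∀ solved rows : List (List F), rows.length = k →
    (∀ r ∈ solved ++ rows, r.length = k + 1) →
    (∃ xs : List F, gaussStep^[k] (solved, rows) = (xs.map fun x => [x], []) ∧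
      xs.length = solved.length + k ∧ ∀ zs ys : List F, zs.length = solved.length →
        ys.length = k → (Solves solved rows zs (ys ++ [-1]) ↔ xs = ys.reverse ++ zs)) ∨
    (gaussStep^[k] (solved, rows) = ([], []) ∧ ∀ zs ys : List F, ys.length = k →
      Solves solved rows zs (ys ++ [-1]) → ∃ zs' ys' : List F, ys'.length = k ∧
        Solves solved rows zs' (ys' ++ [-1]) ∧ ys'.reverse ++ zs' ≠ ys.reverse ++ zs) := by
  induction k with
  | zero =>
    intro solved rows hrows hlen
    left
    rw [List.length_eq_zero_iff] at hrows
    subst hrows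
    have key : ∀ solved : List (List F), (∀ r ∈ solved, r.length = 1) →
        (solved = (solved.map fun r => r.headD 0).map fun x => [x]) ∧
        ∀ zs : List F, zs.length = solved.length →
        (List.Forall₂ (fun r z => z + dot r [-1] = 0) solved zs ↔
          (solved.map fun r => r.headD 0) = zs) := by
      intro solved
      induction solved with
      | nil =>
        intro _
        refine ⟨rfl, fun zs hzs => ?_⟩
        rw [List.length_nil, List.length_eq_zero_iff] at hzs
        simp [hzs]
      | cons r solved ih =>
        intro h
        obtain ⟨i1, i2⟩ := ih fun r' hr' => h r' (by simp [hr'])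
        obtain ⟨b, rfl⟩ := List.length_eq_one_iff.1 (h r (by simp))
        refine ⟨by simpa using i1, fun zs hzs => ?_⟩
        rcases zs with _ | ⟨z, zs⟩
        · simp at hzs
        · rw [List.forall₂_cons, i2 zs (by simpa using hzs)]
          simp only [dot_cons, dot_nil, List.map_cons, List.headD_cons, List.cons.injEq]
          refine and_congr_left fun _ => ⟨fun h => ?_, fun h => ?_⟩
          · linear_combination -h
          · linear_combination -h
    obtain ⟨k1, k2⟩ := key solved fun r hr => by simpa using hlen r (by simp [hr])
    refine ⟨solved.map fun r => r.headD 0, ?_, by simp, fun zs ys hzs hys => ?_⟩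
    · rw [Function.iterate_zero, id, ← k1]
    · rw [List.length_eq_zero_iff] at hys
      subst hys
      simp only [Solves, List.not_mem_nil, false_imp_iff, implies_true, true_and, List.nil_append,
        List.reverse_nil]
      exact k2 zs hzs
  | succ k ih =>
    intro solved rows hrows hlen
    rw [Function.iterate_succ_apply]
    rcases hpiv : findPivot rows with ⟨_ | p, rest⟩
    · right
      have h0 := findPivot_none hpiv
      have hstep : gaussStep (solved, rows) = ([], []) := by simp only [gaussStep, hpiv]
      have hfix : gaussStep (([], []) : List (List F) × List (List F)) = ([], []) := rfl
      refine ⟨by rw [hstep, Function.iterate_fixed hfix], fun zs ys hys hsol => ?_⟩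
      rcases ys with _ | ⟨y, ys⟩
      · simp at hys
      -- The unknown without a pivot is raised by one. The remaining rows do not see it, as their
      -- heads vanish, and the solved unknowns are recomputed from their equations.
      refine ⟨solved.map fun r => -dot r ((y + 1) :: ys ++ [-1]), (y + 1) :: ys, by simpa using hys,
        ⟨fun r hr => ?_, ?_⟩, fun heq => ?_⟩
      · rw [← hsol.1 r hr]
        have hr0 := h0 r hr
        rcases r with _ | ⟨a, r⟩
        · simp
        · simp only [List.headD_cons] at hr0
          simp [hr0]
      · rw [List.forall₂_map_right_iff, List.forall₂_same]
        intro r _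
        ring
      · have := (List.append_inj heq (by simp)).1
        simp at this
    · have hstep : gaussStep (solved, rows) = ((normRow p).tail :: solved.map (elimRow (normRow p)),
        rest.map (elimRow (normRow p))) := by simp only [gaussStep, hpiv]
      obtain ⟨hl1, hl2⟩ := gaussStep_length hpiv hlen
      rw [hstep]
      rcases ih _ _ (by simp; omega) hl2 with ⟨xs, h1, h2, h3⟩ | ⟨h1, h2⟩
      · left
        refine ⟨xs, h1, by simp at h2; omega, fun zs ys hzs hys => ?_⟩
        rcases ys with _ | ⟨y, ys⟩
        · simp at hys
        rw [List.cons_append, solves_gaussStep hpiv hlen,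
          h3 (y :: zs) ys (by simp [hzs]) (by simpa using hys)]
        simp
      · right
        refine ⟨h1, fun zs ys hys hsol => ?_⟩
        rcases ys with _ | ⟨y, ys⟩
        · simp at hys
        rw [List.cons_append, solves_gaussStep hpiv hlen] at hsol
        obtain ⟨zs', ys', h4, h5, h6⟩ := h2 (y :: zs) ys (by simpa using hys) hsol
        have := h5.2.length_eq
        rcases zs' with _ | ⟨y', zs'⟩
        · simp at this
        refine ⟨zs', y' :: ys', by simp [h4], ?_, by simpa using h6⟩
        rw [List.cons_append, solves_gaussStep hpiv hlen]
        exact h5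

/-- Solution of linear equations by elimination. -/
def solveList {n : ℕ} (R : Matrix (Fin n) (Fin n) F) (v : Fin n → F) : List F :=
  (gaussStep^[n] ([], systemRows R v)).1.map fun r => r.headD 0

/-- Unique solvability for the single right-hand side `v` already forces `R` to be injective,
because any `x - y` in the kernel could be added to the solution. So success of the elimination for
`v` decides invertibility. -/
theorem solveList_eq {n : ℕ} (R : Matrix (Fin n) (Fin n) F) (v : Fin n → F) :
    (IsUnit R → solveList R v = List.ofFn (R⁻¹.mulVec v)) ∧ (¬IsUnit R → solveList R v = []) := by
  have hof : ∀ ys : List F, ys.length = n → ∃ x : Fin n → F, ys = (List.ofFn x).reverse := by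
    intro ys hys
    refine ⟨fun i => ys.reverse[i.val]'(by simp [hys]), ?_⟩
    rw [← List.reverse_inj, List.reverse_reverse]
    apply List.ext_getElem <;> simp [hys]
  have hzs : ∀ {zs w : List F}, Solves [] (systemRows R v) zs w → zs = [] := fun h => by
    simpa using h.2
  rcases iterate_gaussStep n [] (systemRows R v) (by simp [systemRows]) (by
    simp [systemRows]) with ⟨xs, h1, h2, h3⟩ | ⟨h1, h2⟩
  · have hsol : ∀ x : Fin n → F, R.mulVec x = v ↔ xs = List.ofFn x := fun x => by
      rw [← solves_systemRows, h3 [] _ rfl (by simp)]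
      simp
    have hx : solveList R v = xs := by
      rw [solveList, h1, List.map_map]
      exact List.map_id _
    rw [hx]
    have hunit : IsUnit R := by
      rw [← Matrix.mulVec_injective_iff_isUnit]
      obtain ⟨x₀, hx₀⟩ := hof xs.reverse (by simpa using h2)
      rw [List.reverse_inj] at hx₀
      have hs₀ := (hsol x₀).2 hx₀
      intro x y hxy
      have h4 : R.mulVec (x₀ + (x - y)) = v := by
        rw [Matrix.mulVec_add, Matrix.mulVec_sub, hs₀]
        rw [show R.mulVec x = R.mulVec y from hxy, sub_self, add_zero]
      have := (hsol _).1 h4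
      rw [hx₀] at this
      have := List.ofFn_injective this
      have h5 : x - y = 0 := by simpa using this
      exact sub_eq_zero.1 h5
    refine ⟨fun _ => (hsol _).1 ?_, fun h => absurd hunit h⟩
    rw [Matrix.mulVec_mulVec, Matrix.mul_nonsing_inv _ ((Matrix.isUnit_iff_isUnit_det _).1 hunit),
      Matrix.one_mulVec]
  · have hx : solveList R v = [] := by
      rw [solveList, h1]
      rfl
    rw [hx]
    refine ⟨fun hunit => ?_, fun _ => rfl⟩
    · exfalso
      have hs : R.mulVec (R⁻¹.mulVec v) = v := by
        rw [Matrix.mulVec_mulVec,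
          Matrix.mul_nonsing_inv _ ((Matrix.isUnit_iff_isUnit_det _).1 hunit), Matrix.one_mulVec]
      rw [← solves_systemRows] at hs
      obtain ⟨zs', ys', h4, h5, h6⟩ := h2 _ _ (by simp) hs
      obtain ⟨x', rfl⟩ := hof ys' h4
      have := hzs h5
      subst this
      rw [solves_systemRows] at h5 hs
      refine h6 ?_
      rw [(Matrix.mulVec_injective_iff_isUnit.2 hunit) (h5.trans hs.symm)]

end Gauss


open scoped NNReal
open Distr

/-! ### The program for solving linear equations -/

namespace Ex

/-- Split a list of rows into a row with nonzero head and the rest. -/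
def pivotE : Ex :=
  fold (ite (hd (var 1)) (cons (hd (var 1)) (cons (var 0) (tl (var 1))))
    (ite (hd (var 0)) (cons (var 0) (tl (var 1))) (cons nil (cons (var 0) (tl (var 1))))))
    arg (cons nil nil)

/-- Scale a row to have head `1`. -/
def normE (q : ℕ) : Ex :=
  fold (ite (tl (hd (var 1))) (app (addV q) (cons (var 1) (tl (tl arg)))) (var 1))
    (const (encNat q)) arg

/-- Eliminate the head of a row by means of a row with head `1`. -/
def elimE (q : ℕ) : Ex :=
  tl (fold (ite (hd (var 1)) (app (addV q) (cons (var 1) (tl (tl (tl arg))))) (var 1))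
    (const (encNat q)) (hd arg))

/-- One step of the elimination. -/
def gaussE (q : ℕ) : Ex :=
  letE (app pivotE (tl arg))
    (ite (hd (var 0))
      (letE (app (normE q) (hd (var 0)))
        (cons (cons (tl (var 0)) (mapE (app (elimE q) (cons (var 0) (var 1))) (hd (tl (tl arg)))))
          (mapE (app (elimE q) (cons (var 0) (var 1))) (tl (var 1)))))
      (cons nil nil))

/-- The solution of a system given by the right-hand side and the matrix. -/
def solveE (q : ℕ) : Ex :=
  mapE (hd (var 0)) (hd (fold (app (gaussE q) (var 1)) (hd arg)
    (cons nil (app (zipE (fold (cons (var 0) (var 1)) (hd arg) (cons (tl arg) nil)))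
      (cons (tl arg) (hd arg))))))

end Ex

section

variable {q X : ℕ}

theorem tl_encRow (r : List (ZMod q)) : (encRow r).tl = encRow r.tail := by
  cases r <;> rfl

theorem evals_revAppend {r : List (ZMod q)} {b : ZMod q} (hr : r.length ≤ X) :
    Evals X (.fold (.cons (.var 0) (.var 1)) (.hd .arg) (.cons (.tl .arg) .nil))
      (.cons (encRow r) (encField b)) (encRow (r.reverse ++ [b])) := by
  have := Evals.fold (X := X) (f := .cons (.var 0) (.var 1)) (l := .hd .arg)
    (a := .cons (.tl .arg) .nil) (d := .cons (encRow r) (encField b)) (ys := r) (eα := encField)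
    (eβ := encRow) (b₀ := [b]) (g := fun b y => y :: b)
    (fun _ => True) (Evals.arg _).hd ((Evals.arg _).tl.cons (.nil _)) hr trivial
    (fun y _ b _ => ⟨trivial, (Evals.var _ _).cons (.var _ _)⟩)
  simpa using this

variable [Fact q.Prime]

theorem isPair_encField (a : ZMod q) : (encField a).isPair = true ↔ a ≠ 0 := by
  unfold encField
  rw [isPair_encNat]
  simp [Nat.pos_iff_ne_zero, ZMod.val_eq_zero]

theorem isPair_encField_false (a : ZMod q) : (encField a).isPair = false ↔ a = 0 := by
  rw [← Bool.not_eq_true, isPair_encField, not_not]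

theorem hd_encRow {r : List (ZMod q)} : (encRow r).hd = encField (r.headD 0) := by
  cases r with
  | nil => simp [encRow, encList, encField, encNat_zero]
  | cons a r => rfl

/-- The state of `Ex.pivotE`. -/
def encPivot (s : Option (List (ZMod q)) × List (List (ZMod q))) : Data :=
  .cons (s.1.elim .nil encRow) (encRows s.2)

theorem evals_pivotE {rows : List (List (ZMod q))} (h : ∀ r ∈ rows, r ≠ [])
    (hX : rows.length ≤ X) :
    Evals X Ex.pivotE (encRows rows) (encPivot (findPivot rows)) := by
  refine Evals.fold (eα := encRow) (eβ := encPivot) (b₀ := (none, [])) (g := pivotStep)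
    (fun s => ∀ p, s.1 = some p → p ≠ []) (.arg _) ((Evals.nil _).cons (.nil _)) hX (by simp) ?_
  rintro r hr ⟨o, acc⟩ hb
  have hrne := h r hr
  cases o with
  | some p =>
    refine ⟨hb, ?_⟩
    refine Evals.ite_true (Evals.var 1 _).hd ?_ ((Evals.var 1 _).hd.cons
      ((Evals.var 0 _).cons (Evals.var 1 _).tl))
    have := hb p rfl
    simp only [Ex.ev_var_one, encPivot, Data.hd_cons, Option.elim]
    cases p with
    | nil => exact absurd rfl this
    | cons a p => rfl
  | none =>
    refine ⟨?_, ?_⟩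
    · intro p hp
      simp only [pivotStep] at hp
      split_ifs at hp
      simp only [Option.some.injEq] at hp
      exact hp ▸ hrne
    refine Evals.ite_false (Evals.var 1 _).hd rfl ?_
    by_cases h0 : r.headD 0 = 0
    · have : pivotStep (none, acc) r = (none, r :: acc) := by simp only [pivotStep, h0, if_true]
      rw [this]
      refine Evals.ite_false (Evals.var 0 _).hd ?_
        ((Evals.nil _).cons ((Evals.var 0 _).cons (Evals.var 1 _).tl))
      rw [Ex.ev_var_zero, hd_encRow, isPair_encField_false, h0]
    · have : pivotStep (none, acc) r = (some r, acc) := by simp only [pivotStep, h0, if_false]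
      rw [this]
      refine Evals.ite_true (Evals.var 0 _).hd ?_ ((Evals.var 0 _).cons (Evals.var 1 _).tl)
      rw [Ex.ev_var_zero, hd_encRow, isPair_encField]
      exact h0

theorem zipWith_map_self {α β : Type*} (f : β → α → α) (g : α → β) (l : List α) :
    List.zipWith f (l.map g) l = l.map fun a => f (g a) a := by
  induction l <;> simp_all

/-- No inverse is computed: `p` is added to itself until the head is `1`, which first happens at the
multiple `j`, the representative of `p₀⁻¹`. All heads on the way are nonzero, so the head is `1`
exactly if its unary form has empty tail. After that the remaining rounds, up to `q`, change
nothing. -/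
theorem evals_normE (hq : q ≤ X) {p : List (ZMod q)} (hp : p.headD 0 ≠ 0) (hX : p.length ≤ X) :
    Evals X (Ex.normE q) (encRow p) (encRow (normRow p)) := by
  set p₀ := p.headD 0 with hp₀
  set j := (p₀⁻¹).val with hj
  have hjq : j < q := ZMod.val_lt _
  have hj0 : 0 < j := Nat.pos_of_ne_zero fun h => by
    rw [hj, ZMod.val_eq_zero] at h
    exact inv_ne_zero hp h
  have hjc : ((j : ℕ) : ZMod q) = p₀⁻¹ := ZMod.natCast_zmod_val _
  set mulr : ℕ → List (ZMod q) := fun k => p.map fun a => (k : ZMod q) * a with hmulr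
  have key := Evals.fold_rem (X := X) (f := .ite (.tl (.hd (.var 1)))
      (.app (.addV q) (.cons (.var 1) (.tl (.tl .arg)))) (.var 1)) (l := .const (encNat q))
    (a := .arg) (d := encRow p) (ys := List.replicate q ()) (eα := fun _ => .nil)
    (eβ := fun i : ℕ => encRow (mulr (min (i + 1) j))) (b₀ := 0) (g := fun i _ => i + 1)
    (fun ys i => ys.length + i = q)
    (by
      have := Evals.const (X := X) (refsBelow_encNat q) (encRow p)
      simpa [encNat] using this)
    (by
      -- The accumulator starts at the multiple `1`, not `0`, since a zero head would pass the test
      -- for `1`.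
      have : mulr (min (0 + 1) j) = p := by
        rw [min_eq_left (by omega), hmulr]
        simp
      rw [this]
      exact .arg _)
    (by simpa using hq) (by simp)
    (by
      intro _ ys i hi
      simp only [List.length_cons] at hi
      refine ⟨by omega, ?_⟩
      have hhd : ∀ k : ℕ, (mulr k).headD 0 = (k : ZMod q) * p₀ := by
        intro k
        rw [hmulr, hp₀]
        cases p <;> simp
      have hv : (encRow (mulr (min (i + 1) j))).hd.tl =
          encNat (((min (i + 1) j : ℕ) : ZMod q) * p₀).val.pred := by
        rw [hd_encRow, hhd, encField, tl_encNat]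
        rfl
      by_cases hij : i + 1 < j
      · have hne0 : ((i + 1 : ℕ) : ZMod q) * p₀ ≠ 0 := by
          refine mul_ne_zero ?_ hp
          intro h
          rw [ZMod.natCast_eq_zero_iff] at h
          have := Nat.le_of_dvd (by omega) h
          omega
        have hne1 : ((i + 1 : ℕ) : ZMod q) * p₀ ≠ 1 := by
          intro h
          have h1 := eq_inv_of_mul_eq_one_left h
          have h2 := congrArg ZMod.val h1
          rw [ZMod.val_natCast, Nat.mod_eq_of_lt (by omega)] at h2
          omega
        rw [min_eq_left (by omega)] at hv ⊢
        rw [min_eq_left (by omega)]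
        refine Evals.ite_true (Evals.var 1 _).hd.tl ?_ ?_
        · rw [Ex.ev_var_one, hv, isPair_encNat, decide_eq_true_eq]
          have h1 : (((i + 1 : ℕ) : ZMod q) * p₀).val ≠ 0 := by rwa [Ne, ZMod.val_eq_zero]
          have h2 : (((i + 1 : ℕ) : ZMod q) * p₀).val ≠ 1 := by
            intro h
            apply hne1
            rw [← ZMod.natCast_zmod_val (((i + 1 : ℕ) : ZMod q) * p₀), h, Nat.cast_one]
          rw [Nat.pred_eq_sub_one]
          omega
        · have := evals_addRow (X := X) hq (r := mulr (i + 1)) (s := p) (by simp [hmulr])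
            (by simpa [hmulr] using hX)
          have h2 : List.zipWith (· + ·) (mulr (i + 1)) p = mulr (i + 1 + 1) := by
            rw [hmulr]
            simp only
            rw [zipWith_map_self (· + ·)]
            refine List.map_congr_left fun a _ => ?_
            push_cast
            ring
          rw [h2] at this
          exact ((Evals.var 1 _).cons (Evals.arg _).tl.tl).app this
      · rw [min_eq_right (by omega)] at hv ⊢
        rw [min_eq_right (by omega)]
        refine Evals.ite_false (Evals.var 1 _).hd.tl ?_ (Evals.var 1 _)
        rw [Ex.ev_var_one, hv, hjc, inv_mul_cancel₀ hp, ZMod.val_one]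
        rfl)
  have hfold : ∀ (l : List Unit) (i : ℕ), l.foldl (fun i _ => i + 1) i = i + l.length := by
    intro l
    induction l with
    | nil => intro i; rfl
    | cons a l ih => intro i; rw [List.foldl_cons, ih, List.length_cons]; omega
  simp only [hfold] at key
  rw [List.length_replicate, min_eq_right (by omega)] at key
  have : mulr j = normRow p := by
    rw [hmulr, normRow, ← hp₀, ← hjc]
  rw [this] at key
  exact key

theorem zipWith_zipWith_self {α β γ : Type*} (f : γ → β → γ) (g : α → β → γ) :
    ∀ (l : List α) (l' : List β), List.zipWith f (List.zipWith g l l') l' =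
      List.zipWith (fun a b => f (g a b) b) l l'
  | [], _ => by simp
  | _ :: _, [] => by simp
  | a :: l, b :: l' => by simp [zipWith_zipWith_self f g l l']

theorem headD_zipWith {α β γ : Type*} (f : α → β → γ) {l : List α} {l' : List β} (a : α) (b : β)
    (c : γ) (h : l ≠ []) (h' : l' ≠ []) :
    (List.zipWith f l l').headD c = f (l.headD a) (l'.headD b) := by
  cases l <;> cases l' <;> simp_all

/-- The row `p`, whose head is `1`, is added until the head of the sum vanishes. This takes `j`
additions, with `j` the representative of `-r₀`, and the remaining rounds do nothing. -/
theorem evals_elimE (hq : q ≤ X) {r p : List (ZMod q)} (hp : p.headD 0 = 1)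
    (hl : p.length = r.length) (hX : r.length ≤ X) :
    Evals X (Ex.elimE q) (.cons (encRow r) (encRow p)) (encRow (elimRow p r)) := by
  set r₀ := r.headD 0 with hr₀
  set j := (-r₀).val with hj
  have hjq : j < q := ZMod.val_lt _
  have hjc : ((j : ℕ) : ZMod q) = -r₀ := ZMod.natCast_zmod_val _
  have hpne : p ≠ [] := by
    rintro rfl
    simp at hp
  have hrne : r ≠ [] := by
    rintro rfl
    rw [List.length_nil, List.length_eq_zero_iff] at hl
    exact hpne hl
  set comb : ℕ → List (ZMod q) := fun k => List.zipWith (fun a b => a + (k : ZMod q) * b) r p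
    with hcomb
  have key := Evals.fold_rem (X := X) (f := .ite (.hd (.var 1))
      (.app (.addV q) (.cons (.var 1) (.tl (.tl (.tl .arg))))) (.var 1)) (l := .const (encNat q))
    (a := .hd .arg) (d := .cons (encRow r) (encRow p)) (ys := List.replicate q ())
    (eα := fun _ => .nil)
    (eβ := fun i : ℕ => encRow (comb (min i j))) (b₀ := 0) (g := fun i _ => i + 1)
    (fun ys i => ys.length + i = q)
    (by
      have := Evals.const (X := X) (refsBelow_encNat q) (.cons (encRow r) (encRow p))
      simpa [encNat] using this)
    (by
      have : comb (min 0 j) = r := by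
        rw [Nat.zero_min, hcomb]
        simp only [Nat.cast_zero, zero_mul, add_zero]
        apply List.ext_getElem
        · simp [hl]
        · simp
      rw [this]
      exact (Evals.arg _).hd)
    (by simpa using hq) (by simp)
    (by
      intro _ ys i hi
      simp only [List.length_cons] at hi
      refine ⟨by omega, ?_⟩
      have hhd : ∀ k : ℕ, (comb k).headD 0 = r₀ + (k : ZMod q) := by
        intro k
        rw [hcomb, hr₀]
        simp only
        rw [headD_zipWith _ 0 0 _ hrne hpne, hp, mul_one]
      by_cases hij : i < j
      · rw [min_eq_left (by omega), min_eq_left (by omega)]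
        refine Evals.ite_true (Evals.var 1 _).hd ?_ ?_
        · rw [Ex.ev_var_one, hd_encRow, isPair_encField, hhd]
          intro h
          have h1 : ((i : ℕ) : ZMod q) = -r₀ := by linear_combination h
          have h2 := congrArg ZMod.val h1
          rw [ZMod.val_natCast, Nat.mod_eq_of_lt (by omega)] at h2
          omega
        · have := evals_addRow (X := X) hq (r := comb i) (s := p) (by simp [hcomb, hl])
            (by simpa [hcomb, hl] using hX)
          have h2 : List.zipWith (· + ·) (comb i) p = comb (i + 1) := by
            rw [hcomb]
            simp only
            rw [zipWith_zipWith_self (· + ·)]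
            congr 1
            funext a b
            push_cast
            ring
          rw [h2] at this
          exact ((Evals.var 1 _).cons (Evals.arg _).tl.tl.tl).app this
      · rw [min_eq_right (by omega), min_eq_right (by omega)]
        refine Evals.ite_false (Evals.var 1 _).hd ?_ (Evals.var 1 _)
        rw [Ex.ev_var_one, hd_encRow, isPair_encField_false, hhd, hjc]
        ring)
  have hfold : ∀ (l : List Unit) (i : ℕ), l.foldl (fun i _ => i + 1) i = i + l.length := by
    intro l
    induction l with
    | nil => intro i; rfl
    | cons a l ih => intro i; rw [List.foldl_cons, ih, List.length_cons]; omega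
  simp only [hfold] at key
  rw [List.length_replicate, min_eq_right (by omega)] at key
  have h2 := key.tl
  rw [tl_encRow] at h2
  have : (comb j).tail = elimRow p r := by
    rw [hcomb, elimRow, ← hr₀]
    simp only
    rw [hjc]
    congr 2
    funext a b
    ring
  rw [this] at h2
  exact h2

/-- The state of the elimination. -/
def encGauss (s : List (List (ZMod q)) × List (List (ZMod q))) : Data :=
  .cons (encRows s.1) (encRows s.2)

theorem evals_gaussE (hq : q ≤ X) {s : List (List (ZMod q)) × List (List (ZMod q))} {k : ℕ}
    (hlen : ∀ r ∈ s.1 ++ s.2, r.length = k + 1) (hk : k + 1 ≤ X) (hX : s.1.length + s.2.length ≤ X) :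
    Evals X (Ex.gaussE q) (encGauss s) (encGauss (gaussStep s)) := by
  obtain ⟨solved, rows⟩ := s
  simp only at hX
  have hne : ∀ r ∈ rows, r ≠ [] := fun r hr h => by
    have := hlen r (by simp [hr])
    simp [h] at this
  have h1 := evals_pivotE (X := X) hne (by omega)
  refine Evals.letE ((Evals.arg _).tl.app h1) ?_
  rcases hpiv : findPivot rows with ⟨_ | p, rest⟩
  · have : gaussStep (solved, rows) = ([], []) := by simp only [gaussStep, hpiv]
    rw [this]
    exact Evals.ite_false (Evals.var 0 _).hd rfl ((Evals.nil _).cons (.nil _))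
  · have : gaussStep (solved, rows) = ((normRow p).tail :: solved.map (elimRow (normRow p)),
        rest.map (elimRow (normRow p))) := by simp only [gaussStep, hpiv]
    rw [this]
    obtain ⟨hp0, hperm⟩ := findPivot_some hpiv
    have hpl : p.length = k + 1 := hlen p (by simp [hperm.mem_iff])
    have hnl : (normRow p).length = k + 1 := by simp [normRow, hpl]
    have hrestlen := hperm.length_eq
    simp only [List.length_cons] at hrestlen
    have hn1 : (normRow p).headD 0 = 1 := by
      rw [normRow_eq hp0]
      rfl
    refine Evals.ite_true (Evals.var 0 _).hd ?_ ?_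
    · simp only [Ex.ev_var_zero, encPivot, Data.hd_cons, Option.elim]
      cases p with
      | nil => simp at hpl
      | cons a p => rfl
    refine Evals.letE ((Evals.var 0 _).hd.app (evals_normE hq hp0 (by omega))) ?_
    refine Evals.cons (Evals.cons ?_ ?_) ?_
    · rw [← tl_encRow]
      exact (Evals.var 0 _).tl
    · refine evals_mapE (eα := encRow) (ys := solved) (Evals.arg _).tl.tl.hd (fun r hr => ?_)
        (by omega)
      have := hlen r (by simp [hr])
      exact ((Evals.var 0 _).cons (Evals.var 1 _)).app (evals_elimE hq hn1 (by omega) (by omega))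
    · refine evals_mapE (eα := encRow) (ys := rest) (Evals.var 1 _).tl (fun r hr => ?_)
        (by omega)
      have := hlen r (by simp [hperm.mem_iff, hr])
      exact ((Evals.var 0 _).cons (Evals.var 1 _)).app (evals_elimE hq hn1 (by omega) (by omega))

theorem gaussStep_inv {s : List (List (ZMod q)) × List (List (ZMod q))} {k N : ℕ}
    (hlen : ∀ r ∈ s.1 ++ s.2, r.length = k + 2) (hN : s.1.length + s.2.length ≤ N) :
    (∀ r ∈ (gaussStep s).1 ++ (gaussStep s).2, r.length = k + 1) ∧
      (gaussStep s).1.length + (gaussStep s).2.length ≤ N := by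
  obtain ⟨solved, rows⟩ := s
  simp only at hN
  rcases hpiv : findPivot rows with ⟨_ | p, rest⟩
  · have : gaussStep (solved, rows) = ([], []) := by simp only [gaussStep, hpiv]
    rw [this]
    simp
  · have : gaussStep (solved, rows) = ((normRow p).tail :: solved.map (elimRow (normRow p)),
        rest.map (elimRow (normRow p))) := by simp only [gaussStep, hpiv]
    rw [this]
    obtain ⟨h1, h2⟩ := gaussStep_length hpiv hlen
    exact ⟨h2, by simp; omega⟩

theorem evals_solveList (hq : q ≤ X) {n : ℕ} (hn : n + 1 ≤ X) (R : Matrix (Fin n) (Fin n) (ZMod q))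
    (v : Fin n → ZMod q) :
    Evals X (Ex.solveE q) (.cons (encVec v) (encMat R)) (encRow (solveList R v)) := by
  have hrows : Evals X (.app (.zipE (.fold (.cons (.var 0) (.var 1)) (.hd .arg)
      (.cons (.tl .arg) .nil))) (.cons (.tl .arg) (.hd .arg))) (.cons (encVec v) (encMat R))
      (encRows (systemRows R v)) := by
    refine ((Evals.arg _).tl.cons (Evals.arg _).hd).app ?_
    have := evals_zipE (X := X) (f := .fold (.cons (.var 0) (.var 1)) (.hd .arg)
      (.cons (.tl .arg) .nil)) (ys := List.ofFn fun i => List.ofFn (R i)) (zs := List.ofFn v)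
      (h := fun r b => r.reverse ++ [b]) (eα := encRow) (eβ := encField) (eγ := encRow)
      (fun r hr b _ => evals_revAppend (by
        obtain ⟨i, rfl⟩ := (List.mem_ofFn' _ _).1 hr
        simp; omega)) (by simp) (by simp; omega)
    rw [zipWith_ofFn] at this
    have e : encMat R = encList ((List.ofFn fun i => List.ofFn (R i)).map encRow) := by
      rw [encMat_eq, List.map_ofFn, List.map_ofFn]
      congr 2
      funext i
      exact encVec_eq (R i)
    have e' : encVec v = encList ((List.ofFn v).map encField) := encVec_eq v
    rw [← e, ← e'] at this
    exact this
  have key := Evals.fold_rem (X := X) (f := .app (Ex.gaussE q) (.var 1)) (l := .hd .arg)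
    (a := .cons .nil _) (d := .cons (encVec v) (encMat R)) (ys := List.ofFn v) (eα := encField)
    (eβ := encGauss) (b₀ := ([], systemRows R v)) (g := fun s _ => gaussStep s)
    -- The vector `v` serves only as a counter of length `n`. Each round removes one column, so the
    -- row length is the number of remaining rounds plus one, for the right-hand side.
    (fun ys s => (∀ r ∈ s.1 ++ s.2, r.length = ys.length + 1) ∧ s.1.length + s.2.length ≤ n ∧
      ys.length ≤ n)
    (by
      have h := (Evals.arg (X := X) (.cons (encVec v) (encMat R))).hd
      rw [Data.hd_cons] at h
      have e' : encVec v = encList ((List.ofFn v).map encField) := encVec_eq v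
      rwa [← e'])
    ((Evals.nil _).cons hrows) (by simp; omega)
    (by
      refine ⟨?_, ?_, ?_⟩ <;> simp [systemRows])
    (by
      rintro y ys s ⟨h1, h2, h3⟩
      simp only [List.length_cons] at h1 h3
      obtain ⟨h4, h5⟩ := gaussStep_inv h1 h2
      exact ⟨⟨h4, h5, by omega⟩, (Evals.var 1 _).app (evals_gaussE hq h1 (by omega) (by omega))⟩)
  have hfold : ∀ (l : List (ZMod q)) (s : List (List (ZMod q)) × List (List (ZMod q))), l.foldl (fun s _ => gaussStep s) s =
      gaussStep^[l.length] s := by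
    intro l
    induction l with
    | nil => intro s; rfl
    | cons a l ih => intro s; rw [List.foldl_cons, ih, List.length_cons, Function.iterate_succ_apply]
  rw [hfold, List.length_ofFn] at key
  have hlen : (gaussStep^[n] ([], systemRows R v)).1.length ≤ X := by
    rcases iterate_gaussStep n [] (systemRows R v) (by simp [systemRows]) (by
      simp [systemRows]) with ⟨xs, h1, h2, -⟩ | ⟨h1, -⟩
    · rw [h1]
      simp at h2 ⊢
      omega
    · rw [h1]
      simp
  exact evals_mapE (h := fun r : List (ZMod q) => r.headD 0) (eα := encRow) (eβ := encField)
    key.hd (fun r _ => by rw [← hd_encRow]; exact (Evals.var 0 _).hd) hlen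

theorem evals_solveE (hq : q ≤ X) {n : ℕ} (hn : n + 1 ≤ X) {R : Matrix (Fin n) (Fin n) (ZMod q)}
    (hR : IsUnit R) (v : Fin n → ZMod q) :
    Evals X (Ex.solveE q) (.cons (encVec v) (encMat R)) (encVec (R⁻¹.mulVec v)) := by
  have := evals_solveList hq hn R v
  rwa [(solveList_eq R v).1 hR, ← encVec_eq] at this

theorem evals_solveE_of_not_isUnit (hq : q ≤ X) {n : ℕ} (hn : n + 1 ≤ X)
    {R : Matrix (Fin n) (Fin n) (ZMod q)} (hR : ¬IsUnit R) (v : Fin n → ZMod q) :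
    Evals X (Ex.solveE q) (.cons (encVec v) (encMat R)) .nil := by
  have := evals_solveList hq hn R v
  rwa [(solveList_eq R v).2 hR] at this

end


open scoped NNReal
open Distr

/-! ### Typed semantics of randomized programs -/

/-- In the environment `d`, the program `r` produces the encoding of a random value with
distribution `μ`, respecting the resource bound `X`. -/
def Samples {q : ℕ} [Fact q.Prime] {α : Type*} (X : ℕ) (r : RX q) (d : Data) (e : α → Data)
    (μ : Distr α) : Prop :=
  r.Ok X d ∧ (∀ F : Data → ℝ, ex (r.sem d) F = ex μ fun a => F (e a)) ∧
    ∀ x, Supp (r.sem d) x → ∃ a, Supp μ a ∧ e a = x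

namespace Distr

/-- Random left fold over a list. -/
def foldl {α β : Type*} (g : β → α → Distr β) : List α → β → Distr β
  | [], b => pure b
  | y :: ys, b => bind (g b y) (foldl g ys)

theorem ex_foldl_append {α β : Type*} (g : β → α → Distr β) (F : β → ℝ) (ys zs : List α) :
    ∀ b, ex (foldl g (ys ++ zs) b) F = ex (foldl g ys b) fun b' => ex (foldl g zs b') F := by
  induction ys with
  | nil => intro b; simp [foldl]
  | cons y ys ih =>
    intro b
    simp only [List.cons_append, foldl, ex_bind, ih]

end Distr

section

variable {q : ℕ} [Fact q.Prime] {X : ℕ}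

theorem Samples.det {α : Type*} {e : Ex} {d : Data} {f : α → Data} {a : α}
    (h : Evals X e d (f a)) : Samples X (.det e : RX q) d f (pure a) := by
  refine ⟨h.2, fun F => ?_, fun x hx => ⟨a, by simp, ?_⟩⟩
  · simp only [RX.sem, ex_pure, h.1]
  · simp only [RX.sem, supp_pure] at hx
    rw [hx, h.1]

theorem Samples.app {α : Type*} {r : RX q} {e : Ex} {d x : Data} {f : α → Data} {μ : Distr α}
    (h : Evals X e d x) (hr : Samples X r x f μ) : Samples X (.app r e) d f μ := by
  obtain ⟨rfl, h1⟩ := h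
  exact ⟨⟨h1, hr.1⟩, hr.2.1, hr.2.2⟩

theorem Samples.ite_true {α : Type*} {c : Ex} {r s : RX q} {d x : Data} {f : α → Data}
    {μ : Distr α} (h : Evals X c d x) (hx : x.isPair = true) (hr : Samples X r d f μ) :
    Samples X (.ite c r s) d f μ := by
  obtain ⟨rfl, h1⟩ := h
  refine ⟨⟨h1, ?_⟩, ?_, ?_⟩
  · simpa [hx] using hr.1
  · simpa [RX.sem, hx] using hr.2.1
  · simpa [RX.sem, hx] using hr.2.2

theorem Samples.ite_false {α : Type*} {c : Ex} {r s : RX q} {d x : Data} {f : α → Data}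
    {μ : Distr α} (h : Evals X c d x) (hx : x.isPair = false) (hr : Samples X s d f μ) :
    Samples X (.ite c r s) d f μ := by
  obtain ⟨rfl, h1⟩ := h
  refine ⟨⟨h1, ?_⟩, ?_, ?_⟩
  · simpa [hx] using hr.1
  · simpa [RX.sem, hx] using hr.2.1
  · simpa [RX.sem, hx] using hr.2.2

theorem Samples.letR {α β : Type*} {r s : RX q} {d : Data} {f : α → Data} {g : β → Data}
    {μ : Distr α} {k : α → Distr β} (hr : Samples X r d f μ)
    (hs : ∀ a, Supp μ a → Samples X s (.cons (f a) d) g (k a)) :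
    Samples X (.letR r s) d g (bind μ k) := by
  refine ⟨⟨hr.1, fun x hx => ?_⟩, fun F => ?_, fun x hx => ?_⟩
  · obtain ⟨a, ha, rfl⟩ := hr.2.2 x hx
    exact (hs a ha).1
  · rw [RX.sem, ex_bind, ex_bind, hr.2.1]
    exact ex_congr fun a ha => (hs a ha).2.1 F
  · rw [RX.sem, supp_bind] at hx
    obtain ⟨y, hy, hx⟩ := hx
    obtain ⟨a, ha, rfl⟩ := hr.2.2 y hy
    obtain ⟨b, hb, rfl⟩ := (hs a ha).2.2 x hx
    exact ⟨b, (supp_bind _ _ _).2 ⟨a, ha, hb⟩, rfl⟩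

theorem Samples.call {A : Com} {u : ZMod q} {e : Ex} {d x : Data} (h : Evals X e d x)
    (h1 : x.RefsBelow 0) (h2 : x.depth ≤ X) (h3 : HaltsWithin X (start A x)) :
    Samples X (.call A u e) d encField
      (ofWeights (fun a => (answer A u x a).toNNReal) (id : ZMod q → ZMod q)) := by
  obtain ⟨rfl, h0⟩ := h
  refine ⟨⟨h0, h1, h2, h3⟩, fun F => ?_, fun x hx => ?_⟩
  · rw [RX.sem, ex_ofWeights, ex_ofWeights]
    rfl
  · rw [RX.sem, supp_ofWeights] at hx
    obtain ⟨a, rfl⟩ := hx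
    exact ⟨a, (supp_ofWeights _ _ _).2 ⟨a, rfl⟩, rfl⟩

/-- The invariant is required only on accumulators that occur with the given distribution. It is
returned for the final value because the resource bounds of later stages depend on it. -/
theorem Samples.fold {α β : Type*} {f : RX q} {l a : Ex} {d : Data} {ys : List α} {eα : α → Data}
    {eβ : β → Data} {b₀ : β} {g : β → α → Distr β} (inv : List α → β → Prop)
    (hl : Evals X l d (encList (ys.map eα))) (ha : Evals X a d (eβ b₀)) (hlen : ys.length ≤ X)
    (h0 : inv ys b₀)
    (hs : ∀ y ys b, inv (y :: ys) b → (∀ b', Supp (g b y) b' → inv ys b') ∧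
      Samples X f (.cons (eα y) (.cons (eβ b) d)) eβ (g b y)) :
    Samples X (.fold f l a) d eβ (Distr.foldl g ys b₀) ∧
      ∀ b, Supp (Distr.foldl g ys b₀) b → inv [] b := by
  obtain ⟨hl1, hl2⟩ := hl
  obtain ⟨ha1, ha2⟩ := ha
  have key : ∀ (ys : List α) (b : β), inv ys b →
      (FoldAll (fun x acc => f.sem (.cons x (.cons acc d)))
        (fun x acc => f.Ok X (.cons x (.cons acc d))) (encList (ys.map eα)) (eβ b)) ∧
      (∀ F : Data → ℝ, ex (foldDist (fun x acc => f.sem (.cons x (.cons acc d)))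
        (encList (ys.map eα)) (eβ b)) F = ex (Distr.foldl g ys b) fun a => F (eβ a)) ∧
      (∀ x, Supp (foldDist (fun x acc => f.sem (.cons x (.cons acc d)))
        (encList (ys.map eα)) (eβ b)) x → ∃ a, Supp (Distr.foldl g ys b) a ∧ eβ a = x) ∧
      ∀ b', Supp (Distr.foldl g ys b) b' → inv [] b' := by
    intro ys
    induction ys with
    | nil =>
      intro b hb
      simp only [List.map_nil, encList, FoldAll, foldDist, Distr.foldl, ex_pure, supp_pure,
        forall_eq, true_and]
      exact ⟨fun _ => trivial, ⟨b, rfl, rfl⟩, hb⟩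
    | cons y ys ih =>
      intro b hb
      obtain ⟨h1, h2, h3, h4⟩ := hs y ys b hb
      simp only [List.map_cons, encList, FoldAll, foldDist, Distr.foldl, ex_bind, supp_bind]
      refine ⟨⟨h2, fun acc' hacc' => ?_⟩, fun F => ?_, ?_, ?_⟩
      · obtain ⟨b', hb', rfl⟩ := h4 acc' hacc'
        exact (ih b' (h1 b' hb')).1
      · rw [h3]
        exact ex_congr fun b' hb' => (ih b' (h1 b' hb')).2.1 F
      · rintro x ⟨z, hz, hx⟩
        obtain ⟨b', hb', rfl⟩ := h4 z hz
        obtain ⟨a, ha, rfl⟩ := (ih b' (h1 b' hb')).2.2.1 x hx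
        exact ⟨a, ⟨b', hb', ha⟩, rfl⟩
      · rintro b'' ⟨b', hb', hb''⟩
        exact (ih b' (h1 b' hb')).2.2.2 b'' hb''
  obtain ⟨k1, k2, k3, k4⟩ := key ys b₀ h0
  refine ⟨⟨⟨hl2, ha2, ?_, ?_⟩, ?_, ?_⟩, k4⟩
  · rw [hl1, len_encList, List.length_map]
    exact hlen
  · rw [hl1, ha1]
    exact k1
  · intro F
    rw [RX.sem, hl1, ha1]
    exact k2 F
  · intro x hx
    rw [RX.sem, hl1, ha1] at hx
    exact k3 x hx

theorem Samples.coin (hX : 5 ≤ X) (d : Data) :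
    Samples X (RX.coin q) d encField
      (ofWeights (fun a => (answer coinCom 0 .nil a).toNNReal) (id : ZMod q → ZMod q)) := by
  classical
  exact Samples.call (Evals.nil d) trivial (Nat.zero_le _) ((val_coinCom ∅).1.mono hX)

end

/-! ### Programs for numbers and for lists of multiples -/

namespace Ex

/-- `n + k` for unary `k` and `n`. -/
def plus (c e : Ex) : Ex := fold (cons nil (var 1)) c e

/-- For a unary number `t > 0`, the least unary `k` with `t ≤ q ^ k`. -/
def logE (q : ℕ) : Ex :=
  tl (fold (ite (fold (tl (var 1)) (hd (var 1)) (tls 2 arg))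
    (cons (fold (plus (hd (var 3)) (var 1)) (const (encNat q)) nil) (cons nil (tl (var 1))))
    (var 1)) arg (cons (cons nil nil) nil))

/-- `a * k ^ j`, where `k` is the length of the list `arg`. -/
def powE (a : ℕ) : ℕ → Ex
  | 0 => const (encNat a)
  | j + 1 => letE (powE a j) (fold (plus (var 2) (var 1)) (tl arg) nil)

/-- For every member `p` of the list `l`, a loop of length `q` that starts with `init` in the
environment `p, arg`; for each of its states `s` it collects the value of `out` in the
environment `s, p, arg` and computes the next state by `step`. -/
def spreadE (q : ℕ) (init out step l : Ex) : Ex :=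
  fold (tl (fold
    (letE (cons (hd (var 1)) (cons (var 2) (tls 4 arg)))
      (cons (app step (var 0)) (cons (app out (var 0)) (tl (var 2)))))
    (const (encNat q)) (cons (app init (cons (var 0) (tls 2 arg))) (var 1)))) l nil

/-- In the environment `z, o, k`: the list `z, …, z` of length `k` and the `k` lists of length
`k` with one member `o` and all others equal to `z`. -/
def spotsE : Ex :=
  fold (cons (cons (var 2) (hd (var 1)))
    (cons (cons (var 3) (hd (var 1))) (mapE (cons (var 3) (var 0)) (tl (var 1)))))
    (tls 2 arg) (cons nil nil)

end Ex

section

variable {X : ℕ}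

theorem Evals.tls {e : Ex} {d x : Data} (h : Evals X e d x) (k : ℕ) :
    Evals X (.tls k e) d (Data.tl^[k] x) := by
  induction k with
  | zero => exact h
  | succ k ih =>
    rw [Function.iterate_succ_apply']
    exact ih.tl

theorem Evals.constNat (k : ℕ) (d : Data) :
    Evals X (.const (encNat k)) d (encList ((List.replicate k ()).map fun _ => .nil)) := by
  have := Evals.const (X := X) (refsBelow_encNat k) d
  simpa [encNat] using this

theorem foldl_add_const {α : Type*} (l : List α) (k n : ℕ) :
    l.foldl (fun b _ => b + k) n = n + l.length * k := by
  induction l generalizing n with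
  | nil => simp
  | cons y l ih => rw [List.foldl_cons, ih, List.length_cons]; ring

theorem evals_plus {c e : Ex} {d : Data} {k n : ℕ} (hc : Evals X c d (encNat k))
    (he : Evals X e d (encNat n)) (hk : k ≤ X) : Evals X (Ex.plus c e) d (encNat (n + k)) := by
  have := Evals.fold (X := X) (f := .cons .nil (.var 1)) (l := c) (a := e) (d := d)
    (ys := List.replicate k ()) (eα := fun _ => .nil) (eβ := encNat) (b₀ := n)
    (g := fun b _ => b + 1) (fun _ => True) (by simpa [encNat] using hc) he (by simpa using hk)
    trivial (fun _ _ b _ => ⟨trivial, (Evals.nil _).cons (Evals.var 1 _)⟩)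
  rwa [foldl_add_const, List.length_replicate, mul_one] at this

theorem evals_powE {a : ℕ} {l : List Data} {j : ℕ} (hX : ∀ i ≤ j, a * l.length ^ i ≤ X)
    (hl : l.length ≤ X) : Evals X (Ex.powE a j) (encList l) (encNat (a * l.length ^ j)) := by
  induction j with
  | zero => rw [pow_zero, mul_one]; exact .const (refsBelow_encNat a) _
  | succ j ih =>
    refine Evals.letE (ih fun i hi => hX i (by omega)) ?_
    have := Evals.fold (X := X) (f := .plus (.var 2) (.var 1)) (l := .tl .arg) (a := .nil)
      (d := .cons (encNat (a * l.length ^ j)) (encList l)) (ys := l) (eα := id)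
      (eβ := encNat) (b₀ := 0) (g := fun b _ => b + a * l.length ^ j)
      (fun _ => True) (by rw [List.map_id]; exact (Evals.arg _).tl) (.nil _) hl trivial
      (fun _ _ b _ => ⟨trivial, evals_plus (Evals.var 2 _) (Evals.var 1 _) (hX j (by omega))⟩)
    rw [foldl_add_const, zero_add] at this
    convert this using 2
    ring

/-- The counter rises while the power is below `t` and then stops for good. -/
theorem foldl_clog {α : Type*} {q t : ℕ} (hq : 1 < q) (l : List α) (i : ℕ) (hi : i ≤ Nat.clog q t) :
    l.foldl (fun i _ => if q ^ i < t then i + 1 else i) i = min (i + l.length) (Nat.clog q t) := by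
  induction l generalizing i with
  | nil => simp [hi]
  | cons y l ih =>
    rw [List.foldl_cons, List.length_cons]
    split_ifs with h
    · have := (Nat.lt_clog_iff_pow_lt hq).2 h
      rw [ih _ (by omega)]
      congr 1
      omega
    · have : ¬i < Nat.clog q t := fun h' => h ((Nat.lt_clog_iff_pow_lt hq).1 h')
      rw [ih _ hi]
      omega

/-- Rounding up to a power of `q` costs at most a factor `q`, which keeps the list of `q ^ k`
matrices polynomially long. -/
theorem pow_clog_le {q t : ℕ} (hq : 1 < q) (ht : 0 < t) : q ^ Nat.clog q t ≤ q * t := by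
  by_cases h : Nat.clog q t = 0
  · rw [h, pow_zero]
    exact Nat.mul_pos (by omega) ht
  · have h2 : Nat.clog q t - 1 < Nat.clog q t := by omega
    have h1 := (Nat.lt_clog_iff_pow_lt hq).1 h2
    obtain ⟨k, hk⟩ := Nat.exists_eq_succ_of_ne_zero h
    rw [hk] at h1 ⊢
    rw [pow_succ, mul_comm]
    exact Nat.mul_le_mul_left _ h1.le

theorem evals_logE {q t : ℕ} (hq : 1 < q) (ht : 0 < t) (hX : q * t ≤ X) :
    Evals X (Ex.logE q) (encNat t) (encNat (Nat.clog q t)) := by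
  have htX : t ≤ X := (Nat.le_mul_of_pos_left t (by omega)).trans hX
  have hqX : q ≤ X := (Nat.le_mul_of_pos_right q ht).trans hX
  have := Evals.fold (X := X) (f := .ite (.fold (.tl (.var 1)) (.hd (.var 1)) (.tls 2 .arg))
      (.cons (.fold (.plus (.hd (.var 3)) (.var 1)) (.const (encNat q)) .nil)
        (.cons .nil (.tl (.var 1)))) (.var 1)) (l := .arg) (a := .cons (.cons .nil .nil) .nil)
    (d := encNat t) (ys := List.replicate t ()) (eα := fun _ => .nil)
    (eβ := fun i : ℕ => .cons (encNat (q ^ i)) (encNat i)) (b₀ := 0)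
    (g := fun i _ => if q ^ i < t then i + 1 else i) (fun i => i ≤ Nat.clog q t)
    (by simpa [encNat] using Evals.arg (encNat t))
    (((Evals.nil _).cons (.nil _)).cons (.nil _)) (by simpa using htX) (Nat.zero_le _) (by
      intro _ _ i hi
      have hpX : q ^ i ≤ X :=
        ((Nat.pow_le_pow_right (by omega) hi).trans (pow_clog_le hq ht)).trans hX
      have hd := evals_drop (X := X) (c := .hd (.var 1)) (e := .tls 2 .arg) (k := q ^ i)
        (d := .cons .nil (.cons (.cons (encNat (q ^ i)) (encNat i)) (encNat t)))
        (l := List.replicate t .nil) (Evals.var 1 _).hd ((Evals.arg _).tls 2) hpX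
      rw [List.drop_replicate] at hd
      have hp : (encList (List.replicate (t - q ^ i) Data.nil)).isPair = decide (0 < t - q ^ i) :=
        isPair_encNat _
      split_ifs with h
      · refine ⟨(Nat.lt_clog_iff_pow_lt hq).2 h, Evals.ite_true hd (by rw [hp]; simp; omega) ?_⟩
        refine Evals.cons ?_ ((Evals.nil _).cons (Evals.var 1 _).tl)
        have := Evals.fold (X := X) (f := .plus (.hd (.var 3)) (.var 1)) (l := .const (encNat q))
          (a := .nil)
          (d := .cons .nil (.cons (.cons (encNat (q ^ i)) (encNat i)) (encNat t)))
          (ys := List.replicate q ()) (eα := fun _ => .nil)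
          (eβ := encNat) (b₀ := 0) (g := fun b _ => b + q ^ i)
          (fun _ => True) (Evals.constNat q _) (.nil _) (by simpa using hqX) trivial
          (fun _ _ b _ => ⟨trivial, evals_plus (Evals.var 3 _).hd (Evals.var 1 _) hpX⟩)
        rw [foldl_add_const, zero_add, List.length_replicate] at this
        rwa [pow_succ, mul_comm]
      · exact ⟨hi, Evals.ite_false hd (by rw [hp]; simp; omega) (Evals.var 1 _)⟩)
  rw [foldl_clog hq _ _ (Nat.zero_le _)] at this
  have h2 := this.tl
  rw [Data.tl_cons, List.length_replicate, zero_add, min_eq_right] at h2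
  · exact h2
  · exact (Nat.clog_le_iff_le_pow hq).2 (Nat.lt_pow_self hq).le

/-- The function computed by `Ex.spreadE`. -/
def spread {α β : Type*} (q : ℕ) (f : α → ℕ → β) (L : List α) : List β :=
  L.foldl (fun acc a => ((List.range q).map (f a)).reverse ++ acc) []

theorem evals_spreadE {α β σ : Type*} {q : ℕ} {init out step l : Ex} {d : Data} {L : List α}
    {eα : α → Data} {eβ : β → Data} {eσ : σ → Data} {s : α → ℕ → σ} {f : α → ℕ → β}
    (hl : Evals X l d (encList (L.map eα)))
    (hinit : ∀ a ∈ L, Evals X init (.cons (eα a) d) (eσ (s a 0)))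
    (hstep : ∀ a ∈ L, ∀ j, Evals X step (.cons (eσ (s a j)) (.cons (eα a) d)) (eσ (s a (j + 1))))
    (hout : ∀ a ∈ L, ∀ j, Evals X out (.cons (eσ (s a j)) (.cons (eα a) d)) (eβ (f a j)))
    (hL : L.length ≤ X) (hq : q ≤ X) :
    Evals X (Ex.spreadE q init out step l) d (encList ((spread q f L).map eβ)) := by
  refine Evals.fold (X := X) (eβ := fun acc : List β => encList (acc.map eβ))
    (g := fun acc a => ((List.range q).map (f a)).reverse ++ acc) (b₀ := [])
    (fun _ => True) hl (Evals.nil _) hL trivial ?_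
  intro a ha acc _
  refine ⟨trivial, ?_⟩
  have := Evals.fold (X := X)
    (f := .letE (.cons (.hd (.var 1)) (.cons (.var 2) (.tls 4 .arg)))
      (.cons (.app step (.var 0)) (.cons (.app out (.var 0)) (.tl (.var 2)))))
    (l := .const (encNat q)) (a := .cons (.app init (.cons (.var 0) (.tls 2 .arg))) (.var 1))
    (d := .cons (eα a) (.cons (encList (acc.map eβ)) d)) (ys := List.replicate q ())
    (eα := fun _ => .nil)
    (eβ := fun p : ℕ × List β => .cons (eσ (s a p.1)) (encList (p.2.map eβ))) (b₀ := (0, acc))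
    (g := fun p _ => (p.1 + 1, f a p.1 :: p.2)) (fun _ => True) (Evals.constNat q _)
    ((((Evals.var 0 _).cons ((Evals.arg _).tls 2)).app (hinit a ha)).cons (Evals.var 1 _))
    (by simpa using hq) trivial
    (fun _ _ p _ => ⟨trivial, Evals.letE
      ((Evals.var 1 _).hd.cons ((Evals.var 2 _).cons ((Evals.arg _).tls 4)))
      (((Evals.var 0 _).app (hstep a ha p.1)).cons
        (((Evals.var 0 _).app (hout a ha p.1)).cons (Evals.var 2 _).tl))⟩)
  have hfold : ∀ n : ℕ, (List.replicate n ()).foldl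
      (fun (p : ℕ × List β) _ => (p.1 + 1, f a p.1 :: p.2)) (0, acc) =
        (n, ((List.range n).map (f a)).reverse ++ acc) := by
    intro n
    induction n with
    | zero => rfl
    | succ n ih => simp [List.replicate_succ', List.foldl_append, ih, List.range_succ]
  rw [hfold] at this
  exact this.tl

/-- The reversals inside `spread` do not affect sums, and sums are all that the analysis of the
votes uses. -/
theorem spread_sum {α β : Type*} {q : ℕ} (f : α → ℕ → β) (Φ : β → ℝ) (L : List α) :
    ((spread q f L).map Φ).sum = (L.map fun a => ∑ j ∈ Finset.range q, Φ (f a j)).sum := by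
  have hr : ∀ F : ℕ → ℝ, ((List.range q).map F).sum = ∑ j ∈ Finset.range q, F j := fun F =>
    (Multiset.sum_coe _).symm
  have key : ∀ (L : List α) (acc : List β),
      ((L.foldl (fun acc a => ((List.range q).map (f a)).reverse ++ acc) acc).map Φ).sum =
        (L.map fun a => ∑ j ∈ Finset.range q, Φ (f a j)).sum + (acc.map Φ).sum := by
    intro L
    induction L with
    | nil => intro acc; simp
    | cons a L ih =>
      intro acc
      rw [List.foldl_cons, ih, List.map_append, List.sum_append, List.map_reverse,
        List.sum_reverse, List.map_map, List.map_cons, List.sum_cons, ← hr]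
      simp only [Function.comp_def]
      ring
  rw [spread, key]
  simp

theorem length_spread {α β : Type*} {q : ℕ} (f : α → ℕ → β) (L : List α) :
    (spread q f L).length = q * L.length := by
  have key : ∀ (L : List α) (acc : List β),
      (L.foldl (fun acc a => ((List.range q).map (f a)).reverse ++ acc) acc).length =
        q * L.length + acc.length := by
    intro L
    induction L with
    | nil => intro acc; simp
    | cons a L ih => intro acc; rw [List.foldl_cons, ih]; simp; ring
  rw [spread, key]
  simp

theorem map_spread {α β γ : Type*} {q : ℕ} (f : α → ℕ → β) (h : β → γ) (L : List α) :
    (spread q f L).map h = spread q (fun a j => h (f a j)) L := by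
  have key : ∀ (L : List α) (acc : List β),
      (L.foldl (fun acc a => ((List.range q).map (f a)).reverse ++ acc) acc).map h =
        L.foldl (fun acc a => ((List.range q).map fun j => h (f a j)).reverse ++ acc)
          (acc.map h) := by
    intro L
    induction L with
    | nil => intro acc; rfl
    | cons a L ih =>
      intro acc
      rw [List.foldl_cons, ih, List.foldl_cons]
      simp [List.map_reverse, Function.comp_def]
  exact key L []

theorem spread_map {α β γ : Type*} {q : ℕ} (f : β → ℕ → γ) (h : α → β) (L : List α) :
    spread q f (L.map h) = spread q (fun a j => f (h a) j) L := by
  rw [spread, List.foldl_map]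
  rfl

/-- Constant functions with one exceptional value. -/
theorem evals_spotsE {α : Type*} {e : α → Data} {z o : α} {n : ℕ} {l : List Data}
    (hl : l.length = n) (hX : n ≤ X) :
    Evals X Ex.spotsE (.cons (e z) (.cons (e o) (encList l)))
      (.cons (encList (List.ofFn fun _ : Fin n => e z))
        (encList (List.ofFn fun i : Fin n => encList (List.ofFn fun j : Fin n =>
          e (if j = i then o else z))))) := by
  have := Evals.fold_rem (X := X) (f := .cons (.cons (.var 2) (.hd (.var 1)))
      (.cons (.cons (.var 3) (.hd (.var 1))) (Ex.mapE (.cons (.var 3) (.var 0)) (.tl (.var 1)))))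
    (l := .tls 2 .arg) (a := .cons .nil .nil) (d := .cons (e z) (.cons (e o) (encList l)))
    (ys := l) (eα := id)
    (eβ := fun k : ℕ => .cons (encList (List.ofFn fun _ : Fin k => e z))
        (encList (List.ofFn fun i : Fin k => encList (List.ofFn fun j : Fin k =>
          e (if j = i then o else z)))))
    (b₀ := 0) (g := fun k _ => k + 1) (fun ys k => ys.length + k = n)
    (by rw [List.map_id]; exact (Evals.arg _).tls 2) ((Evals.nil _).cons (.nil _))
    (by omega) (by simpa using hl) (by
      intro y ys k hk
      simp only [List.length_cons] at hk
      refine ⟨by omega, ?_⟩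
      have hz : encList (List.ofFn fun _ : Fin (k + 1) => e z) =
          .cons (e z) (encList (List.ofFn fun _ : Fin k => e z)) := by
        rw [List.ofFn_succ]
        rfl
      rw [hz]
      refine ((Evals.var 2 _).cons (Evals.var 1 _).hd).cons ?_
      rw [List.ofFn_succ]
      refine Evals.cons ?_ ?_
      · rw [List.ofFn_succ]
        simp only [if_true, Fin.succ_ne_zero, if_false]
        exact (Evals.var 3 _).cons (Evals.var 1 _).hd
      · have hm := evals_mapE (X := X) (f := .cons (.var 3) (.var 0)) (l := .tl (.var 1))
          (d := .cons y (.cons (.cons (encList (List.ofFn fun _ : Fin k => e z))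
            (encList (List.ofFn fun i : Fin k => encList (List.ofFn fun j : Fin k =>
              e (if j = i then o else z))))) (.cons (e z) (.cons (e o) (encList l)))))
          (ys := List.finRange k)
          (eα := fun i : Fin k => encList (List.ofFn fun j : Fin k => e (if j = i then o else z)))
          (h := fun i => .cons (e z)
            (encList (List.ofFn fun j : Fin k => e (if j = i then o else z)))) (eβ := id)
          (by rw [← List.ofFn_eq_map]; exact (Evals.var 1 _).tl)
          (fun i _ => (Evals.var 3 _).cons (Evals.var 0 _)) (by simp; omega)
        rw [List.map_id, ← List.ofFn_eq_map] at hm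
        convert hm using 3
        · rfl
        funext i
        rw [List.ofFn_succ]
        simp only [(Fin.succ_ne_zero i).symm, if_false, Fin.succ_inj]
        rfl)
  have hfold : ∀ (l : List Data) (k : ℕ), l.foldl (fun k _ => k + 1) k = k + l.length := by
    intro l k
    rw [foldl_add_const, mul_one]
  rw [hfold, zero_add, hl] at this
  exact this

end


open scoped NNReal
open Distr

/-! ### Programs for the queries and for counting the votes -/

namespace Ex

/-- In the environment `R, W, V`: the query `W, R⁻¹ V`, and `nil` if `R` is singular. -/
def queryE (q : ℕ) : Ex :=
  letE (mapE (app (solveE q) (cons (var 0) (hd (tl arg)))) (tls 2 arg))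
    (ite (hd (var 0)) (cons (var 2) (var 0)) nil)

/-- Sum of pairs of a matrix and a scalar. -/
def addP (q : ℕ) : Ex :=
  cons (app (addM q) (cons (hd (hd arg)) (hd (tl arg))))
    (app (addS q) (cons (tl (hd arg)) (tl (tl arg))))

/-- In the environment `L, p`: all sums of members of `L` and multiples of `p`. -/
def extendE (q : ℕ) : Ex :=
  spreadE q (var 0) (var 0) (app (addP q) (cons (var 0) (tls 3 arg))) (hd arg)

/-- In the environment `U, L, d`: for all members `R, h` of `L` and all scalars `y` the query for
`R + y U`, together with `h` and `y`. -/
def recordsE (q : ℕ) : Ex :=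
  spreadE q (cons (hd (var 0)) nil)
    (cons (app (queryE q) (cons (hd (var 0)) (tls 4 arg))) (cons (tl (var 1)) (tl (var 0))))
    (cons (app (addM q) (cons (hd (var 0)) (var 2))) (app (inc q) (tl (var 0)))) (var 1)

/-- In the environment `x, Z`: the number of members `s, y` of `Z` with `s + y * x = 0`. -/
def countE (q : ℕ) : Ex :=
  fold (ite (fold (app (addS q) (cons (var 4) (var 1))) (tl (var 0)) (hd (var 0)))
    (var 1) (cons nil (var 1))) (tl arg) nil

/-- The scalar with the largest count. -/
def argmaxE (q : ℕ) : Ex :=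
  hd (tl (fold
    (letE (app (countE q) (cons (hd (var 1)) (tls 2 arg)))
      (ite (fold (tl (var 1)) (tl (tl (var 2))) (var 0))
        (cons (app (inc q) (hd (var 2))) (cons (hd (var 2)) (var 0)))
        (cons (app (inc q) (hd (var 2))) (tl (var 2)))))
    (const (encNat q)) (cons nil (cons nil nil))))

end Ex

section

variable {q : ℕ} {n m : ℕ}

/-- A pair of a collection of vectors and a list of vectors, as a tree. -/
def encInst (W : Data) (V : Fin m → Fin n → ZMod q) : Data :=
  .cons W (encList (List.ofFn fun i => encVec (V i)))

open Classical in
/-- The query for `R`. -/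
noncomputable def query (W : Data) (V : Fin m → Fin n → ZMod q)
    (R : Matrix (Fin n) (Fin n) (ZMod q)) : Data :=
  if IsUnit R then encInst W fun i => R⁻¹.mulVec (V i) else .nil

/-- A pair of a matrix and a scalar, as a tree. -/
def encPair (p : Matrix (Fin n) (Fin n) (ZMod q) × ZMod q) : Data :=
  .cons (encMat p.1) (encField p.2)

/-- All sums of members of `L` and multiples of `p`. -/
def extend (q : ℕ) {E : Type*} [AddCommGroup E] [Module (ZMod q) E] (L : List E) (p : E) : List E :=
  spread q (fun a j => a + (j : ZMod q) • p) L

/-- For all members `R, h` of `L` and all scalars `y` the triple `R + y U, h, y`. -/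
def records (U : Matrix (Fin n) (Fin n) (ZMod q))
    (L : List (Matrix (Fin n) (Fin n) (ZMod q) × ZMod q)) :
    List (Matrix (Fin n) (Fin n) (ZMod q) × ZMod q × ZMod q) :=
  spread q (fun p j => (p.1 + (j : ZMod q) • U, p.2, (j : ZMod q))) L

/-- A member of `records`, with the query for the matrix. -/
noncomputable def encRecord (W : Data) (V : Fin m → Fin n → ZMod q)
    (r : Matrix (Fin n) (Fin n) (ZMod q) × ZMod q × ZMod q) : Data :=
  .cons (query W V r.1) (.cons (encField r.2.1) (encField r.2.2))

/-- A pair of scalars as a tree. -/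
def encVote (z : ZMod q × ZMod q) : Data := .cons (encField z.1) (encField z.2)

/-- The number of members `s, y` of `Z` with `s + y * x = 0`. -/
def count (Z : List (ZMod q × ZMod q)) (x : ZMod q) : ℕ :=
  Z.countP fun z => z.1 + z.2 * x = 0

/-- A scalar with the largest count, together with this count, among the first `i` ones. -/
def argmaxTo (Z : List (ZMod q × ZMod q)) : ℕ → ZMod q × ℕ
  | 0 => (0, 0)
  | i + 1 => if (argmaxTo Z i).2 < count Z i then ((i : ZMod q), count Z i) else argmaxTo Z i

/-- The scalar with the largest count. -/
def argmax (Z : List (ZMod q × ZMod q)) : ZMod q := (argmaxTo Z q).1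

/-- Candidates are tried in the order `0, …, q - 1`. Before `x` no recorded count reaches that of
`x`, and after `x` none exceeds it. How ties are broken is irrelevant, as only strict winners are
analysed. -/
theorem argmax_eq [Fact q.Prime] {Z : List (ZMod q × ZMod q)} {x : ZMod q}
    (h : ∀ y, y ≠ x → count Z y < count Z x) : argmax Z = x := by
  have hpos : 0 < count Z x := (Nat.zero_le _).trans_lt (h (x + 1) (by simp))
  have key : ∀ i : ℕ, i ≤ q →
      (i ≤ x.val → (argmaxTo Z i).2 < count Z x) ∧ (x.val < i → argmaxTo Z i = (x, count Z x)) := by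
    intro i
    induction i with
    | zero => exact fun _ => ⟨fun _ => hpos, fun hx => absurd hx (Nat.not_lt_zero _)⟩
    | succ i ih =>
      intro hi
      obtain ⟨h1, h2⟩ := ih (by omega)
      have hv : ((i : ℕ) : ZMod q).val = i := by
        rw [ZMod.val_natCast, Nat.mod_eq_of_lt (by omega)]
      rw [argmaxTo]
      rcases lt_trichotomy i x.val with hlt | heq | hgt
      · refine ⟨fun _ => ?_, fun h => by omega⟩
        split_ifs
        · refine h _ fun h' => ?_
          rw [h'] at hv
          omega
        · exact h1 (by omega)
      · refine ⟨fun h => by omega, fun _ => ?_⟩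
        have hx : ((i : ℕ) : ZMod q) = x := by rw [heq, ZMod.natCast_zmod_val]
        rw [hx, if_pos (h1 (by omega))]
      · refine ⟨fun h => by omega, fun _ => ?_⟩
        rw [h2 hgt, if_neg]
        refine (h _ fun h' => ?_).le.not_gt
        rw [h'] at hv
        omega
  rw [argmax, ((key q le_rfl).2 (ZMod.val_lt x))]

end

section

variable {q : ℕ} [Fact q.Prime] {X n m : ℕ}

/-- Elimination returns the empty list for singular `R`. As `n` and `m` are positive, looking for a
pair at the head of the list of solutions separates the two cases. -/
theorem evals_queryE (hq : q ≤ X) (hn : 0 < n) (hnX : n + 1 ≤ X) (hm : 0 < m) (hmX : m ≤ X)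
    (W : Data) (V : Fin m → Fin n → ZMod q) (R : Matrix (Fin n) (Fin n) (ZMod q)) :
    Evals X (Ex.queryE q) (.cons (encMat R) (encInst W V)) (query W V R) := by
  obtain ⟨n, rfl⟩ := Nat.exists_eq_succ_of_ne_zero hn.ne'
  obtain ⟨m, rfl⟩ := Nat.exists_eq_succ_of_ne_zero hm.ne'
  have hV : Evals X (.tls 2 .arg) (.cons (encMat R) (encInst W V))
      (encList ((List.ofFn V).map encVec)) := by
    rw [List.map_ofFn]
    exact (Evals.arg _).tls 2
  by_cases hR : IsUnit R
  · have := evals_mapE (X := X) (eα := encVec) (eβ := encVec)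
      (f := .app (Ex.solveE q) (.cons (.var 0) (.hd (.tl .arg)))) (l := .tls 2 .arg)
      (h := fun v => R⁻¹.mulVec v) (ys := List.ofFn V) hV (fun v _ =>
        ((Evals.var 0 _).cons (Evals.arg _).tl.hd).app (evals_solveE hq hnX hR v))
        (by simpa using hmX)
    refine Evals.letE this ?_
    refine Evals.ite_true (Evals.var 0 _).hd ?_ ?_
    · simp only [Ex.ev_var_zero, List.map_ofFn]
      rw [List.ofFn_succ, encList, Data.hd_cons, Function.comp, encVec, List.ofFn_succ]
      rfl
    · rw [query, if_pos hR, encInst]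
      refine (Evals.var 2 _).cons ?_
      convert Evals.var 0 _ using 1
      rw [Ex.ev_var_zero, List.map_ofFn, List.map_ofFn]
      rfl
  · have := evals_mapE (X := X) (eα := encVec) (eβ := id)
      (f := .app (Ex.solveE q) (.cons (.var 0) (.hd (.tl .arg)))) (l := .tls 2 .arg)
      (h := fun _ => Data.nil) (ys := List.ofFn V) hV (fun v _ =>
        ((Evals.var 0 _).cons (Evals.arg _).tl.hd).app (evals_solveE_of_not_isUnit hq hnX hR v))
        (by simpa using hmX)
    refine Evals.letE this ?_
    rw [query, if_neg hR]
    refine Evals.ite_false (Evals.var 0 _).hd ?_ (Evals.nil _)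
    simp only [Ex.ev_var_zero, List.map_ofFn]
    rw [List.ofFn_succ]
    rfl

theorem evals_addP (hq : q ≤ X) (hnX : n ≤ X) (p r : Matrix (Fin n) (Fin n) (ZMod q) × ZMod q) :
    Evals X (Ex.addP q) (.cons (encPair p) (encPair r)) (encPair (p + r)) :=
  (((Evals.arg _).hd.hd.cons (Evals.arg _).tl.hd).app (evals_addM hq hnX _ _)).cons
    (((Evals.arg _).hd.tl.cons (Evals.arg _).tl.tl).app (evals_addS hq _ _))

theorem evals_extendE (hq : q ≤ X) (hnX : n ≤ X)
    {L : List (Matrix (Fin n) (Fin n) (ZMod q) × ZMod q)} (hL : L.length ≤ X)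
    (p : Matrix (Fin n) (Fin n) (ZMod q) × ZMod q) :
    Evals X (Ex.extendE q) (.cons (encList (L.map encPair)) (encPair p))
      (encList ((extend q L p).map encPair)) := by
  refine evals_spreadE (eα := encPair) (eσ := encPair) (s := fun a j => a + (j : ZMod q) • p)
    (Evals.arg _).hd ?_ ?_ ?_ hL hq
  · intro a _
    simp only [Nat.cast_zero, zero_smul, add_zero]
    exact Evals.var 0 _
  · intro a _ j
    have : a + ((j + 1 : ℕ) : ZMod q) • p = (a + (j : ZMod q) • p) + p := by
      rw [Nat.cast_succ, add_smul, one_smul, add_assoc]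
    rw [this]
    exact ((Evals.var 0 _).cons ((Evals.arg _).tls 3)).app (evals_addP hq hnX _ _)
  · intro a _ j
    exact Evals.var 0 _

theorem evals_recordsE (hq : q ≤ X) (hn : 0 < n) (hnX : n + 1 ≤ X) (hm : 0 < m) (hmX : m ≤ X)
    (W : Data) (V : Fin m → Fin n → ZMod q) (U : Matrix (Fin n) (Fin n) (ZMod q))
    {L : List (Matrix (Fin n) (Fin n) (ZMod q) × ZMod q)} (hL : L.length ≤ X) :
    Evals X (Ex.recordsE q) (.cons (encMat U) (.cons (encList (L.map encPair)) (encInst W V)))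
      (encList ((records U L).map (encRecord W V))) := by
  refine evals_spreadE (eα := encPair) (eσ := encPair)
    (s := fun p j => (p.1 + (j : ZMod q) • U, (j : ZMod q))) (Evals.var 1 _) ?_ ?_ ?_ hL hq
  · intro a _
    simp only [Nat.cast_zero, zero_smul, add_zero]
    have : encPair (a.1, (0 : ZMod q)) = .cons (encMat a.1) .nil := by
      simp [encPair, encField, encNat_zero]
    rw [this]
    exact (Evals.var 0 _).hd.cons (Evals.nil _)
  · intro a _ j
    have : a.1 + ((j + 1 : ℕ) : ZMod q) • U = (a.1 + (j : ZMod q) • U) + U := by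
      rw [Nat.cast_succ, add_smul, one_smul, add_assoc]
    rw [this, Nat.cast_succ]
    exact (((Evals.var 0 _).hd.cons (Evals.var 2 _)).app (evals_addM hq (by omega) _ _)).cons
      ((Evals.var 0 _).tl.app (evals_inc X _))
  · intro a _ j
    exact (((Evals.var 0 _).hd.cons ((Evals.arg _).tls 4)).app
      (evals_queryE hq hn hnX hm hmX W V _)).cons ((Evals.var 1 _).tl.cons (Evals.var 0 _).tl)

theorem evals_countE (hq : q ≤ X) (x : ZMod q) {Z : List (ZMod q × ZMod q)} (hZ : Z.length ≤ X) :
    Evals X (Ex.countE q) (.cons (encField x) (encList (Z.map encVote))) (encNat (count Z x)) := by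
  have := Evals.fold (X := X) (f := .ite (.fold (.app (.addS q) (.cons (.var 4) (.var 1)))
      (.tl (.var 0)) (.hd (.var 0))) (.var 1) (.cons .nil (.var 1))) (l := .tl .arg) (a := .nil)
    (d := .cons (encField x) (encList (Z.map encVote))) (ys := Z) (eα := encVote)
    (eβ := encNat) (b₀ := 0) (g := fun b z => if z.1 + z.2 * x = 0 then b + 1 else b)
    (fun _ => True) (Evals.arg _).tl (.nil _) hZ trivial (by
      intro z _ b _
      refine ⟨trivial, ?_⟩
      have := Evals.fold (X := X) (f := .app (.addS q) (.cons (.var 4) (.var 1)))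
        (l := .tl (.var 0)) (a := .hd (.var 0))
        (d := .cons (encVote z) (.cons (encNat b) (.cons (encField x) (encList (Z.map encVote)))))
        (ys := List.replicate z.2.val ()) (eα := fun _ => .nil) (eβ := encField (q := q))
        (b₀ := z.1) (g := fun b _ => x + b) (fun _ => True)
        (by simpa [encNat, encVote, encField] using (Evals.var (X := X) 0
          (.cons (encVote z) (.cons (encNat b) (.cons (encField x) (encList (Z.map encVote)))))).tl)
        (Evals.var 0 _).hd (by simpa using (ZMod.val_lt _).le.trans hq) trivial
        (fun _ _ b _ => ⟨trivial, ((Evals.var 4 _).cons (Evals.var 1 _)).app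
          (evals_addS hq _ _)⟩)
      have hfold : ∀ (k : ℕ) (b : ZMod q), (List.replicate k ()).foldl (fun b _ => x + b) b =
          b + k * x := by
        intro k
        induction k with
        | zero => intro b; simp
        | succ k ih =>
          intro b
          rw [List.replicate_succ, List.foldl_cons, ih]
          push_cast
          ring
      rw [hfold, ZMod.natCast_zmod_val] at this
      split_ifs with h
      · exact Evals.ite_false this ((isPair_encField_false _).2 h)
          ((Evals.nil _).cons (Evals.var 1 _))
      · exact Evals.ite_true this ((isPair_encField _).2 h) (Evals.var 1 _))
  have hfold : ∀ (Z : List (ZMod q × ZMod q)) (b : ℕ),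
      Z.foldl (fun b z => if z.1 + z.2 * x = 0 then b + 1 else b) b = b + count Z x := by
    intro Z
    induction Z with
    | nil => intro b; rfl
    | cons z Z ih =>
      intro b
      rw [List.foldl_cons, ih, count, count, List.countP_cons]
      simp only [decide_eq_true_eq]
      split_ifs <;> omega
  rw [hfold, zero_add] at this
  exact this

theorem evals_argmaxE (hq : q ≤ X) {Z : List (ZMod q × ZMod q)} (hZ : Z.length ≤ X) :
    Evals X (Ex.argmaxE q) (encList (Z.map encVote)) (encField (argmax Z)) := by
  have h0 : encField (0 : ZMod q) = .nil := by simp [encField, encNat_zero]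
  have hle : ∀ i, (argmaxTo Z i).2 ≤ X := by
    intro i
    induction i with
    | zero => exact Nat.zero_le _
    | succ i ih =>
      rw [argmaxTo]
      split_ifs
      · exact List.countP_le_length.trans hZ
      · exact ih
  have := Evals.fold (X := X) (f := .letE (.app (.countE q) (.cons (.hd (.var 1)) (.tls 2 .arg)))
      (.ite (.fold (.tl (.var 1)) (.tl (.tl (.var 2))) (.var 0))
        (.cons (.app (.inc q) (.hd (.var 2))) (.cons (.hd (.var 2)) (.var 0)))
        (.cons (.app (.inc q) (.hd (.var 2))) (.tl (.var 2)))))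
    (l := .const (encNat q)) (a := .cons .nil (.cons .nil .nil))
    (d := encList (Z.map encVote)) (ys := List.replicate q ()) (eα := fun _ => .nil)
    (eβ := fun i : ℕ => .cons (encField (i : ZMod q))
      (.cons (encField (argmaxTo Z i).1) (encNat (argmaxTo Z i).2))) (b₀ := 0)
    (g := fun i _ => i + 1) (fun _ => True) (Evals.constNat q _)
    (by
      rw [argmaxTo, Nat.cast_zero, h0]
      exact (Evals.nil _).cons ((Evals.nil _).cons (Evals.nil _)))
    (by simpa using hq) trivial (by
      intro _ _ i _
      refine ⟨trivial, ?_⟩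
      refine Evals.letE (((Evals.var 1 _).hd.cons ((Evals.arg _).tls 2)).app
        (evals_countE hq (i : ZMod q) hZ)) ?_
      -- The new count is compared with the best one so far by truncated subtraction of unary
      -- numbers.
      have hd := evals_drop (X := X) (c := .tl (.tl (.var 2))) (e := .var 0)
        (k := (argmaxTo Z i).2)
        (d := .cons (encNat (count Z i)) (.cons .nil (.cons (.cons (encField (i : ZMod q))
          (.cons (encField (argmaxTo Z i).1) (encNat (argmaxTo Z i).2)))
            (encList (Z.map encVote)))))
        (l := List.replicate (count Z i) .nil) (Evals.var 2 _).tl.tl (Evals.var 0 _) (hle i)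
      rw [List.drop_replicate] at hd
      have hp : (encList (List.replicate (count Z i - (argmaxTo Z i).2) Data.nil)).isPair =
        decide (0 < count Z i - (argmaxTo Z i).2) := isPair_encNat _
      rw [argmaxTo, Nat.cast_succ]
      split_ifs with h
      · exact Evals.ite_true hd (by rw [hp]; simp; omega)
          (((Evals.var 2 _).hd.app (evals_inc X _)).cons
            ((Evals.var 2 _).hd.cons (Evals.var 0 _)))
      · exact Evals.ite_false hd (by rw [hp]; simp; omega)
          (((Evals.var 2 _).hd.app (evals_inc X _)).cons (Evals.var 2 _).tl))
  rw [foldl_add_const, List.length_replicate, zero_add, mul_one] at this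
  exact this.tl.hd

end


open scoped NNReal
open Distr

/-! ### The randomized programs -/

namespace Distr

/-- Iterated random experiments. -/
def iter {β : Type*} (g : β → Distr β) : ℕ → β → Distr β
  | 0, b => pure b
  | k + 1, b => bind (g b) (iter g k)

theorem foldl_const {α β : Type*} (g : β → Distr β) (ys : List α) :
    ∀ b, foldl (fun b _ => g b) ys b = iter g ys.length b := by
  induction ys with
  | nil => intro b; rfl
  | cons y ys ih =>
    intro b
    simp only [foldl, iter, List.length_cons]
    congr 1
    funext b'
    exact ih b'

theorem ex_iter_succ {β : Type*} (g : β → Distr β) (F : β → ℝ) (k : ℕ) :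
    ∀ b, ex (iter g (k + 1) b) F = ex (iter g k b) fun b' => ex (g b') F := by
  induction k with
  | zero =>
    intro b
    simp only [iter, ex_bind, ex_pure]
  | succ k ih =>
    intro b
    rw [iter, ex_bind, iter, ex_bind]
    simp only [ih]

/-- Independent samples, written in front of a list. -/
def repeatFrom {α : Type*} (μ : Distr α) (k : ℕ) (acc : List α) : Distr (List α) :=
  iter (fun acc => bind μ fun a => pure (a :: acc)) k acc

/-- A tuple of independent samples. -/
def tuple {α : Type*} [Inhabited α] (μ : Distr α) (n : ℕ) : Distr (Fin n → α) :=
  bind (repeatFrom μ n []) fun l => pure fun i => l.getD i default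

/-- Independent samples from distributions that depend on the members of a list. -/
def mapD {α β : Type*} (k : α → Distr β) (ys : List α) : Distr (List β) :=
  foldl (fun acc y => bind (k y) fun b => pure (b :: acc)) ys.reverse []

end Distr

namespace RX

variable {q : ℕ}

/-- As many samples of `r` as the head of the second component of the environment has members. -/
def repeatR (r : RX q) : RX q :=
  fold (letR (app r (.tls 2 .arg)) (det (.cons (.var 0) (.var 2)))) (.hd (.tl .arg)) .nil

/-- Apply `r` to the members of the list `l`; the environment of `r` is extended by the member. -/
def mapR (r : RX q) (l : Ex) : RX q :=
  fold (letR (app r (.cons (.var 0) (.tls 2 .arg))) (det (.cons (.var 0) (.var 2))))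
    (.app .rev l) .nil

/-- An almost uniformly random scalar. -/
def scalarR (q : ℕ) : RX q :=
  fold (letR (coin q) (det (.app (.addS q) (.cons (.var 0)
    (.app (.addS q) (.cons (.var 2) (.var 2))))))) (.tl .arg) .nil

/-- A matrix and a scalar. -/
def pairR (q : ℕ) : RX q :=
  letR (repeatR (repeatR (scalarR q))) (letR (app (scalarR q) (.tl .arg))
    (det (.cons (.var 1) (.var 0))))

/-- A list of `q ^ k` pairs that is closed under the lines through pairwise differences, with
`k` the logarithm of `a * m ^ j`. -/
def listR (q a j : ℕ) : RX q :=
  letR (pairR q) (fold (letR (app (pairR q) (.tls 3 .arg))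
    (det (.app (.extendE q) (.cons (.var 2) (.var 0)))))
    (.app (.logE q) (.app (.powE a j) (.tls 2 .arg))) (.cons (.var 0) .nil))

/-- In the environment `U, L, d`: the votes for minus the trace of `M U`. -/
def votesR (A : Com) (u : ZMod q) : RX q :=
  fold (ite (.hd (.var 0))
    (letR (call A u (.hd (.var 0)))
      (det (.cons (.cons (.app (.addS q) (.cons (.var 0) (.hd (.tl (.var 1)))))
        (.tl (.tl (.var 1)))) (.var 2))))
    (det (.var 1))) (.recordsE q) .nil

/-- In the environment `U, L, d`: the guess for minus the trace of `M U`. -/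
def entryR (A : Com) (u : ZMod q) : RX q :=
  letR (votesR A u) (det (.app (.argmaxE q) (.var 0)))

/-- The unit vectors, negated, together with the zero vector. -/
def _root_.TraceHC.Ex.unitsE (q : ℕ) : Ex :=
  .app .spotsE (.cons .nil (.cons (.const (encNat (q - 1))) (.hd (.tl .arg))))

/-- The algorithm that finds `M`. -/
def invertR (A : Com) (u : ZMod q) (a j : ℕ) : RX q :=
  letR (listR q a j)
    (mapR (mapR (app (entryR A u) (.cons (.var 0) (.tls 2 .arg)))
        (.tl (.app .spotsE (.cons (.hd (.app (.unitsE q) (.tls 2 .arg)))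
          (.cons (.var 0) (.hd (.tls 3 .arg)))))))
      (.tl (.app (.unitsE q) (.tl .arg))))

end RX

section

variable {q n m : ℕ} {V : Fin m → Fin n → ZMod q} {W : Data}

theorem evals_hd_encInst (hm : 0 < m) : ∃ xs : List Data, xs.length = n ∧
    (encInst W V).tl.hd = encList xs := by
  obtain ⟨m, rfl⟩ := Nat.exists_eq_succ_of_ne_zero hm.ne'
  refine ⟨List.ofFn fun i => encField (V 0 i), by simp, ?_⟩
  rw [encInst, List.ofFn_succ]
  rfl

theorem length_records (U : Matrix (Fin n) (Fin n) (ZMod q))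
    (L : List (Matrix (Fin n) (Fin n) (ZMod q) × ZMod q)) :
    (records U L).length = q * L.length := length_spread _ _

end

section

variable {q : ℕ} [Fact q.Prime] {X : ℕ}

theorem Samples.iter {β : Type*} {f : RX q} {l a : Ex} {d : Data} {xs : List Data}
    {eβ : β → Data} {b₀ : β} {g : β → Distr β} (inv : ℕ → β → Prop)
    (hl : Evals X l d (encList xs)) (ha : Evals X a d (eβ b₀)) (hlen : xs.length ≤ X)
    (h0 : inv xs.length b₀)
    (hs : ∀ k b x, inv (k + 1) b → (∀ b', Supp (g b) b' → inv k b') ∧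
      Samples X f (.cons x (.cons (eβ b) d)) eβ (g b)) :
    Samples X (.fold f l a) d eβ (Distr.iter g xs.length b₀) ∧
      ∀ b, Supp (Distr.iter g xs.length b₀) b → inv 0 b := by
  have := Samples.fold (X := X) (f := f) (l := l) (a := a) (d := d) (ys := xs) (eα := id)
    (eβ := eβ) (b₀ := b₀) (g := fun b _ => g b) (fun ys b => inv ys.length b)
    (by rwa [List.map_id]) ha hlen h0 (fun x ys b hb => hs ys.length b x hb)
  rwa [foldl_const] at this

theorem Samples.retype {α β : Type*} {r : RX q} {d : Data} {e : α → Data} {e' : β → Data}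
    {μ : Distr α} (h : Samples X r d e μ) (φ : α → β) (hφ : ∀ a, Supp μ a → e' (φ a) = e a) :
    Samples X r d e' (bind μ fun a => pure (φ a)) := by
  refine ⟨h.1, fun F => ?_, fun x hx => ?_⟩
  · rw [h.2.1, ex_bind]
    exact ex_congr fun a ha => by rw [ex_pure, hφ a ha]
  · obtain ⟨a, ha, rfl⟩ := h.2.2 x hx
    exact ⟨φ a, (supp_bind _ _ _).2 ⟨a, ha, by simp⟩, hφ a ha⟩

theorem Samples.tuple {α : Type*} [Inhabited α] {r : RX q} {d : Data} {e : α → Data}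
    {μ : Distr α} {xs : List Data} {n : ℕ} (h : Samples X r d e μ)
    (hd : Evals X (.hd (.tl .arg)) d (encList xs)) (hn : xs.length = n) (hX : n ≤ X) :
    Samples X (.repeatR r) d (fun v : Fin n → α => encList (List.ofFn fun i => e (v i)))
      (Distr.tuple μ n) := by
  subst hn
  obtain ⟨h1, h2⟩ := Samples.iter (X := X) (f := .letR (.app r (.tls 2 .arg))
      (.det (.cons (.var 0) (.var 2)))) (l := .hd (.tl .arg)) (a := .nil) (d := d) (xs := xs)
    (eβ := fun l : List α => encList (l.map e)) (b₀ := [])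
    (g := fun acc => bind μ fun a => pure (a :: acc))
    (fun k acc => k + acc.length = xs.length) hd (Evals.nil _) hX rfl
    (fun k acc x hk => ⟨fun acc' h' => by
      obtain ⟨a, -, h'⟩ := (supp_bind _ _ _).1 h'
      rw [supp_pure] at h'
      rw [h', List.length_cons]
      omega, Samples.letR (Samples.app ((Evals.arg _).tls 2) h) fun a _ =>
        Samples.det ((Evals.var 0 _).cons (Evals.var 2 _))⟩)
  refine h1.retype _ fun l hl => ?_
  -- Exactly `n` samples have been collected, so the default value in `Distr.tuple` never appears.
  have hlen := h2 l hl
  rw [zero_add] at hlen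
  congr 1
  apply List.ext_getElem
  · simp [hlen]
  · intro i h1 h2
    simp only [List.length_map] at h2
    simp [List.getElem?_eq_getElem h2]

theorem Samples.map {α β : Type*} {r : RX q} {l : Ex} {d : Data} {ys : List α}
    {eα : α → Data} {eβ : β → Data} {k : α → Distr β} (hl : Evals X l d (encList (ys.map eα)))
    (hs : ∀ y ∈ ys, Samples X r (.cons (eα y) d) eβ (k y)) (hX : ys.length ≤ X) :
    Samples X (.mapR r l) d (fun l : List β => encList (l.map eβ)) (mapD k ys) := by
  refine (Samples.fold (X := X) (eα := eα) (eβ := fun l : List β => encList (l.map eβ))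
    (fun ys' _ => ∀ y ∈ ys', y ∈ ys) ?_ (Evals.nil _) (by simpa using hX)
    (fun y hy => by simpa using hy) ?_).1
  · have := hl.app (evals_rev (by simpa using hX))
    rwa [← List.map_reverse] at this
  · intro y ys' acc hy
    exact ⟨fun _ _ y' hy' => hy y' (by simp [hy']),
      Samples.letR (Samples.app ((Evals.var 0 _).cons ((Evals.arg _).tls 2)) (hs y (hy y (by simp))))
        fun b _ => Samples.det ((Evals.var 0 _).cons (Evals.var 2 _))⟩

/-! ### Distributions produced by the parts of the inverter -/

/-- The distribution of `RX.coin`. -/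
noncomputable def coinD (q : ℕ) [Fact q.Prime] : Distr (ZMod q) :=
  ofWeights (fun a => (answer coinCom 0 .nil a).toNNReal) id

/-- The distribution of `RX.scalarR`. -/
noncomputable def scalarD (q : ℕ) [Fact q.Prime] (m : ℕ) : Distr (ZMod q) :=
  Distr.iter (fun a => bind (coinD q) fun b => pure (b + (a + a))) m 0

/-- The distribution of `RX.pairR`. -/
noncomputable def pairD (q : ℕ) [Fact q.Prime] (n m : ℕ) :
    Distr (Matrix (Fin n) (Fin n) (ZMod q) × ZMod q) :=
  bind (Distr.tuple (Distr.tuple (scalarD q m) n) n) fun R => bind (scalarD q m) fun h =>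
    pure (R, h)

/-- The distribution of `RX.listR`. -/
noncomputable def listD (q : ℕ) [Fact q.Prime] (n m k : ℕ) :
    Distr (List (Matrix (Fin n) (Fin n) (ZMod q) × ZMod q)) :=
  bind (pairD q n m) fun p => Distr.iter (fun L => bind (pairD q n m) fun p => pure (extend q L p))
    k [p]

open Classical in
/-- The distribution of `RX.votesR`. -/
noncomputable def votesD {n m : ℕ} (A : Com) (u : ZMod q) (W : Data)
    (V : Fin m → Fin n → ZMod q) (rs : List (Matrix (Fin n) (Fin n) (ZMod q) × ZMod q × ZMod q)) :
    Distr (List (ZMod q × ZMod q)) :=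
  Distr.foldl (fun acc r => if IsUnit r.1 then
    bind (ofWeights (fun a => (answer A u (query W V r.1) a).toNNReal) (id : ZMod q → ZMod q))
      fun a => pure ((a + r.2.1, r.2.2) :: acc) else pure acc) rs []

/-- The distribution of `RX.entryR`. -/
noncomputable def entryD {n m : ℕ} (A : Com) (u : ZMod q) (W : Data)
    (V : Fin m → Fin n → ZMod q) (L : List (Matrix (Fin n) (Fin n) (ZMod q) × ZMod q))
    (U : Matrix (Fin n) (Fin n) (ZMod q)) : Distr (ZMod q) :=
  bind (votesD A u W V (records U L)) fun Z => pure (argmax Z)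

/-- The negated unit vectors. -/
def negUnits (q n : ℕ) : List (Fin n → ZMod q) :=
  List.ofFn fun a => fun j => if j = a then -1 else 0

/-- The matrices with one row `e` and all others zero. -/
def rowMatrices {q n : ℕ} (e : Fin n → ZMod q) : List (Matrix (Fin n) (Fin n) (ZMod q)) :=
  List.ofFn fun b => Matrix.of fun i => if i = b then e else 0

/-- The distribution of `RX.invertR`. -/
noncomputable def invertD {n m : ℕ} (A : Com) (u : ZMod q) (k : ℕ) (W : Data)
    (V : Fin m → Fin n → ZMod q) : Distr (List (List (ZMod q))) :=
  bind (listD q n m k) fun L => mapD (fun e => mapD (entryD A u W V L) (rowMatrices e))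
    (negUnits q n)

theorem encField_zero : encField (0 : ZMod q) = .nil := by simp [encField, encNat_zero]

/-- Each round doubles and adds a coin, so the result is a number with random binary digits, reduced
modulo `q` along the way. One coin is tossed per member of the list at hand, here the list `V`,
which makes the bias exponentially small. -/
theorem samples_scalarR (hX : 5 ≤ X) (hq : q ≤ X) {d₁ : Data} {l : List Data} (hl : l.length ≤ X) :
    Samples X (RX.scalarR q) (.cons d₁ (encList l)) encField (scalarD q l.length) := by
  refine (Samples.iter (X := X) (fun _ _ => True) (Evals.arg _).tl ?_ hl trivial ?_).1
  · rw [encField_zero]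
    exact Evals.nil _
  · intro k b x _
    exact ⟨fun _ _ => trivial, Samples.letR (Samples.coin hX _) fun a _ =>
      Samples.det (((Evals.var 0 _).cons (((Evals.var 2 _).cons (Evals.var 2 _)).app
        (evals_addS hq b b))).app (evals_addS hq _ _))⟩

variable {n m : ℕ} {V : Fin m → Fin n → ZMod q} {W : Data}

theorem samples_pairR (hX : 5 ≤ X) (hq : q ≤ X) (hnX : n ≤ X) (hm : 0 < m) (hmX : m ≤ X) :
    Samples X (RX.pairR q) (encInst W V) encPair (pairD q n m) := by
  obtain ⟨xs, hxs, hd⟩ := evals_hd_encInst (V := V) (W := W) hm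
  have hd' : Evals X (.hd (.tl .arg)) (encInst W V) (encList xs) := by
    rw [← hd]
    exact (Evals.arg _).tl.hd
  have h1 : Samples X (RX.scalarR q) (encInst W V) encField (scalarD q m) := by
    have := samples_scalarR (q := q) hX hq (d₁ := W) (l := List.ofFn fun i => encVec (V i))
      (by simpa using hmX)
    rwa [List.length_ofFn] at this
  have h2 := (h1.tuple hd' hxs hnX).tuple hd' hxs hnX
  refine Samples.letR (f := fun R : Matrix (Fin n) (Fin n) (ZMod q) => encMat R) h2 fun R _ => ?_
  exact Samples.letR (Samples.app (Evals.arg _).tl h1) fun h _ =>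
    Samples.det ((Evals.var 1 _).cons (Evals.var 0 _))

/-- The machine is uniform, so the number of rounds is computed from the length of `V` in unary. The
exact length of the resulting list is recorded to bound the time of the vote. -/
theorem samples_listR (hX : 5 ≤ X) (hq : q ≤ X) (hnX : n ≤ X) (hm : 0 < m) (hmX : m ≤ X)
    {a j : ℕ} (ha : 0 < a) (hT : q * (a * m ^ j) ≤ X) :
    Samples X (RX.listR q a j) (encInst W V)
        (fun L : List (Matrix (Fin n) (Fin n) (ZMod q) × ZMod q) => encList (L.map encPair))
        (listD q n m (Nat.clog q (a * m ^ j))) ∧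
      ∀ L, Supp (listD q n m (Nat.clog q (a * m ^ j))) L →
        L.length = q ^ Nat.clog q (a * m ^ j) := by
  have hq2 := (Fact.out : q.Prime).two_le
  set t := a * m ^ j with ht
  have htpos : 0 < t := Nat.mul_pos ha (pow_pos hm j)
  have hqt := (pow_clog_le (by omega) htpos).trans hT
  have hp := samples_pairR (q := q) (V := V) (W := W) hX hq hnX hm hmX
  have hpow : Evals X (.app (.logE q) (.app (.powE a j) (.tls 1 .arg))) (encInst W V)
      (encList (List.replicate (Nat.clog q t) .nil)) := by
    refine Evals.app (x := encNat t) (Evals.app ((Evals.arg _).tls 1) ?_)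
      (evals_logE (by omega) htpos hT)
    have hlen : (List.ofFn fun i => encVec (V i)).length = m := List.length_ofFn
    have := evals_powE (X := X) (a := a) (l := List.ofFn fun i => encVec (V i)) (j := j) (by
      intro i hi
      rw [hlen]
      have h1 : a * m ^ i ≤ a * m ^ j := Nat.mul_le_mul_left _ (Nat.pow_le_pow_right hm hi)
      exact h1.trans ((Nat.le_mul_of_pos_left _ (by omega)).trans hT)) (by rwa [hlen])
    rw [hlen] at this
    exact this
  have step : ∀ p : Matrix (Fin n) (Fin n) (ZMod q) × ZMod q,
      Samples X (.fold (.letR (.app (RX.pairR q) (.tls 3 .arg))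
        (.det (.app (.extendE q) (.cons (.var 2) (.var 0)))))
        (.app (.logE q) (.app (.powE a j) (.tls 2 .arg))) (.cons (.var 0) .nil))
        (.cons (encPair p) (encInst W V))
        (fun L : List (Matrix (Fin n) (Fin n) (ZMod q) × ZMod q) => encList (L.map encPair))
        (Distr.iter (fun L => bind (pairD q n m) fun p => pure (extend q L p))
          (Nat.clog q t) [p]) ∧
      ∀ L, Supp (Distr.iter (fun L => bind (pairD q n m) fun p => pure (extend q L p))
          (Nat.clog q t) [p]) L → L.length = q ^ Nat.clog q t := by
    intro p
    have := Samples.iter (X := X) (f := .letR (.app (RX.pairR q) (.tls 3 .arg))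
        (.det (.app (.extendE q) (.cons (.var 2) (.var 0)))))
      (l := .app (.logE q) (.app (.powE a j) (.tls 2 .arg))) (a := .cons (.var 0) .nil)
      (d := .cons (encPair p) (encInst W V)) (xs := List.replicate (Nat.clog q t) .nil)
      (eβ := fun L : List (Matrix (Fin n) (Fin n) (ZMod q) × ZMod q) => encList (L.map encPair))
      (b₀ := [p]) (g := fun L => bind (pairD q n m) fun p => pure (extend q L p))
      (fun i L => i ≤ Nat.clog q t ∧ L.length = q ^ (Nat.clog q t - i)) ?_
      ((Evals.var 0 _).cons (Evals.nil _)) ?_ (by simp) ?_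
    · rw [List.length_replicate] at this
      exact ⟨this.1, fun L hL => (this.2 L hL).2⟩
    · exact ⟨hpow.1, hpow.2⟩
    · rw [List.length_replicate]
      exact (Nat.lt_pow_self (by omega)).le.trans hqt
    · rintro i L x ⟨hi, hL⟩
      refine ⟨fun L' hL' => ?_, Samples.letR (Samples.app ((Evals.arg _).tls 3) hp) fun p' _ =>
        Samples.det (((Evals.var 2 _).cons (Evals.var 0 _)).app (evals_extendE hq hnX ?_ p'))⟩
      · obtain ⟨p', -, h'⟩ := (supp_bind _ _ _).1 hL'
        rw [supp_pure] at h'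
        refine ⟨by omega, ?_⟩
        rw [h', extend, length_spread, hL, ← pow_succ']
        congr 1
        omega
      · rw [hL]
        exact (Nat.pow_le_pow_right (by omega) (Nat.sub_le _ _)).trans hqt
  refine ⟨Samples.letR hp fun p _ => (step p).1, fun L hL => ?_⟩
  obtain ⟨p, -, hL⟩ := (supp_bind _ _ _).1 hL
  exact (step p).2 L hL

/-- The time bound of the predictor is assumed only on queries for invertible `R`, because only
these are genuine instances. The program must therefore skip the marker `nil` of a singular matrix
before calling it. -/
theorem samples_entryR (hq : q ≤ X) (hn : 0 < n) (hnX : n + 1 ≤ X) (hm : 0 < m) (hmX : m ≤ X)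
    {A : Com} {u : ZMod q} (hA : ∀ R : Matrix (Fin n) (Fin n) (ZMod q), IsUnit R →
      (query W V R).RefsBelow 0 ∧ (query W V R).depth ≤ X ∧ HaltsWithin X (start A (query W V R)))
    {L : List (Matrix (Fin n) (Fin n) (ZMod q) × ZMod q)} (hL : q * L.length ≤ X)
    (U : Matrix (Fin n) (Fin n) (ZMod q)) :
    Samples X (RX.entryR A u) (.cons (encMat U) (.cons (encList (L.map encPair)) (encInst W V)))
      encField (entryD A u W V L U) := by
  have hq2 := (Fact.out : q.Prime).two_le
  have hLX : L.length ≤ X := (Nat.le_mul_of_pos_left _ (by omega)).trans hL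
  obtain ⟨h1, h2⟩ := Samples.fold (X := X)
    (f := .ite (.hd (.var 0))
      (.letR (.call A u (.hd (.var 0)))
        (.det (.cons (.cons (.app (.addS q) (.cons (.var 0) (.hd (.tl (.var 1)))))
          (.tl (.tl (.var 1)))) (.var 2))))
      (.det (.var 1))) (l := .recordsE q) (a := .nil)
    (d := .cons (encMat U) (.cons (encList (L.map encPair)) (encInst W V)))
    (ys := records U L) (eα := encRecord W V) (b₀ := [])
    (eβ := fun Z : List (ZMod q × ZMod q) => encList (Z.map encVote))
    (g := fun acc r => open Classical in if IsUnit r.1 then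
      bind (ofWeights (fun a => (answer A u (query W V r.1) a).toNNReal) (id : ZMod q → ZMod q))
        fun a => pure ((a + r.2.1, r.2.2) :: acc) else pure acc)
    (fun ys Z => ys.length + Z.length ≤ X)
    (evals_recordsE hq hn hnX hm hmX W V U hLX) (Evals.nil _)
    (by rwa [length_records]) (by simpa [length_records] using hL) (by
      intro r ys Z hZ
      simp only [List.length_cons] at hZ
      by_cases hr : IsUnit r.1
      · simp only [hr, if_true]
        refine ⟨fun Z' hZ' => ?_, ?_⟩
        · obtain ⟨a, -, h'⟩ := (supp_bind _ _ _).1 hZ'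
          rw [supp_pure] at h'
          rw [h', List.length_cons]
          omega
        · refine Samples.ite_true (Evals.var 0 _).hd ?_ ?_
          · simp only [Ex.ev_var_zero, encRecord, Data.hd_cons, query, hr, if_true]
            rfl
          · obtain ⟨h1, h2, h3⟩ := hA r.1 hr
            refine Samples.letR (Samples.call (x := query W V r.1) (Evals.var 0 _).hd h1 h2 h3)
              fun a _ => Samples.det ?_
            exact ((((Evals.var 0 _).cons (Evals.var 1 _).tl.hd).app
              (evals_addS hq _ _)).cons (Evals.var 1 _).tl.tl).cons (Evals.var 2 _)
      · simp only [hr, if_false]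
        refine ⟨fun Z' hZ' => ?_, ?_⟩
        · rw [supp_pure] at hZ'
          rw [hZ']
          omega
        · refine Samples.ite_false (Evals.var 0 _).hd ?_ (Samples.det (Evals.var 1 _))
          simp only [Ex.ev_var_zero, encRecord, Data.hd_cons, query, hr, if_false]
          rfl)
  exact Samples.letR h1 fun Z hZ => Samples.det ((Evals.var 0 _).app
    (evals_argmaxE hq (by have := h2 Z hZ; simpa using this)))

theorem evals_unitsE (hnX : n ≤ X) (hm : 0 < m) :
    Evals X (Ex.unitsE q) (encInst W V)
      (.cons (encVec (0 : Fin n → ZMod q)) (encList ((negUnits q n).map encVec))) := by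
  obtain ⟨xs, hxs, hd⟩ := evals_hd_encInst (V := V) (W := W) hm
  have h := evals_spotsE (X := X) (e := encField (q := q)) (z := 0) (o := -1) (l := xs) hxs hnX
  rw [encField_zero] at h
  -- The program contains the constant `q - 1` as the representative of `-1`.
  have hneg : encField (-1 : ZMod q) = encNat (q - 1) := by
    obtain ⟨k, hk⟩ := Nat.exists_eq_succ_of_ne_zero (Fact.out : q.Prime).ne_zero
    subst hk
    rw [encField, ZMod.val_neg_one]
    rfl
  rw [hneg, ← hd] at h
  have h2 := Evals.app ((Evals.nil (encInst W V)).cons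
    ((Evals.const (refsBelow_encNat (q - 1)) _).cons (Evals.arg _).tl.hd)) h
  have e1 : encVec (0 : Fin n → ZMod q) = encList (List.ofFn fun _ : Fin n => Data.nil) := by
    simp only [encVec, Pi.zero_apply, encField_zero]
  have e2 : (negUnits q n).map encVec = List.ofFn fun i : Fin n =>
      encList (List.ofFn fun j : Fin n => encField (q := q) (if j = i then -1 else 0)) := by
    rw [negUnits, List.map_ofFn]
    rfl
  rw [e1, e2]
  exact h2

theorem samples_invertR (hX : 5 ≤ X) (hq : q ≤ X) (hn : 0 < n) (hnX : n + 1 ≤ X) (hm : 0 < m)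
    (hmX : m ≤ X) {a j : ℕ} (ha : 0 < a) (hT : q * (q * (a * m ^ j)) ≤ X) {A : Com} {u : ZMod q}
    (hA : ∀ R : Matrix (Fin n) (Fin n) (ZMod q), IsUnit R →
      (query W V R).RefsBelow 0 ∧ (query W V R).depth ≤ X ∧
        HaltsWithin X (start A (query W V R))) :
    Samples X (RX.invertR A u a j) (encInst W V) (fun rows => encRows rows)
      (invertD A u (Nat.clog q (a * m ^ j)) W V) := by
  have hq2 := (Fact.out : q.Prime).two_le
  have hT' : q * (a * m ^ j) ≤ X := (Nat.le_mul_of_pos_left _ (by omega)).trans hT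
  obtain ⟨h1, h2⟩ := samples_listR (V := V) (W := W) hX hq (by omega) hm hmX ha hT'
  refine Samples.letR h1 fun L hL => ?_
  have hLX : q * L.length ≤ X := by
    rw [h2 L hL]
    exact (Nat.mul_le_mul_left _ (pow_clog_le (by omega) (Nat.mul_pos ha (pow_pos hm j)))).trans hT
  have hu := evals_unitsE (V := V) (W := W) (X := X) (by omega) hm
  have h0 : Evals X (.tl (.app (Ex.unitsE q) (.tl .arg)))
      (.cons (encList (L.map encPair)) (encInst W V)) (encList ((negUnits q n).map encVec)) := by
    have := (Evals.app (Evals.arg (.cons (encList (L.map encPair)) (encInst W V))).tl hu).tl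
    exact this
  refine Samples.map (eα := encVec) (eβ := encRow) (ys := negUnits q n) h0 ?_ (by simp [negUnits]; omega)
  intro e _
  refine Samples.map (eα := encMat) (eβ := encField) (ys := rowMatrices e) ?_ ?_
    (by simp [rowMatrices]; omega)
  · obtain ⟨xs, hxs, hd⟩ := evals_hd_encInst (V := V) (W := W) hm
    have h := evals_spotsE (X := X) (e := fun v : Fin n → ZMod q => encVec v) (z := 0) (o := e)
      (l := xs) hxs (by omega)
    rw [← hd] at h
    have h2 := (Evals.app (((Evals.app ((Evals.arg (Data.cons (encVec e)
      (.cons (encList (L.map encPair)) (encInst W V)))).tls 2) hu).hd.cons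
      ((Evals.var 0 _).cons ((Evals.arg _).tls 3).hd))) h).tl
    rw [rowMatrices, List.map_ofFn]
    exact h2
  · intro U _
    exact Samples.app ((Evals.var 0 _).cons ((Evals.arg _).tls 2))
      (samples_entryR hq hn hnX hm hmX hA hLX U)

end


open scoped NNReal
open Distr

/-! ### Lower bounds for expectations -/

theorem expect_prod {α β : Type*} [Fintype α] [Fintype β] (F : α × β → ℝ) :
    𝔼 p, F p = 𝔼 a, 𝔼 b, F (a, b) := by
  rw [← Finset.univ_product_univ, Finset.expect_product]

namespace Distr

variable {α β : Type*}

/-- The expectation of a nonnegative function with respect to `μ` is at least `c` times its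
average. -/
def Covers [Fintype α] (μ : Distr α) (c : ℝ) : Prop :=
  ∀ F : α → ℝ, (∀ x, 0 ≤ F x) → c * 𝔼 a, F a ≤ ex μ F

theorem ex_const_mul_one (μ : Distr α) (h : ex μ (fun _ => 1) = 1) (c : ℝ) :
    ex μ (fun _ => c) = c := by
  have := ex_mul_left μ c fun _ => 1
  simpa [h] using this

theorem ex_sum {ι : Type*} (μ : Distr α) (s : Finset ι) (F : ι → α → ℝ) :
    ex μ (fun x => ∑ i ∈ s, F i x) = ∑ i ∈ s, ex μ (F i) := by
  classical
  induction s using Finset.induction_on with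
  | empty => simp
  | insert i s hi ih => simp only [Finset.sum_insert hi, ex_add, ih]

theorem ex_expect {ι : Type*} [Fintype ι] (μ : Distr α) (F : ι → α → ℝ) :
    ex μ (fun x => 𝔼 i, F i x) = 𝔼 i, ex μ (F i) := by
  simp only [Fintype.expect_eq_sum_div_card, div_eq_inv_mul, ex_mul_left, ex_sum]

/-- Lower bounds relative to the uniform distribution multiply under independence, because all
functions involved are nonnegative. Samples are put in front of the list, so peeling off the first
sample fixes the last coordinate of the tuple; hence `Fin.snocEquiv`. -/
theorem Covers.tuple [Fintype α] [Inhabited α] {μ : Distr α} {c : ℝ} (h : Covers μ c) (hc : 0 ≤ c)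
    (n : ℕ) : Covers (Distr.tuple μ n) (c ^ n) := by
  have key : ∀ (k : ℕ) (acc : List α) (F : List α → ℝ), (∀ x, 0 ≤ F x) →
      c ^ k * 𝔼 w : Fin k → α, F (List.ofFn w ++ acc) ≤ ex (repeatFrom μ k acc) F := by
    intro k
    induction k with
    | zero =>
      intro acc F hF
      simp [repeatFrom, iter]
    | succ k ih =>
      intro acc F hF
      have h1 : ex (repeatFrom μ (k + 1) acc) F =
          ex μ fun a => ex (repeatFrom μ k (a :: acc)) F := by
        simp only [repeatFrom, iter, ex_bind, ex_pure]
      have h2 : 𝔼 w : Fin (k + 1) → α, F (List.ofFn w ++ acc) =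
          𝔼 a, 𝔼 w : Fin k → α, F (List.ofFn w ++ a :: acc) := by
        rw [← expect_prod fun p : α × (Fin k → α) => F (List.ofFn p.2 ++ p.1 :: acc)]
        symm
        refine Fintype.expect_equiv (Fin.snocEquiv fun _ => α) _ _ fun p => ?_
        rw [List.ofFn_succ']
        simp [Fin.snocEquiv]
      rw [h1, h2]
      calc c ^ (k + 1) * 𝔼 a, 𝔼 w : Fin k → α, F (List.ofFn w ++ a :: acc)
          = c * 𝔼 a, c ^ k * 𝔼 w : Fin k → α, F (List.ofFn w ++ a :: acc) := by
            rw [← Finset.mul_expect]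
            ring
        _ ≤ ex μ fun a => c ^ k * 𝔼 w : Fin k → α, F (List.ofFn w ++ a :: acc) :=
            h _ fun a => mul_nonneg (pow_nonneg hc k) (Finset.expect_nonneg fun w _ => hF _)
        _ ≤ _ := ex_mono fun a _ => ih _ _ hF
  intro F hF
  have := key n [] (fun l => F fun i => l.getD i default) fun x => hF _
  rw [Distr.tuple, ex_bind]
  simp only [ex_pure]
  refine le_trans (le_of_eq ?_) this
  congr 2
  funext w
  congr 1
  funext i
  simp

theorem foldl_map {γ : Type*} (g : β → α → Distr β) (f : γ → α) (ys : List γ) :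
    ∀ b, foldl g (ys.map f) b = foldl (fun b y => g b (f y)) ys b := by
  induction ys with
  | nil => intro b; rfl
  | cons y ys ih =>
    intro b
    simp only [List.map_cons, foldl]
    congr 1
    funext b'
    exact ih b'

theorem mapD_map {γ : Type*} (k : α → Distr β) (f : γ → α) (ys : List γ) :
    mapD k (ys.map f) = mapD (fun y => k (f y)) ys := by
  rw [mapD, ← List.map_reverse, foldl_map]
  rfl

/-- For independent samples the probability that all come out as prescribed is at least the product
of the single bounds. Arbitrary nonnegative `F` are allowed so that the lemma can be applied twice,
to the entries of a row and to the rows of a matrix. -/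
theorem ex_mapD_ge {k : α → Distr β} {h : α → β} {p : α → ℝ} :
    ∀ (ys : List α), (∀ y ∈ ys, 0 ≤ p y) →
    (∀ y ∈ ys, ∀ F : β → ℝ, (∀ x, 0 ≤ F x) → p y * F (h y) ≤ ex (k y) F) → ∀ F : List β → ℝ,
    (∀ x, 0 ≤ F x) → (ys.map p).prod * F (ys.map h) ≤ ex (mapD k ys) F := by
  intro ys
  induction ys with
  | nil =>
    intro _ _ F hF
    simp [mapD, foldl]
  | cons y ys ih =>
    intro hp hk F hF
    have h1 : ex (mapD k (y :: ys)) F = ex (mapD k ys) fun l => ex (k y) fun b => F (b :: l) := by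
      rw [mapD, List.reverse_cons, ex_foldl_append]
      simp only [foldl, ex_bind, ex_pure]
      rfl
    rw [h1]
    calc ((y :: ys).map p).prod * F ((y :: ys).map h)
        = (ys.map p).prod * (p y * F (h y :: ys.map h)) := by
          rw [List.map_cons, List.prod_cons, List.map_cons]
          ring
      _ ≤ ex (mapD k ys) fun l => p y * F (h y :: l) :=
          ih (fun y hy => hp y (by simp [hy])) (fun y hy => hk y (by simp [hy]))
            (fun l => p y * F (h y :: l)) fun l => mul_nonneg (hp y (by simp)) (hF _)
      _ ≤ _ := ex_mono fun l _ => hk y (by simp) (fun b => F (b :: l)) fun b => hF _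

/-- The second moment of a sum of independent increments. -/
theorem ex_foldl_sq {g : β → α → Distr β} {D : β → ℝ} {z : α → ℝ} (t : ℝ) :
    ∀ (ys : List α), (∀ y ∈ ys, ∀ b, ex (g b y) (fun _ => 1) = 1) →
    (∀ y ∈ ys, ∀ b, ex (g b y) (fun b' => D b' - D b) = z y) →
    (∀ y ∈ ys, ∀ b, ex (g b y) (fun b' => (D b' - D b) ^ 2) ≤ 1) → ∀ b,
    ex (foldl g ys b) (fun b' => (D b' - t) ^ 2) ≤ ys.length + (D b + (ys.map z).sum - t) ^ 2 := by
  intro ys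
  induction ys with
  | nil => intro _ _ _ b; simp [foldl]
  | cons y ys ih =>
    intro h1 h2 h3 b
    rw [foldl, ex_bind, List.map_cons, List.sum_cons, List.length_cons]
    set Z := (ys.map z).sum
    have hy1 := h1 y (by simp) b
    have hy2 := h2 y (by simp) b
    have hy3 := h3 y (by simp) b
    calc ex (g b y) (fun b' => ex (foldl g ys b') fun b' => (D b' - t) ^ 2)
        ≤ ex (g b y) fun b' => (ys.length + (D b + Z - t) ^ 2) +
            ((D b' - D b) ^ 2 + 2 * (D b + Z - t) * (D b' - D b)) := by
          refine ex_mono fun b' _ => ?_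
          refine (ih (fun y hy => h1 y (by simp [hy])) (fun y hy => h2 y (by simp [hy]))
            (fun y hy => h3 y (by simp [hy])) b').trans (le_of_eq ?_)
          ring
      _ = (ys.length + (D b + Z - t) ^ 2) + (ex (g b y) (fun b' => (D b' - D b) ^ 2) +
            2 * (D b + Z - t) * z y) := by
          rw [ex_add (F := fun _ => (ys.length : ℝ) + (D b + Z - t) ^ 2), ex_const_mul_one _ hy1,
            ex_add, ex_mul_left, hy2]
      -- With `X = D b + Z - t`, the second moment of the increment is at most `1`, and `X ^ 2 + 2 *
      -- X * z y` is `(X + z y) ^ 2` without a nonnegative square.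
      _ ≤ _ := by
          push_cast
          nlinarith [sq_nonneg (z y)]

theorem ex_foldl_one {g : β → α → Distr β} :
    ∀ (ys : List α), (∀ y ∈ ys, ∀ b, ex (g b y) (fun _ => 1) = 1) → ∀ b,
    ex (foldl g ys b) (fun _ => 1) = 1 := by
  intro ys
  induction ys with
  | nil => intro _ b; simp [foldl]
  | cons y ys ih =>
    intro h b
    rw [foldl, ex_bind]
    simp only [ih (fun y hy => h y (by simp [hy]))]
    exact h y (by simp) b

end Distr

/-! ### Random scalars -/

section

variable {q : ℕ} [Fact q.Prime]

theorem sum_range_natCast (F : ZMod q → ℝ) : ∑ j ∈ Finset.range q, F j = ∑ a, F a := by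
  refine Finset.sum_bij' (fun j _ => (j : ZMod q)) (fun a _ => a.val) (by simp)
    (fun a _ => by simpa using ZMod.val_lt a) (fun j hj => ?_) (fun a _ => ?_) (fun _ _ => rfl)
  · rw [ZMod.val_natCast, Nat.mod_eq_of_lt (by simpa using hj)]
  · exact ZMod.natCast_zmod_val a

theorem sum_range_mul_natCast (F : ZMod q → ℝ) (K : ℕ) :
    ∑ j ∈ Finset.range (K * q), F j = K * ∑ a, F a := by
  induction K with
  | zero => simp
  | succ K ih =>
    rw [Nat.succ_mul, Finset.sum_range_add, ih]
    have : ∀ j : ℕ, ((K * q + j : ℕ) : ZMod q) = j := fun j => by simp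
    simp only [this, sum_range_natCast]
    push_cast
    ring

theorem ex_coinD (F : ZMod q → ℝ) : ex (coinD q) F = (F 0 + F 1) / 2 := by
  have h : ∀ a : ZMod q, ((answer coinCom (0 : ZMod q) .nil a).toNNReal : ℝ) =
      answer coinCom (0 : ZMod q) .nil a := fun a => Real.coe_toNNReal _ (prob_nonneg _ _ _)
  rw [coinD, ex_ofWeights]
  simp only [h]
  simp only [answer_coin, add_mul, Finset.sum_add_distrib, mul_assoc, ite_mul, one_mul, zero_mul,
    ← Finset.mul_sum]
  simp
  ring

theorem sum_range_two_mul (F : ℕ → ℝ) (N : ℕ) :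
    ∑ j ∈ Finset.range (2 * N), F j = ∑ j ∈ Finset.range N, (F (2 * j) + F (2 * j + 1)) := by
  induction N with
  | zero => simp
  | succ N ih =>
    rw [Nat.mul_succ, Finset.sum_range_succ, Finset.sum_range_succ, Finset.sum_range_succ, ih]
    ring

/-- The last coin is the lowest binary digit, so the sum over `2 ^ (m + 1)` numbers splits into even
and odd ones. -/
theorem ex_scalarD (m : ℕ) : ∀ F : ZMod q → ℝ,
    ex (scalarD q m) F = (∑ j ∈ Finset.range (2 ^ m), F j) / 2 ^ m := by
  induction m with
  | zero => intro F; simp [scalarD, iter]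
  | succ m ih =>
    intro F
    have h := ih fun a => (F (a + a) + F (1 + (a + a))) / 2
    rw [scalarD] at h ⊢
    rw [ex_iter_succ]
    simp only [ex_bind, ex_pure, ex_coinD, zero_add]
    rw [h, pow_succ, mul_comm (2 ^ m) 2, sum_range_two_mul, ← Finset.sum_div]
    have : ∀ j : ℕ, F ((2 * j : ℕ) : ZMod q) + F ((2 * j + 1 : ℕ) : ZMod q) =
        F (j + j) + F (1 + (j + j)) := by
      intro j
      push_cast
      rw [two_mul, add_comm 1]
    rw [pow_succ']
    simp only [this]
    rw [div_div]

/-- The numbers below `2 ^ m` contain `2 ^ m / q` full periods modulo `q`, on which residues are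
equidistributed; fewer than `q` numbers are left over and dropped. -/
theorem covers_scalarD (m : ℕ) : Covers (scalarD q m) (1 - q / 2 ^ m) := by
  intro F hF
  have hq : 0 < q := (Fact.out : q.Prime).pos
  have hq' : (0 : ℝ) < q := by exact_mod_cast hq
  rw [ex_scalarD, Fintype.expect_eq_sum_div_card, ZMod.card]
  have h1 : ∑ j ∈ Finset.range (2 ^ m / q * q), F (j : ℕ) ≤ ∑ j ∈ Finset.range (2 ^ m), F (j : ℕ) :=
    Finset.sum_le_sum_of_subset_of_nonneg
      (Finset.range_subset_range.2 (Nat.div_mul_le_self _ _)) fun _ _ _ => hF _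
  rw [sum_range_mul_natCast] at h1
  have h2 : (2 : ℝ) ^ m ≤ ((2 ^ m / q : ℕ) : ℝ) * q + q := by
    have := Nat.lt_div_mul_add (a := 2 ^ m) hq
    exact_mod_cast this.le
  have hS : 0 ≤ ∑ a, F a := Finset.sum_nonneg fun a _ => hF a
  have h2m : (0 : ℝ) < 2 ^ m := by positivity
  rw [le_div_iff₀ h2m]
  refine le_trans ?_ h1
  calc (1 - q / 2 ^ m) * ((∑ a, F a) / q) * 2 ^ m = (2 ^ m - q) / q * ∑ a, F a := by
        field_simp
    _ ≤ _ := by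
        refine mul_le_mul_of_nonneg_right ?_ hS
        rw [div_le_iff₀ hq']
        linarith

/-- The exponent counts the scalars drawn: `n * n` entries of the matrix and one guess. -/
theorem covers_pairD {m : ℕ} (n : ℕ) (hm : (q : ℝ) ≤ 2 ^ m) :
    Covers (pairD q n m) ((1 - q / 2 ^ m) ^ (n * n + 1)) := by
  intro F hF
  have hc : (0 : ℝ) ≤ 1 - q / 2 ^ m := by
    rw [sub_nonneg, div_le_one (by positivity)]
    exact hm
  have h1 := covers_scalarD (q := q) m
  have h2 := (h1.tuple hc n).tuple (pow_nonneg hc n) n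
  set c := (1 - (q : ℝ) / 2 ^ m)
  rw [expect_prod, pairD, ex_bind]
  simp only [ex_bind, ex_pure]
  calc c ^ (n * n + 1) * 𝔼 R, 𝔼 h, F (R, h)
      = (c ^ n) ^ n * 𝔼 R : Fin n → Fin n → ZMod q, c * 𝔼 h, F (Matrix.of R, h) := by
        rw [← Finset.mul_expect, ← pow_mul, pow_succ, mul_assoc]
        rfl
    _ ≤ _ := h2 _ fun R => mul_nonneg hc (Finset.expect_nonneg fun h _ => hF _)
    _ ≤ _ := ex_mono fun R _ => h1 _ fun h => hF _

end

/-! ### Random lists with pairwise independent members -/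

section

variable {q : ℕ} {E : Type*} [AddCommGroup E] [Module (ZMod q) E]

/-- Applied to the graph `R ↦ (R, ℓ R)`, this says that correct guesses on the generators yield
correct values on all their combinations. -/
theorem extend_map {E' : Type*} [AddCommGroup E'] [Module (ZMod q) E'] (f : E →ₗ[ZMod q] E')
    (L : List E) (r : E) : extend q (L.map f) (f r) = (extend q L r).map f := by
  rw [extend, extend, spread_map, map_spread]
  simp

variable [Fintype E]

/-- The uniform distribution. -/
noncomputable def unifD (α : Type*) [Fintype α] : Distr α :=
  ofWeights (fun _ => (Fintype.card α : ℝ≥0)⁻¹) id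

theorem ex_unifD {α : Type*} [Fintype α] (F : α → ℝ) : ex (unifD α) F = 𝔼 a, F a := by
  rw [unifD, ex_ofWeights, Fintype.expect_eq_sum_div_card, div_eq_inv_mul, Finset.mul_sum]
  simp

/-- The sums of a random vector and the members of the span of `k` random vectors. -/
noncomputable def lineD (q : ℕ) (E : Type*) [AddCommGroup E] [Module (ZMod q) E] [Fintype E] :
    ℕ → Distr (List E)
  | 0 => bind (unifD E) fun r => pure [r]
  | k + 1 => bind (lineD q E k) fun L => bind (unifD E) fun r => pure (extend q L r)

theorem ex_lineD_zero (F : List E → ℝ) : ex (lineD q E 0) F = 𝔼 r, F [r] := by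
  simp [lineD, ex_bind, ex_unifD]

theorem ex_lineD_succ (k : ℕ) (F : List E → ℝ) :
    ex (lineD q E (k + 1)) F = ex (lineD q E k) fun L => 𝔼 r, F (extend q L r) := by
  simp [lineD, ex_bind, ex_unifD]

theorem length_lineD (k : ℕ) : ∀ L, Supp (lineD q E k) L → L.length = q ^ k := by
  induction k with
  | zero =>
    intro L hL
    obtain ⟨r, -, h⟩ := (supp_bind _ _ _).1 hL
    rw [supp_pure] at h
    simp [h]
  | succ k ih =>
    intro L hL
    obtain ⟨L', hL', h⟩ := (supp_bind _ _ _).1 hL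
    obtain ⟨r, -, h⟩ := (supp_bind _ _ _).1 h
    rw [supp_pure] at h
    rw [h, extend, length_spread, ih L' hL', pow_succ']

theorem expect_add_right (Φ : E → ℝ) (s : E) : 𝔼 R, Φ (R + s) = 𝔼 R, Φ R :=
  Fintype.expect_equiv (Equiv.addRight s) _ _ fun _ => rfl

theorem ex_lineD_one (k : ℕ) : ex (lineD q E k) (fun _ => 1) = 1 := by
  induction k with
  | zero => simp [ex_lineD_zero]
  | succ k ih => simp [ex_lineD_succ, ih]

variable [Fact q.Prime]

theorem expect_smul {x : ZMod q} (hx : x ≠ 0) (Φ : E → ℝ) : 𝔼 R, Φ (x • R) = 𝔼 R, Φ R :=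
  Fintype.expect_equiv (LinearEquiv.smulOfNeZero (ZMod q) E x hx).toEquiv _ _ fun _ => rfl

/-- For `x ≠ y` the points `R + x • r` and `R + y • r` are independent and uniform, so the cross
terms vanish as `Φ` has mean zero. The `q` diagonal terms remain. -/
theorem expect_sq_line (Φ : E → ℝ) (hΦ : 𝔼 R, Φ R = 0) :
    𝔼 r, 𝔼 R, (∑ x : ZMod q, Φ (R + x • r)) ^ 2 = q * 𝔼 R, Φ R ^ 2 := by
  have h : ∀ x y : ZMod q, 𝔼 r, 𝔼 R, Φ (R + x • r) * Φ (R + y • r) =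
      if x = y then 𝔼 R, Φ R ^ 2 else 0 := by
    intro x y
    have h1 : ∀ r : E, 𝔼 R, Φ (R + x • r) * Φ (R + y • r) =
        𝔼 R, Φ R * Φ (R + (y - x) • r) := by
      intro r
      rw [← expect_add_right (fun R => Φ R * Φ (R + (y - x) • r)) (x • r)]
      refine Finset.expect_congr rfl fun R _ => ?_
      congr 2
      rw [sub_smul]
      abel
    simp only [h1]
    split_ifs with hxy
    · simp [hxy, sq]
    · rw [Finset.expect_comm]
      have h2 : ∀ R : E, 𝔼 r : E, Φ R * Φ (R + (y - x) • r) = 0 := by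
        intro R
        rw [← Finset.mul_expect, expect_smul (sub_ne_zero.2 (Ne.symm hxy)) fun r => Φ (R + r)]
        simp only [add_comm R, expect_add_right, hΦ, mul_zero]
      simp [h2]
  simp only [sq, Finset.sum_mul_sum]
  simp only [Finset.expect_sum_comm, h]
  simp [sq]

/-- This is the form in which pairwise independence is used: the variance of the sum is the sum of
the variances. In the induction the newest direction `r` is absorbed into the function `R ↦ ∑ x, Φ
(R + x • r)`, which again has mean zero. -/
theorem ex_lineD_sq (k : ℕ) : ∀ Φ : E → ℝ, 𝔼 R, Φ R = 0 →
    ex (lineD q E k) (fun L => (L.map Φ).sum ^ 2) = q ^ k * 𝔼 R, Φ R ^ 2 := by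
  induction k with
  | zero => intro Φ _; simp [ex_lineD_zero]
  | succ k ih =>
    intro Φ hΦ
    rw [ex_lineD_succ, ex_expect]
    have h1 : ∀ r : E, ex (lineD q E k) (fun L => ((extend q L r).map Φ).sum ^ 2) =
        q ^ k * 𝔼 R, (∑ x : ZMod q, Φ (R + x • r)) ^ 2 := by
      intro r
      rw [← ih fun R => ∑ x : ZMod q, Φ (R + x • r)]
      · have h2 : ∀ R, ∑ j ∈ Finset.range q, Φ (R + (j : ZMod q) • r) =
            ∑ x : ZMod q, Φ (R + x • r) := fun R => sum_range_natCast fun x => Φ (R + x • r)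
        simp only [extend, spread_sum, h2]
      · rw [Finset.expect_sum_comm]
        simp [expect_add_right, hΦ]
    simp only [h1]
    rw [← Finset.mul_expect, expect_sq_line Φ hΦ, pow_succ]
    ring

end

section

variable {q : ℕ} [Fact q.Prime]

/-- Each guess `h` agrees with `ℓ R` with probability `1 / q`, up to the sampling loss, and there
are `k + 1` guesses. All other outcomes are discarded, as `F` is nonnegative. -/
theorem ex_listD_ge {n m : ℕ} (hm : (q : ℝ) ≤ 2 ^ m) (k : ℕ)
    (ℓ : Matrix (Fin n) (Fin n) (ZMod q) →ₗ[ZMod q] ZMod q) :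
    ∀ F : List (Matrix (Fin n) (Fin n) (ZMod q) × ZMod q) → ℝ, (∀ L, 0 ≤ F L) →
    ((1 - q / 2 ^ m) ^ (n * n + 1) / q) ^ (k + 1) *
      ex (lineD q (Matrix (Fin n) (Fin n) (ZMod q)) k) (fun L => F (L.map fun R => (R, ℓ R))) ≤
        ex (listD q n m k) F := by
  have hq : (0 : ℝ) < q := by exact_mod_cast (Fact.out : q.Prime).pos
  have hc : (0 : ℝ) ≤ (1 - q / 2 ^ m) ^ (n * n + 1) := by
    refine pow_nonneg ?_ _
    rw [sub_nonneg, div_le_one (by positivity)]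
    exact hm
  have hp := covers_pairD (q := q) n hm
  set c := (1 - (q : ℝ) / 2 ^ m) ^ (n * n + 1)
  have hpair : ∀ G : Matrix (Fin n) (Fin n) (ZMod q) × ZMod q → ℝ, (∀ p, 0 ≤ G p) →
      c / q * 𝔼 R, G (R, ℓ R) ≤ ex (pairD q n m) G := by
    intro G hG
    refine le_trans ?_ (hp G hG)
    rw [expect_prod, div_mul_eq_mul_div, mul_div_assoc, Finset.expect_div]
    refine mul_le_mul_of_nonneg_left (Finset.expect_le_expect fun R _ => ?_) hc
    rw [Fintype.expect_eq_sum_div_card, ZMod.card]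
    exact div_le_div_of_nonneg_right
      (Finset.single_le_sum (f := fun h => G (R, h)) (fun h _ => hG _) (Finset.mem_univ (ℓ R))) hq.le
  induction k with
  | zero =>
    intro F hF
    rw [ex_lineD_zero, zero_add, pow_one, listD, ex_bind]
    simp only [iter, ex_pure]
    exact hpair (fun p => F [p]) fun p => hF _
  | succ k ih =>
    intro F hF
    have h1 : ex (listD q n m (k + 1)) F =
        ex (listD q n m k) fun L => ex (pairD q n m) fun p => F (extend q L p) := by
      simp only [listD, ex_bind, ex_iter_succ, ex_pure]
    rw [h1]
    refine le_trans ?_ (ih _ fun L => ex_nonneg fun p _ => hF _)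
    rw [ex_lineD_succ, pow_succ, mul_assoc, ← ex_mul_left]
    refine mul_le_mul_of_nonneg_left (ex_mono fun L _ => ?_) (by positivity)
    refine le_trans (le_of_eq ?_) (hpair _ fun p => hF _)
    congr 2
    funext R
    have := extend_map (LinearMap.prod LinearMap.id ℓ) L R
    simp only [LinearMap.prod_apply] at this
    exact congrArg F this.symm

end


open scoped NNReal
open Distr

/-! ### The analysis of the votes -/

section

variable {q : ℕ} [Fact q.Prime] {n m : ℕ}

open Classical in
/-- The probability that the answer to the query for `R` is `a`. -/
noncomputable def ansP (A : Com) (u : ZMod q) (W : Data) (V : Fin m → Fin n → ZMod q)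
    (R : Matrix (Fin n) (Fin n) (ZMod q)) (a : ZMod q) : ℝ :=
  if IsUnit R then answer A u (query W V R) a else 0

theorem count_cons (z : ZMod q × ZMod q) (Z : List (ZMod q × ZMod q)) (x : ZMod q) :
    (count (z :: Z) x : ℝ) = count Z x + if z.1 + z.2 * x = 0 then 1 else 0 := by
  rw [count, count, List.countP_cons]
  push_cast
  simp

theorem answer_nonneg (A : Com) (u : ZMod q) (d : Data) (a : ZMod q) : 0 ≤ answer A u d a :=
  prob_nonneg _ _ _

variable {A : Com} {u : ZMod q} {W : Data} {V : Fin m → Fin n → ZMod q}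

theorem ansP_nonneg (R : Matrix (Fin n) (Fin n) (ZMod q)) (a : ZMod q) :
    0 ≤ ansP A u W V R a := by
  unfold ansP
  split_ifs
  · exact answer_nonneg _ _ _ _
  · exact le_rfl

open Classical in
theorem sum_ansP (hA : ∀ R : Matrix (Fin n) (Fin n) (ZMod q), IsUnit R →
      ∑ a, answer A u (query W V R) a = 1) (R : Matrix (Fin n) (Fin n) (ZMod q)) :
    ∑ a, ansP A u W V R a = if IsUnit R then 1 else 0 := by
  unfold ansP
  split_ifs with h
  · exact hA R h
  · simp

theorem ansP_le_one (hA : ∀ R : Matrix (Fin n) (Fin n) (ZMod q), IsUnit R →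
      ∑ a, answer A u (query W V R) a = 1) (R : Matrix (Fin n) (Fin n) (ZMod q)) (a : ZMod q) :
    ansP A u W V R a ≤ 1 := by
  classical
  refine (Finset.single_le_sum (f := ansP A u W V R) (fun a _ => ansP_nonneg R a)
    (Finset.mem_univ a)).trans ?_
  rw [sum_ansP hA]
  split_ifs <;> norm_num

theorem ex_answerD (d : Data) (F : ZMod q → ℝ) :
    ex (ofWeights (fun a => (answer A u d a).toNNReal) (id : ZMod q → ZMod q)) F =
      ∑ a, answer A u d a * F a := by
  rw [ex_ofWeights]
  exact Finset.sum_congr rfl fun a _ => by rw [Real.coe_toNNReal _ (answer_nonneg _ _ _ _)]; rfl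

/-- The expected advantage of the candidate `x₀` over `x` in the vote for a record. -/
noncomputable def gain (A : Com) (u : ZMod q) (W : Data) (V : Fin m → Fin n → ZMod q)
    (x₀ x : ZMod q) (r : Matrix (Fin n) (Fin n) (ZMod q) × ZMod q × ZMod q) : ℝ :=
  ansP A u W V r.1 (-(r.2.1 + r.2.2 * x₀)) - ansP A u W V r.1 (-(r.2.1 + r.2.2 * x))

/-- For a fixed list, each record changes the lead of `x₀` over `x` by `-1`, `0` or `1`, with mean
`gain` independent of earlier votes; singular matrices change nothing. The second moment of the lead
about `t` is thus at most the number of records plus the squared bias. -/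
theorem ex_votesD (hA : ∀ R : Matrix (Fin n) (Fin n) (ZMod q), IsUnit R →
      ∑ a, answer A u (query W V R) a = 1)
    (rs : List (Matrix (Fin n) (Fin n) (ZMod q) × ZMod q × ZMod q)) (x₀ x : ZMod q) (t : ℝ) :
    ex (votesD A u W V rs) (fun _ => 1) = 1 ∧
    ex (votesD A u W V rs) (fun Z => ((count Z x₀ : ℝ) - count Z x - t) ^ 2) ≤
      rs.length + ((rs.map (gain A u W V x₀ x)).sum - t) ^ 2 := by
  classical
  set g : List (ZMod q × ZMod q) → Matrix (Fin n) (Fin n) (ZMod q) × ZMod q × ZMod q →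
      Distr (List (ZMod q × ZMod q)) := fun acc r => if IsUnit r.1 then
    bind (ofWeights (fun a => (answer A u (query W V r.1) a).toNNReal) (id : ZMod q → ZMod q))
      fun a => pure ((a + r.2.1, r.2.2) :: acc) else pure acc with hg
  have hv : votesD A u W V rs = Distr.foldl g rs [] := by
    unfold votesD
    congr!
  have hmass : ∀ r ∈ rs, ∀ b, ex (g b r) (fun _ => 1) = 1 := by
    intro r _ b
    simp only [hg]
    split_ifs with h
    · rw [ex_bind]
      simp only [ex_pure]
      rw [ex_answerD]
      simpa using hA r.1 h
    · simp
  have hcalc : ∀ (r : Matrix (Fin n) (Fin n) (ZMod q) × ZMod q × ZMod q) (a : ZMod q)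
      (b : List (ZMod q × ZMod q)) (y : ZMod q),
      (count ((a + r.2.1, r.2.2) :: b) y : ℝ) =
        count b y + if a = -(r.2.1 + r.2.2 * y) then 1 else 0 := by
    intro r a b y
    rw [count_cons]
    congr 2
    simp only [eq_iff_iff]
    constructor <;> intro h <;> linear_combination h
  rw [hv]
  refine ⟨ex_foldl_one rs hmass [], ?_⟩
  have := ex_foldl_sq (g := g) (D := fun Z => (count Z x₀ : ℝ) - count Z x)
    (z := gain A u W V x₀ x) t rs hmass ?_ ?_ []
  · simpa [count] using this
  · intro r _ b
    simp only [hg, gain, ansP]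
    split_ifs with h
    · rw [ex_bind]
      simp only [ex_pure, hcalc]
      rw [ex_answerD]
      have : ∀ a : ZMod q, answer A u (query W V r.1) a *
          (((count b x₀ : ℝ) + if a = -(r.2.1 + r.2.2 * x₀) then 1 else 0) -
            ((count b x : ℝ) + if a = -(r.2.1 + r.2.2 * x) then 1 else 0) -
            ((count b x₀ : ℝ) - count b x)) =
          (if a = -(r.2.1 + r.2.2 * x₀) then answer A u (query W V r.1) a else 0) -
            if a = -(r.2.1 + r.2.2 * x) then answer A u (query W V r.1) a else 0 := by
        intro a
        split_ifs <;> ring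
      simp only [this, Finset.sum_sub_distrib, Finset.sum_ite_eq', Finset.mem_univ, if_true]
    · simp
  · intro r hr b
    rw [← hmass r hr b]
    simp only [hg]
    split_ifs with h
    · rw [ex_bind, ex_bind]
      refine ex_mono fun a _ => ?_
      simp only [ex_pure, hcalc]
      split_ifs <;> norm_num
    · simp

-- If `x₀` fails to win strictly, some `x` has a lead over it that is at most zero, hence at
-- distance at least `t` from `t`. Chebyshev's inequality for each `x` and a union bound give the
-- estimate.
open Classical in
theorem ex_entryD_ge (hA : ∀ R : Matrix (Fin n) (Fin n) (ZMod q), IsUnit R →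
      ∑ a, answer A u (query W V R) a = 1)
    (L : List (Matrix (Fin n) (Fin n) (ZMod q) × ZMod q)) (U : Matrix (Fin n) (Fin n) (ZMod q))
    (x₀ : ZMod q) {t : ℝ} (ht : 0 < t) :
    1 - ∑ x ∈ Finset.univ.erase x₀, ((q * L.length : ℝ) +
        (((records U L).map (gain A u W V x₀ x)).sum - t) ^ 2) / t ^ 2 ≤
      ex (entryD A u W V L U) fun y => if y = x₀ then 1 else 0 := by
  rw [entryD, ex_bind]
  simp only [ex_pure]
  have h0 := (ex_votesD hA (records U L) x₀ x₀ t).1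
  have h1 : ex (votesD A u W V (records U L)) (fun Z => 1 - ∑ x ∈ Finset.univ.erase x₀,
      (t ^ 2)⁻¹ * ((count Z x₀ : ℝ) - count Z x - t) ^ 2) ≤
        ex (votesD A u W V (records U L)) fun Z => if argmax Z = x₀ then 1 else 0 := by
    refine ex_mono fun Z _ => ?_
    have hnn : ∀ x ∈ Finset.univ.erase x₀,
        0 ≤ (t ^ 2)⁻¹ * ((count Z x₀ : ℝ) - count Z x - t) ^ 2 := fun x _ => by positivity
    by_cases h : ∀ x, x ≠ x₀ → count Z x < count Z x₀
    · rw [if_pos (argmax_eq h)]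
      have := Finset.sum_nonneg hnn
      linarith
    · push Not at h
      obtain ⟨x, hx, hxc⟩ := h
      have h2 := Finset.single_le_sum hnn (Finset.mem_erase.2 ⟨hx, Finset.mem_univ x⟩)
      have hxc' : (count Z x₀ : ℝ) ≤ count Z x := by exact_mod_cast hxc
      have h3 : 1 ≤ (t ^ 2)⁻¹ * ((count Z x₀ : ℝ) - count Z x - t) ^ 2 := by
        rw [← div_eq_inv_mul, one_le_div (by positivity)]
        nlinarith
      split_ifs <;> linarith
  refine le_trans ?_ h1
  rw [ex_sub, h0, ex_sum]
  refine sub_le_sub_left (Finset.sum_le_sum fun x _ => ?_) 1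
  rw [ex_mul_left, div_eq_inv_mul]
  refine mul_le_mul_of_nonneg_left ?_ (by positivity)
  have := (ex_votesD hA (records U L) x₀ x t).2
  rw [length_records] at this
  push_cast at this
  exact this

theorem ex_entryD_mass_le (hA : ∀ R : Matrix (Fin n) (Fin n) (ZMod q), IsUnit R →
      ∑ a, answer A u (query W V R) a = 1)
    (L : List (Matrix (Fin n) (Fin n) (ZMod q) × ZMod q)) (U : Matrix (Fin n) (Fin n) (ZMod q)) :
    ex (entryD A u W V L U) (fun _ => 1) = 1 := by
  rw [entryD, ex_bind]
  simp only [ex_pure]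
  exact (ex_votesD hA (records U L) 0 0 0).1

/-- The average probability, over all matrices `R`, of the answer `tr (M R) + e`. -/
noncomputable def errP (A : Com) (u : ZMod q) (W : Data) (V : Fin m → Fin n → ZMod q)
    (M : Matrix (Fin n) (Fin n) (ZMod q)) (e : ZMod q) : ℝ :=
  𝔼 R : Matrix (Fin n) (Fin n) (ZMod q), ansP A u W V R ((M * R).trace + e)

/-- The linear functional `R ↦ -tr (M R)`. -/
def negTrace (M : Matrix (Fin n) (Fin n) (ZMod q)) :
    Matrix (Fin n) (Fin n) (ZMod q) →ₗ[ZMod q] ZMod q :=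
  -((Matrix.traceLinearMap (Fin n) (ZMod q) (ZMod q)).comp (LinearMap.mulLeft (ZMod q) M))

theorem negTrace_apply (M R : Matrix (Fin n) (Fin n) (ZMod q)) :
    negTrace M R = -(M * R).trace := rfl

-- For fixed `R` the errors `e` run through all answers, so the total is one if the query is made
-- and zero if `R` is singular.
open Classical in
theorem sum_errP (hA : ∀ R : Matrix (Fin n) (Fin n) (ZMod q), IsUnit R →
      ∑ a, answer A u (query W V R) a = 1) (M : Matrix (Fin n) (Fin n) (ZMod q)) :
    ∑ e, errP A u W V M e =
      𝔼 R : Matrix (Fin n) (Fin n) (ZMod q), if IsUnit R then (1 : ℝ) else 0 := by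
  unfold errP
  rw [← Finset.expect_sum_comm]
  refine Finset.expect_congr rfl fun R _ => ?_
  rw [← sum_ansP hA]
  exact Fintype.sum_equiv (Equiv.addLeft (M * R).trace) _ _ fun _ => rfl

theorem sum_comp_mul_right {c : ZMod q} (hc : c ≠ 0) (F : ZMod q → ℝ) :
    ∑ y, F (y * c) = ∑ y, F y :=
  Fintype.sum_bijective (fun y => y * c) (mulRight_bijective₀ c hc) _ _ fun _ => rfl

-- With correct values `-tr (M R)` in the list, a vote at `R + y U` favours `x₀` if the answer has
-- error `0`, and `x` if it has error `y (x₀ - x)`. The function `φ` collects the `q` votes on the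
-- line through `R`. It has mean `μ` and absolute value at most `q`, and pairwise independence of
-- the listed matrices bounds the variance of its sum.
open Classical in
theorem ex_lineD_gain (hA : ∀ R : Matrix (Fin n) (Fin n) (ZMod q), IsUnit R →
      ∑ a, answer A u (query W V R) a = 1) (M U : Matrix (Fin n) (Fin n) (ZMod q)) (k : ℕ)
    {x : ZMod q} (hx : x ≠ negTrace M U) :
    ex (lineD q (Matrix (Fin n) (Fin n) (ZMod q)) k) (fun L =>
      (((records U (L.map fun R => (R, negTrace M R))).map
        (gain A u W V (negTrace M U) x)).sum - q ^ k * (q * errP A u W V M 0 -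
          𝔼 R : Matrix (Fin n) (Fin n) (ZMod q), if IsUnit R then (1 : ℝ) else 0)) ^ 2) ≤
      q ^ k * q ^ 2 := by
  set x₀ := negTrace M U with hx₀
  set Q : Matrix (Fin n) (Fin n) (ZMod q) → ZMod q → ℝ := fun R e =>
    ansP A u W V R ((M * R).trace + e) with hQ
  set φ : Matrix (Fin n) (Fin n) (ZMod q) → ℝ := fun R =>
    ∑ y : ZMod q, (Q (R + y • U) 0 - Q (R + y • U) (y * (x₀ - x))) with hφ
  set μ := q * errP A u W V M 0 -
    𝔼 R : Matrix (Fin n) (Fin n) (ZMod q), if IsUnit R then (1 : ℝ) else 0 with hμ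
  have hQ0 : ∀ R e, 0 ≤ Q R e := fun R e => ansP_nonneg _ _
  have hQ1 : ∀ R e, Q R e ≤ 1 := fun R e => ansP_le_one hA _ _
  have hsum : ∀ L : List (Matrix (Fin n) (Fin n) (ZMod q)),
      ((records U (L.map fun R => (R, negTrace M R))).map (gain A u W V x₀ x)).sum =
        (L.map φ).sum := by
    intro L
    rw [records, spread_map, spread_sum]
    congr 1
    refine List.map_congr_left fun R _ => ?_
    rw [sum_range_natCast fun y => gain A u W V x₀ x (R + y • U, negTrace M R, y)]
    refine Finset.sum_congr rfl fun y _ => ?_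
    simp only [gain, hQ, hx₀, negTrace_apply, Matrix.mul_add, Matrix.mul_smul, Matrix.trace_add,
      Matrix.trace_smul, smul_eq_mul]
    congr 2 <;> ring
  have hmean : 𝔼 R, φ R = μ := by
    simp only [hφ]
    rw [Finset.expect_sum_comm]
    simp only [Finset.expect_sub_distrib]
    have h1 : ∀ y e : ZMod q, 𝔼 R, Q (R + y • U) e = errP A u W V M e := fun y e =>
      expect_add_right (fun R => Q R e) (y • U)
    simp only [h1, Finset.sum_sub_distrib, Finset.sum_const, Finset.card_univ, ZMod.card,
      nsmul_eq_mul]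
    rw [hμ, ← sum_errP hA M]
    -- As `x ≠ x₀`, the error `y (x₀ - x)` takes every value exactly once. The votes for `x`
    -- therefore amount to the mass of all answers, however the errors are distributed.
    rw [sum_comp_mul_right (sub_ne_zero.2 (Ne.symm hx)) (errP A u W V M)]
  have habs : ∀ R, φ R ^ 2 ≤ q ^ 2 := by
    intro R
    have h1 : ∀ y ∈ (Finset.univ : Finset (ZMod q)),
        |Q (R + y • U) 0 - Q (R + y • U) (y * (x₀ - x))| ≤ 1 := by
      intro y _
      rw [abs_le]
      constructor <;> linarith [hQ0 (R + y • U) 0, hQ1 (R + y • U) 0,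
        hQ0 (R + y • U) (y * (x₀ - x)), hQ1 (R + y • U) (y * (x₀ - x))]
    have h2 : |φ R| ≤ q := by
      refine (Finset.abs_sum_le_sum_abs _ _).trans ((Finset.sum_le_sum h1).trans ?_)
      simp [ZMod.card]
    rw [← sq_abs]
    exact pow_le_pow_left₀ (abs_nonneg _) h2 2
  have hcongr : ex (lineD q (Matrix (Fin n) (Fin n) (ZMod q)) k) (fun L =>
      (((records U (L.map fun R => (R, negTrace M R))).map (gain A u W V x₀ x)).sum -
        q ^ k * μ) ^ 2) = ex (lineD q (Matrix (Fin n) (Fin n) (ZMod q)) k) fun L =>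
          (L.map fun R => φ R - μ).sum ^ 2 := by
    refine ex_congr fun L hL => ?_
    have hlen := length_lineD k L hL
    have : (L.map fun R => φ R - μ).sum = (L.map φ).sum - q ^ k * μ := by
      have h3 : ∀ L : List (Matrix (Fin n) (Fin n) (ZMod q)),
          (L.map fun R => φ R - μ).sum = (L.map φ).sum - L.length * μ := by
        intro L
        induction L with
        | nil => simp
        | cons R L ih =>
          rw [List.map_cons, List.sum_cons, ih, List.map_cons, List.sum_cons, List.length_cons]
          push_cast
          ring
      rw [h3, hlen]
      push_cast
      rfl
    rw [hsum, this]
  rw [hcongr, ex_lineD_sq]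
  · refine mul_le_mul_of_nonneg_left ?_ (by positivity)
    -- The variance is bounded by the second moment.
    have h4 : 𝔼 R, (φ R - μ) ^ 2 = 𝔼 R, φ R ^ 2 - μ ^ 2 := by
      have : ∀ R, (φ R - μ) ^ 2 = φ R ^ 2 - (2 * μ * φ R - μ ^ 2) := fun R => by ring
      simp only [this, Finset.expect_sub_distrib]
      rw [← Finset.mul_expect, hmean, Finset.expect_const Finset.univ_nonempty]
      ring
    rw [h4]
    have h5 : 𝔼 R, φ R ^ 2 ≤ 𝔼 _R : Matrix (Fin n) (Fin n) (ZMod q), (q : ℝ) ^ 2 :=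
      Finset.expect_le_expect fun R _ => habs R
    rw [Finset.expect_const Finset.univ_nonempty] at h5
    nlinarith [sq_nonneg μ]
  · rw [Finset.expect_sub_distrib, hmean, Finset.expect_const Finset.univ_nonempty, sub_self]

/-- The union bound for independent events; the bounds on the product keep the induction going. -/
theorem one_sub_sum_le_prod {α : Type*} (p : α → ℝ) :
    ∀ l : List α, (∀ a ∈ l, 0 ≤ p a ∧ p a ≤ 1) →
      1 - (l.map fun a => 1 - p a).sum ≤ (l.map p).prod ∧ 0 ≤ (l.map p).prod ∧
        (l.map p).prod ≤ 1 := by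
  intro l
  induction l with
  | nil => simp
  | cons a l ih =>
    intro h
    obtain ⟨h1, h2, h3⟩ := ih fun b hb => h b (by simp [hb])
    obtain ⟨h4, h5⟩ := h a (by simp)
    simp only [List.map_cons, List.sum_cons, List.prod_cons]
    refine ⟨?_, mul_nonneg h4 h2, mul_le_one₀ h5 h2 h3⟩
    have : 0 ≤ (l.map fun a => 1 - p a).sum := List.sum_nonneg fun x hx => by
      obtain ⟨b, hb, rfl⟩ := List.mem_map.1 hx
      linarith [(h b (by simp [hb])).2]
    nlinarith

end


open scoped NNReal
open Distr

/-! ### The success probability for a fixed instance -/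

/-- The negated unit vectors. -/
def negUnit (q : ℕ) {n : ℕ} (a : Fin n) : Fin n → ZMod q := fun j => if j = a then -1 else 0

/-- The matrix with row `b` equal to `e` and all others zero. -/
def rowMatrix {q n : ℕ} (e : Fin n → ZMod q) (b : Fin n) : Matrix (Fin n) (Fin n) (ZMod q) :=
  Matrix.of fun i => if i = b then e else 0

theorem negUnits_eq_map (q n : ℕ) : negUnits q n = (List.finRange n).map (negUnit q) :=
  List.ofFn_eq_map

theorem rowMatrices_eq_map {q n : ℕ} (e : Fin n → ZMod q) :
    rowMatrices e = (List.finRange n).map (rowMatrix e) := List.ofFn_eq_map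

section

variable {q : ℕ} [Fact q.Prime] {n m : ℕ} {A : Com} {u : ZMod q} {W : Data}
  {V : Fin m → Fin n → ZMod q}

/-- The sign in `negUnit` cancels the one in `negTrace`, so the winner of the vote for this matrix
is directly an entry of `M`. -/
theorem negTrace_rowMatrix (M : Matrix (Fin n) (Fin n) (ZMod q)) (a b : Fin n) :
    negTrace M (rowMatrix (negUnit q a) b) = M a b := by
  rw [negTrace_apply, Matrix.trace]
  have h : ∀ i, (M * rowMatrix (negUnit q a) b).diag i = if i = a then -M i b else 0 := by
    intro i
    rw [Matrix.diag_apply, Matrix.mul_apply, Finset.sum_eq_single b]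
    · simp only [rowMatrix, Matrix.of_apply, if_true, negUnit]
      split_ifs <;> ring
    · intro j _ hj
      simp [rowMatrix, hj]
    · simp
  rw [Finset.sum_congr rfl fun i _ => h i]
  simp

/-- With `N = q ^ k` and threshold `N * μ`, each of at most `q` wrong candidates contributes `(q * N
+ N * q ^ 2) / (N * μ) ^ 2`: the first term is the randomness of the answers, the second that of the
list. Bounding `q ^ 2 + q ^ 3` by `2 * q ^ 3` gives the constant. -/
theorem ex_lineD_entryD (hA : ∀ R : Matrix (Fin n) (Fin n) (ZMod q), IsUnit R →
      ∑ a, answer A u (query W V R) a = 1) (M U : Matrix (Fin n) (Fin n) (ZMod q)) (k : ℕ) {μ : ℝ}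
    (hμ : 0 < μ) (hμe : μ = q * errP A u W V M 0 -
      𝔼 R : Matrix (Fin n) (Fin n) (ZMod q), open Classical in if IsUnit R then (1 : ℝ) else 0) :
    1 - 2 * q ^ 3 / (q ^ k * μ ^ 2) ≤
    ex (lineD q (Matrix (Fin n) (Fin n) (ZMod q)) k) fun L =>
      ex (entryD A u W V (L.map fun R => (R, negTrace M R)) U) fun y =>
        if y = negTrace M U then 1 else 0 := by
  have hq : (0 : ℝ) < q := by exact_mod_cast (Fact.out : q.Prime).pos
  have hq1 : (1 : ℝ) ≤ q := by exact_mod_cast (Fact.out : q.Prime).one_lt.le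
  have hN : (0 : ℝ) < q ^ k := by positivity
  set N : ℝ := (q : ℝ) ^ k with hNdef
  set x₀ := negTrace M U
  have ht : 0 < N * μ := by positivity
  have hle : ∀ x ∈ Finset.univ.erase x₀,
      ex (lineD q (Matrix (Fin n) (Fin n) (ZMod q)) k) (fun L => ((N * μ) ^ 2)⁻¹ * (q * N +
        (((records U (L.map fun R => (R, negTrace M R))).map
          (gain A u W V x₀ x)).sum - N * μ) ^ 2)) ≤ ((N * μ) ^ 2)⁻¹ * (q * N + N * q ^ 2) := by
    intro x hx
    rw [ex_mul_left, ex_add, ex_const_mul_one _ (ex_lineD_one k)]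
    refine mul_le_mul_of_nonneg_left (add_le_add_right ?_ _) (by positivity)
    have := ex_lineD_gain hA M U k (Finset.ne_of_mem_erase hx)
    rw [← hμe] at this
    exact this
  have hfail : ∑ x ∈ Finset.univ.erase x₀,
      ex (lineD q (Matrix (Fin n) (Fin n) (ZMod q)) k) (fun L => ((N * μ) ^ 2)⁻¹ * (q * N +
        (((records U (L.map fun R => (R, negTrace M R))).map
          (gain A u W V x₀ x)).sum - N * μ) ^ 2)) ≤ 2 * q ^ 3 / (N * μ ^ 2) := by
    refine (Finset.sum_le_sum hle).trans ?_
    rw [Finset.sum_const, nsmul_eq_mul]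
    have hcard : ((Finset.univ.erase x₀).card : ℝ) ≤ q := by
      have := Finset.card_erase_le (s := (Finset.univ : Finset (ZMod q))) (a := x₀)
      rw [Finset.card_univ, ZMod.card] at this
      exact_mod_cast this
    calc ((Finset.univ.erase x₀).card : ℝ) * (((N * μ) ^ 2)⁻¹ * (q * N + N * q ^ 2))
        ≤ q * (((N * μ) ^ 2)⁻¹ * (q * N + N * q ^ 2)) :=
          mul_le_mul_of_nonneg_right hcard (by positivity)
      _ = (q ^ 2 + q ^ 3) / (N * μ ^ 2) := by field_simp
      _ ≤ _ := by
          refine div_le_div_of_nonneg_right ?_ (by positivity)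
          nlinarith [sq_nonneg (q : ℝ)]
  calc 1 - 2 * q ^ 3 / (N * μ ^ 2) ≤ ex (lineD q (Matrix (Fin n) (Fin n) (ZMod q)) k) fun L =>
        1 - ∑ x ∈ Finset.univ.erase x₀, ((N * μ) ^ 2)⁻¹ * (q * N +
        (((records U (L.map fun R => (R, negTrace M R))).map
          (gain A u W V x₀ x)).sum - N * μ) ^ 2) := by
        rw [ex_sub, ex_lineD_one, ex_sum]
        linarith
    _ ≤ _ := by
        refine ex_mono fun L hL => ?_
        have := ex_entryD_ge hA (L.map fun R => (R, negTrace M R)) U x₀ ht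
        rw [List.length_map, length_lineD k L hL] at this
        push_cast at this
        refine le_trans (le_of_eq ?_) (this.trans (le_of_eq ?_))
        · simp only [hNdef, div_eq_inv_mul]
        · congr!

/-- One list serves all `n * n` entries, so the entries are independent only given the list. The
product of their conditional success probabilities is bounded below by one minus the sum of the
failures, and only this sum is averaged over the list. -/
theorem ex_invertD_ge (hm : (q : ℝ) ≤ 2 ^ m)
    (hA : ∀ R : Matrix (Fin n) (Fin n) (ZMod q), IsUnit R →
      ∑ a, answer A u (query W V R) a = 1) (M : Matrix (Fin n) (Fin n) (ZMod q)) (k : ℕ) {μ : ℝ}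
    (hμ : 0 < μ) (hμe : μ = q * errP A u W V M 0 -
      𝔼 R : Matrix (Fin n) (Fin n) (ZMod q), open Classical in if IsUnit R then (1 : ℝ) else 0) :
    ((1 - q / 2 ^ m) ^ (n * n + 1) / q) ^ (k + 1) *
        (1 - n * (n * (2 * q ^ 3 / (q ^ k * μ ^ 2)))) ≤
      ex (invertD A u k W V) fun rows =>
        if rows = List.ofFn fun a => List.ofFn (M a) then 1 else 0 := by
  set F : List (List (ZMod q)) → ℝ := fun rows =>
    if rows = List.ofFn fun a => List.ofFn (M a) then 1 else 0 with hF
  have hF0 : ∀ rows, 0 ≤ F rows := fun rows => by simp only [hF]; split_ifs <;> norm_num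
  set p : List (Matrix (Fin n) (Fin n) (ZMod q)) → Fin n → Fin n → ℝ := fun L a b =>
    ex (entryD A u W V (L.map fun R => (R, negTrace M R)) (rowMatrix (negUnit q a) b)) fun y =>
      if y = M a b then 1 else 0 with hp
  have hp0 : ∀ L a b, 0 ≤ p L a b := fun L a b =>
    ex_nonneg fun y _ => by split_ifs <;> norm_num
  have hp1 : ∀ L a b, p L a b ≤ 1 := fun L a b => by
    rw [← ex_entryD_mass_le hA (L.map fun R => (R, negTrace M R)) (rowMatrix (negUnit q a) b)]
    exact ex_mono fun y _ => by split_ifs <;> norm_num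
  have hpe : ∀ L a b, ∀ G : ZMod q → ℝ, (∀ y, 0 ≤ G y) → p L a b * G (M a b) ≤
      ex (entryD A u W V (L.map fun R => (R, negTrace M R)) (rowMatrix (negUnit q a) b)) G := by
    intro L a b G hG
    rw [mul_comm, hp]
    simp only
    rw [← ex_mul_left]
    refine ex_mono fun y _ => ?_
    split_ifs with h
    · rw [h, mul_one]
    · rw [mul_zero]
      exact hG y
  have hrow : ∀ (L) (a : Fin n) (G : List (ZMod q) → ℝ), (∀ y, 0 ≤ G y) →
      (∏ b, p L a b) * G (List.ofFn (M a)) ≤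
        ex (mapD (entryD A u W V (L.map fun R => (R, negTrace M R)))
          (rowMatrices (negUnit q a))) G := by
    intro L a G hG
    have := ex_mapD_ge (k := fun b => entryD A u W V (L.map fun R => (R, negTrace M R))
      (rowMatrix (negUnit q a) b)) (h := M a) (p := p L a) (List.finRange n)
      (fun b _ => hp0 L a b) (fun b _ => hpe L a b) G hG
    rw [← List.ofFn_eq_map, ← List.ofFn_eq_map, List.prod_ofFn] at this
    rw [rowMatrices_eq_map, mapD_map]
    exact this
  have hall : ∀ L, (∏ a, ∏ b, p L a b) ≤
      ex (mapD (fun e => mapD (entryD A u W V (L.map fun R => (R, negTrace M R)))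
        (rowMatrices e)) (negUnits q n)) F := by
    intro L
    have := ex_mapD_ge (k := fun a => mapD (entryD A u W V (L.map fun R => (R, negTrace M R)))
      (rowMatrices (negUnit q a))) (h := fun a => List.ofFn (M a)) (p := fun a => ∏ b, p L a b)
      (List.finRange n) (fun a _ => Finset.prod_nonneg fun b _ => hp0 L a b)
      (fun a _ => hrow L a) F hF0
    rw [← List.ofFn_eq_map, ← List.ofFn_eq_map, List.prod_ofFn] at this
    rw [negUnits_eq_map, mapD_map]
    refine le_trans (le_of_eq ?_) this
    simp only [hF, if_true, mul_one]
  have hprod : ∀ L, 1 - ∑ a, ∑ b, (1 - p L a b) ≤ ∏ a, ∏ b, p L a b := by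
    intro L
    have h1 : ∀ a, 1 - ∑ b, (1 - p L a b) ≤ ∏ b, p L a b ∧ 0 ≤ ∏ b, p L a b ∧
        ∏ b, p L a b ≤ 1 := by
      intro a
      have := one_sub_sum_le_prod (p L a) (List.finRange n) fun b _ => ⟨hp0 L a b, hp1 L a b⟩
      rwa [← List.ofFn_eq_map, ← List.ofFn_eq_map, List.sum_ofFn, List.prod_ofFn] at this
    have := (one_sub_sum_le_prod (fun a => ∏ b, p L a b) (List.finRange n) fun a _ =>
      (h1 a).2).1
    rw [← List.ofFn_eq_map, ← List.ofFn_eq_map, List.sum_ofFn, List.prod_ofFn] at this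
    refine le_trans (sub_le_sub_left (Finset.sum_le_sum fun a _ => ?_) 1) this
    linarith [(h1 a).1]
  have hc : (0 : ℝ) ≤ ((1 - q / 2 ^ m) ^ (n * n + 1) / q) ^ (k + 1) := by
    refine pow_nonneg (div_nonneg (pow_nonneg ?_ _) (Nat.cast_nonneg q)) _
    rw [sub_nonneg, div_le_one (by positivity)]
    exact hm
  rw [invertD, ex_bind]
  refine le_trans (mul_le_mul_of_nonneg_left ?_ hc) (ex_listD_ge hm k (negTrace M) _ fun L =>
    ex_nonneg fun rows _ => hF0 rows)
  calc 1 - n * (n * (2 * q ^ 3 / (q ^ k * μ ^ 2)))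
      = 1 - ∑ a : Fin n, ∑ b : Fin n, 2 * q ^ 3 / (q ^ k * μ ^ 2) := by simp
    _ ≤ 1 - ∑ a : Fin n, ∑ b : Fin n, (1 -
        ex (lineD q (Matrix (Fin n) (Fin n) (ZMod q)) k) fun L => p L a b) := by
        refine sub_le_sub_left (Finset.sum_le_sum fun a _ => Finset.sum_le_sum fun b _ => ?_) 1
        have := ex_lineD_entryD hA M (rowMatrix (negUnit q a) b) k hμ hμe
        rw [negTrace_rowMatrix] at this
        simp only [hp]
        linarith
    _ = ex (lineD q (Matrix (Fin n) (Fin n) (ZMod q)) k) fun L =>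
        1 - ∑ a, ∑ b, (1 - p L a b) := by
        simp only [ex_sub, ex_sum, ex_lineD_one]
    _ ≤ _ := ex_mono fun L _ => (hprod L).trans (hall L)

end


open scoped NNReal
open Distr

/-! ### Averages over the general linear group -/

section

variable {q : ℕ} [Fact q.Prime] {n : ℕ}

/-- The bound `1/4` alone does not survive induction; the extra term is chosen so that the step
reduces to `(1 / 2) ^ (n + 1) ≤ 1 / 2`. -/
theorem prod_one_sub_half_ge (n : ℕ) :
    (1 : ℝ) / 4 + (1 / 2) ^ (n + 1) / 2 ≤ ∏ i ∈ Finset.range (n + 1), (1 - (1 / 2 : ℝ) ^ (i + 1)) := by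
  induction n with
  | zero => norm_num
  | succ n ih =>
    rw [Finset.prod_range_succ]
    have h1 : (0 : ℝ) < (1 / 2) ^ (n + 1) := by positivity
    have h2 : (1 / 2 : ℝ) ^ (n + 1) ≤ 1 / 2 := by
      rw [pow_succ]
      have := pow_le_one₀ (n := n) (by norm_num : (0 : ℝ) ≤ 1 / 2) (by norm_num)
      linarith
    have h3 : (1 / 2 : ℝ) ^ (n + 1 + 1) = (1 / 2) ^ (n + 1) / 2 := by rw [pow_succ]; ring
    rw [h3]
    set e := (1 / 2 : ℝ) ^ (n + 1)
    have h4 : (1 / 4 + e / 2) * (1 - e / 2) ≤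
        (∏ i ∈ Finset.range (n + 1), (1 - (1 / 2 : ℝ) ^ (i + 1))) * (1 - e / 2) :=
      mul_le_mul_of_nonneg_right ih (by linarith)
    nlinarith

theorem prod_one_sub_half_ge' (n : ℕ) :
    (1 : ℝ) / 4 ≤ ∏ i ∈ Finset.range n, (1 - (1 / 2 : ℝ) ^ (i + 1)) := by
  cases n with
  | zero => norm_num
  | succ n =>
    refine le_trans ?_ (prod_one_sub_half_ge n)
    have : (0 : ℝ) ≤ (1 / 2) ^ (n + 1) := by positivity
    linarith

open Classical in
theorem sum_isUnit (f : Matrix (Fin n) (Fin n) (ZMod q) → ℝ) :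
    ∑ R : Matrix (Fin n) (Fin n) (ZMod q), (if IsUnit R then f R else 0) =
      ∑ R : GL (Fin n) (ZMod q), f R := by
  rw [← Finset.sum_filter]
  symm
  refine Finset.sum_bij (fun R _ => (R : Matrix (Fin n) (Fin n) (ZMod q))) ?_ ?_ ?_ ?_
  · intro R _
    simp
  · intro R _ S _ h
    exact Units.ext h
  · intro R hR
    obtain ⟨g, hg⟩ := (Finset.mem_filter.1 hR).2
    exact ⟨g, Finset.mem_univ _, hg⟩
  · intro R _
    rfl

-- An average over all matrices restricted to the invertible ones is their density times the average
-- over the group. This connects the analysis, which needs `R` uniform in a vector space, with the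
-- predictor, which sees `R` only in the group.
open Classical in
theorem expect_isUnit (f : Matrix (Fin n) (Fin n) (ZMod q) → ℝ) :
    𝔼 R : Matrix (Fin n) (Fin n) (ZMod q), (if IsUnit R then f R else 0) =
      (𝔼 R : Matrix (Fin n) (Fin n) (ZMod q), if IsUnit R then (1 : ℝ) else 0) *
        𝔼 R : GL (Fin n) (ZMod q), f R := by
  rw [Fintype.expect_eq_sum_div_card, Fintype.expect_eq_sum_div_card,
    Fintype.expect_eq_sum_div_card, sum_isUnit, sum_isUnit fun _ => 1]
  have : (Fintype.card (GL (Fin n) (ZMod q)) : ℝ) ≠ 0 := by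
    exact_mod_cast Fintype.card_ne_zero
  simp only [Finset.sum_const, Finset.card_univ, nsmul_eq_mul, mul_one]
  field_simp

-- The density is the product of the factors `1 - q ^ (-i)` for `1 ≤ i ≤ n`, and it is smallest for
-- `q = 2`.
open Classical in
theorem expect_isUnit_ge :
    (1 : ℝ) / 4 ≤ 𝔼 R : Matrix (Fin n) (Fin n) (ZMod q), if IsUnit R then (1 : ℝ) else 0 := by
  have hq : 2 ≤ q := (Fact.out : q.Prime).two_le
  have hq' : (2 : ℝ) ≤ q := by exact_mod_cast hq
  rw [Fintype.expect_eq_sum_div_card, sum_isUnit fun _ => 1]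
  simp only [Finset.sum_const, Finset.card_univ, nsmul_eq_mul, mul_one]
  rw [← Nat.card_eq_fintype_card, Matrix.card_GL_field]
  have hM : Fintype.card (Matrix (Fin n) (Fin n) (ZMod q)) = (q ^ n) ^ n := by
    change Fintype.card (Fin n → Fin n → ZMod q) = _
    simp [ZMod.card]
  rw [hM, ZMod.card]
  have hprod : ((∏ i : Fin n, (q ^ n - q ^ (i : ℕ)) : ℕ) : ℝ) / ((q ^ n) ^ n : ℕ) =
      ∏ i ∈ Finset.range n, (1 - (1 / (q : ℝ)) ^ (i + 1)) := by
    rw [← Finset.prod_range_reflect]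
    rw [Finset.prod_range]
    push_cast
    rw [div_eq_iff (by positivity)]
    have : ((q : ℝ) ^ n) ^ n = ∏ _i : Fin n, (q : ℝ) ^ n := by simp
    rw [this, ← Finset.prod_mul_distrib]
    refine Finset.prod_congr rfl fun i _ => ?_
    have hi := i.2
    rw [Nat.cast_sub (Nat.pow_le_pow_right (by omega) hi.le)]
    push_cast
    have h1 : n - 1 - (i : ℕ) + 1 = n - i := by omega
    have h2 : (q : ℝ) ^ n = q ^ (n - (i : ℕ)) * q ^ (i : ℕ) := by
      rw [← pow_add]
      congr 1
      omega
    rw [h1, h2, sub_mul, one_mul, ← mul_assoc, ← mul_pow, one_div, inv_mul_cancel₀ (by positivity),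
      one_pow, one_mul]
  rw [hprod]
  refine (prod_one_sub_half_ge' n).trans (Finset.prod_le_prod (fun i _ => ?_) fun i _ => ?_)
  · rw [sub_nonneg]
    exact pow_le_one₀ (by norm_num) (by norm_num)
  · refine sub_le_sub_left (pow_le_pow_left₀ (by positivity) ?_ _) 1
    exact one_div_le_one_div_of_le (by norm_num) hq'

/-! ### Random self-reduction of the instances -/

variable {m : ℕ}

/-- The list `R⁻¹ V`. -/
def pullBack (R : GL (Fin n) (ZMod q)) (V : Fin m → Fin n → ZMod q) : Fin m → Fin n → ZMod q :=
  fun i => ((R⁻¹ : GL (Fin n) (ZMod q)) : Matrix (Fin n) (Fin n) (ZMod q)).mulVec (V i)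

/-- Since `(M R)(R⁻¹ v) = M v`, the given collection can be reused unchanged. The query for `R` is a
genuine instance with secret `M R`, though `M` is unknown to whoever forms it. -/
theorem fV_pullBack (R M : GL (Fin n) (ZMod q)) (V : Fin m → Fin n → ZMod q) :
    fV (pullBack R V) (M * R) = fV V M := by
  unfold fV pullBack
  refine Multiset.map_congr rfl fun i _ => ?_
  rw [Matrix.mulVec_mulVec, ← Units.val_mul, mul_inv_cancel_right]

theorem instanceOf_eq (V : Fin m → Fin n → ZMod q) (M : GL (Fin n) (ZMod q)) :
    instanceOf V M = encInst (encColl (fV V M)) V := rfl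

theorem query_eq (R M : GL (Fin n) (ZMod q)) (V : Fin m → Fin n → ZMod q) :
    query (encColl (fV V M)) V (R : Matrix (Fin n) (Fin n) (ZMod q)) =
      instanceOf (pullBack R V) (M * R) := by
  rw [instanceOf_eq, fV_pullBack, query, if_pos R.isUnit]
  congr 1
  funext i
  rw [pullBack, Matrix.coe_units_inv]

/-- The bijection `(V, M) ↦ (R⁻¹ V, M R)`. -/
def pullBackEquiv (R : GL (Fin n) (ZMod q)) :
    (Fin m → Fin n → ZMod q) × GL (Fin n) (ZMod q) ≃
      (Fin m → Fin n → ZMod q) × GL (Fin n) (ZMod q) where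
  toFun p := (pullBack R p.1, p.2 * R)
  invFun p := (pullBack R⁻¹ p.1, p.2 * R⁻¹)
  left_inv p := by
    ext1
    · funext i
      simp only [pullBack, Matrix.mulVec_mulVec, ← Units.val_mul]
      simp
    · simp
  right_inv p := by
    ext1
    · funext i
      simp only [pullBack, Matrix.mulVec_mulVec, ← Units.val_mul]
      simp
    · simp

/-- For each fixed `R` the pair `(R⁻¹ V, M R)` is again uniform. Hence the average success of the
predictor is not changed by first randomizing the instance. -/
theorem expect_pullBack (F : (Fin m → Fin n → ZMod q) × GL (Fin n) (ZMod q) → ℝ) :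
    𝔼 p : (Fin m → Fin n → ZMod q) × GL (Fin n) (ZMod q),
      𝔼 R : GL (Fin n) (ZMod q), F (pullBack R p.1, p.2 * R) = 𝔼 p, F p := by
  rw [Finset.expect_comm]
  have : ∀ R : GL (Fin n) (ZMod q), 𝔼 p : (Fin m → Fin n → ZMod q) × GL (Fin n) (ZMod q),
      F (pullBack R p.1, p.2 * R) = 𝔼 p, F p := fun R =>
    Fintype.expect_equiv (pullBackEquiv R) _ _ fun _ => rfl
  simp only [this]
  exact Finset.expect_const Finset.univ_nonempty _

end

/-! ### The size of the instances -/

theorem depth_encList_le {l : List Data} {D : ℕ} (h : ∀ x ∈ l, x.depth ≤ D) :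
    (encList l).depth ≤ l.length + D := by
  induction l with
  | nil => simp [encList, Data.depth]
  | cons a l ih =>
    have h1 := ih fun x hx => h x (by simp [hx])
    have h2 := h a (by simp)
    simp only [encList, Data.depth, List.length_cons]
    omega

theorem depth_encNat_le (k : ℕ) : (encNat k).depth ≤ k := by
  have := depth_encList_le (l := List.replicate k .nil) (D := 0) fun x hx => by
    rw [List.eq_of_mem_replicate hx]
    rfl
  simpa [encNat] using this

section

variable {q n m : ℕ}

theorem refsBelow_encInst {W : Data} (hW : W.RefsBelow 0) (V : Fin m → Fin n → ZMod q) :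
    (encInst W V).RefsBelow 0 := by
  refine ⟨hW, refsBelow_encList fun x hx => ?_⟩
  obtain ⟨i, rfl⟩ := (List.mem_ofFn' _ _).1 hx
  refine refsBelow_encList fun x hx => ?_
  obtain ⟨j, rfl⟩ := (List.mem_ofFn' _ _).1 hx
  exact refsBelow_encNat _

variable [Fact q.Prime]

theorem depth_encInst_le {W : Data} (hW : W.depth ≤ m + (n + q)) (V : Fin m → Fin n → ZMod q) :
    (encInst W V).depth ≤ m + (n + q) + 1 := by
  have h : (encList (List.ofFn fun i => encVec (V i))).depth ≤ m + (n + q) := by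
    have := depth_encList_le (l := List.ofFn fun i => encVec (V i)) (D := n + q) fun x hx => by
      obtain ⟨i, rfl⟩ := (List.mem_ofFn' _ _).1 hx
      have := depth_encList_le (l := List.ofFn fun j => encField (V i j)) (D := q) fun x hx => by
        obtain ⟨j, rfl⟩ := (List.mem_ofFn' _ _).1 hx
        exact (depth_encNat_le _).trans (ZMod.val_lt _).le
      rwa [List.length_ofFn] at this
    rwa [List.length_ofFn] at this
  simp only [encInst, Data.depth]
  omega

theorem encColl_bounds (V : Fin m → Fin n → ZMod q) (M : GL (Fin n) (ZMod q)) :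
    (encColl (fV V M)).RefsBelow 0 ∧ (encColl (fV V M)).depth ≤ m + (n + q) := by
  have hmem : ∀ l ∈ ((fV V M).map fun w => List.ofFn fun i => (w i).val).sort (· ≤ ·),
      l.length = n ∧ ∀ k ∈ l, k ≤ q := by
    intro l hl
    rw [Multiset.mem_sort] at hl
    obtain ⟨w, -, rfl⟩ := Multiset.mem_map.1 hl
    refine ⟨List.length_ofFn, fun k hk => ?_⟩
    obtain ⟨i, rfl⟩ := (List.mem_ofFn' _ _).1 hk
    exact (ZMod.val_lt _).le
  have hlen : (((fV V M).map fun w => List.ofFn fun i => (w i).val).sort (· ≤ ·)).length = m := by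
    rw [Multiset.length_sort, Multiset.card_map, fV, Multiset.card_map]
    simp
  unfold encColl
  constructor
  · refine refsBelow_encList fun x hx => ?_
    obtain ⟨l, hl, rfl⟩ := List.mem_map.1 hx
    refine refsBelow_encList fun x hx => ?_
    obtain ⟨k, hk, rfl⟩ := List.mem_map.1 hx
    exact refsBelow_encNat _
  · have := depth_encList_le (l := (((fV V M).map fun w => List.ofFn fun i =>
      (w i).val).sort (· ≤ ·)).map fun l => encList (l.map encNat)) (D := n + q) fun x hx => by
        obtain ⟨l, hl, rfl⟩ := List.mem_map.1 hx
        obtain ⟨h1, h2⟩ := hmem l hl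
        have := depth_encList_le (l := l.map encNat) (D := q) fun x hx => by
          obtain ⟨k, hk, rfl⟩ := List.mem_map.1 hx
          exact (depth_encNat_le k).trans (h2 k hk)
        rwa [List.length_map, h1] at this
    rwa [List.length_map, hlen] at this

theorem instanceOf_bounds (V : Fin m → Fin n → ZMod q) (M : GL (Fin n) (ZMod q)) :
    (instanceOf V M).RefsBelow 0 ∧ (instanceOf V M).depth ≤ m + (n + q) + 1 := by
  obtain ⟨h1, h2⟩ := encColl_bounds V M
  exact ⟨refsBelow_encInst h1 V, depth_encInst_le h2 V⟩

/-! ### Shifts of the predictor -/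

theorem sum_answer {A : Com} {d : Data} {t : ℕ} (h : HaltsWithin t (start A d)) (u : ZMod q) :
    ∑ a, answer A u d a = 1 := by
  have := sum_probWithin_fiber (fun x => readField q x + u) h
  simp only [answer, prob_eq_of_haltsWithin h]
  rw [this]
  simp [start, normSq_single]

theorem answer_shift (A : Com) (d : Data) (u a : ZMod q) :
    answer A u d a = answer A 0 d (a - u) := by
  unfold answer
  congr 1
  ext x
  simp only [Set.mem_ofPred_eq, add_zero]
  exact eq_sub_iff_add_eq.symm

theorem sum_answer_shift {A : Com} {d : Data} {t : ℕ} (h : HaltsWithin t (start A d)) (a : ZMod q) :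
    ∑ u, answer A u d a = 1 := by
  rw [← sum_answer h (0 : ZMod q)]
  rw [Finset.sum_congr rfl fun u _ => answer_shift A d u a]
  exact Fintype.sum_equiv (Equiv.subLeft a) _ _ fun _ => rfl

/-- If `P 0` is large, take `u = 0`. If it is small, the remaining `q - 1` values share an excess of
more than `δ`, and one of them exceeds `1 / q` by more than `δ / q`. Thus a predictor that is too
often wrong is as useful as one that is too often right. -/
theorem exists_shift {P : ZMod q → ℝ} (hP : ∑ u, P u = 1) {δ : ℝ}
    (h : δ < |P 0 - 1 / q|) (hδ : 0 < δ) : ∃ u, 1 / q + δ / q ≤ P u := by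
  have hq1 : (1 : ℝ) < q := by exact_mod_cast (Fact.out : q.Prime).one_lt
  by_contra! hlt
  have hsum : ∑ u ∈ Finset.univ.erase (0 : ZMod q), P u ≤ (q - 1) * (1 / q + δ / q) := by
    refine (Finset.sum_le_sum fun u _ => (hlt u).le).trans (le_of_eq ?_)
    rw [Finset.sum_const, Finset.card_erase_of_mem (Finset.mem_univ _), Finset.card_univ,
      ZMod.card, nsmul_eq_mul, Nat.cast_sub (Fact.out : q.Prime).one_lt.le, Nat.cast_one]
  rw [← Finset.add_sum_erase _ _ (Finset.mem_univ (0 : ZMod q))] at hP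
  have h0 := hlt 0
  have e1 : (q - 1 : ℝ) * (1 / q + δ / q) = 1 - 1 / q + δ - δ / q := by field_simp; ring
  have e2 : 0 < δ / q := by positivity
  have e3 : δ / q ≤ δ := div_le_self hδ.le hq1.le
  rcases lt_abs.1 h with h | h <;> linarith

end


open scoped NNReal
open Distr

/-! ### The success probability of the inverter -/

section

variable {q n m : ℕ}

theorem encRows_ofFn (M : Matrix (Fin n) (Fin n) (ZMod q)) :
    encRows (List.ofFn fun a => List.ofFn (M a)) = encMat M := by
  rw [encRows, encMat_eq, List.map_ofFn, List.map_ofFn]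
  congr 2
  funext i
  exact (encVec_eq (M i)).symm

variable [Fact q.Prime]

/-- The average success probability of the predictor on the queries made for a given instance. -/
noncomputable def orbitP (A : Com) (u : ZMod q)
    (p : (Fin m → Fin n → ZMod q) × GL (Fin n) (ZMod q)) : ℝ :=
  𝔼 R : GL (Fin n) (ZMod q), answer A u (instanceOf (pullBack R p.1) (p.2 * R))
    ((p.2 * R : GL (Fin n) (ZMod q)) : Matrix (Fin n) (Fin n) (ZMod q)).trace

theorem expect_orbitP (A : Com) (u : ZMod q) :
    𝔼 p : (Fin m → Fin n → ZMod q) × GL (Fin n) (ZMod q), orbitP A u p =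
      𝔼 p : (Fin m → Fin n → ZMod q) × GL (Fin n) (ZMod q),
        answer A u (instanceOf p.1 p.2) (p.2 : Matrix (Fin n) (Fin n) (ZMod q)).trace := by
  unfold orbitP
  rw [← expect_pullBack fun p : (Fin m → Fin n → ZMod q) × GL (Fin n) (ZMod q) =>
    answer A u (instanceOf p.1 p.2) (p.2 : Matrix (Fin n) (Fin n) (ZMod q)).trace]

/-- The factor `1 / 4` is one half for imperfect sampling times one half for the vote; `q ^ (k + 1)`
is the price of guessing the values of the functional on the `k + 1` random matrices. -/
theorem prob_invertR_ge {X a j k : ℕ} {A : Com} {u : ZMod q} {δ : ℝ} (hX : 5 ≤ X) (hq : q ≤ X)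
    (hn : 0 < n) (hnX : n + 1 ≤ X) (hm : 0 < m) (hinst : m + (n + q) + 1 ≤ X) (ha : 0 < a)
    (hT : q * (q * (a * m ^ j)) ≤ X)
    (hA : ∀ (V : Fin m → Fin n → ZMod q) (M : GL (Fin n) (ZMod q)),
      HaltsWithin X (start A (instanceOf V M)))
    (hk : k = Nat.clog q (a * m ^ j)) (hδ : 0 < δ) (hqm : (q : ℝ) ≤ 2 ^ m)
    (hc : (1 : ℝ) / 2 ≤ (1 - q / 2 ^ m) ^ ((n * n + 1) * (k + 1)))
    (hN : 256 * q * (n : ℝ) ^ 2 ≤ q ^ k * δ ^ 2) (p : (Fin m → Fin n → ZMod q) × GL (Fin n) (ZMod q))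
    (hp : 1 / q + δ / 2 ≤ orbitP A u p) :
    1 / (4 * q ^ (k + 1)) ≤ prob ((RX.invertR A u a j).compile 0) (instanceOf p.1 p.2)
      {encMat (p.2 : Matrix (Fin n) (Fin n) (ZMod q))} := by
  classical
  obtain ⟨V, M⟩ := p
  have hq0 : (0 : ℝ) < q := by exact_mod_cast (Fact.out : q.Prime).pos
  simp only at hp ⊢
  set W := encColl (fV V M) with hW
  have hquery : ∀ R : GL (Fin n) (ZMod q), query W V (R : Matrix (Fin n) (Fin n) (ZMod q)) =
      instanceOf (pullBack R V) (M * R) := fun R => query_eq R M V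
  have hs : Samples X (RX.invertR A u a j) (encInst W V) (fun rows => encRows rows)
      (invertD A u k W V) := by
    rw [hk]
    refine samples_invertR hX hq hn hnX hm (by omega) ha hT ?_
    rintro _ ⟨R, rfl⟩
    rw [hquery]
    obtain ⟨h1, h2⟩ := instanceOf_bounds (pullBack R V) (M * R)
    exact ⟨h1, h2.trans hinst, hA _ _⟩
  have hmass : ∀ R : Matrix (Fin n) (Fin n) (ZMod q), IsUnit R →
      ∑ a, answer A u (query W V R) a = 1 := by
    rintro _ ⟨R, rfl⟩
    rw [hquery]
    exact sum_answer (hA _ _) u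
  set ρ := 𝔼 R : Matrix (Fin n) (Fin n) (ZMod q), if IsUnit R then (1 : ℝ) else 0 with hρ
  have hρ4 : 1 / 4 ≤ ρ := by convert expect_isUnit_ge (q := q) (n := n)
  have herr : errP A u W V (M : Matrix (Fin n) (Fin n) (ZMod q)) 0 = ρ * orbitP A u (V, M) := by
    have h1 := expect_isUnit (q := q) (n := n) fun R =>
      answer A u (query W V R) ((M : Matrix (Fin n) (Fin n) (ZMod q)) * R).trace
    have h2 : orbitP A u (V, M) = 𝔼 R : GL (Fin n) (ZMod q), answer A u
        (query W V (R : Matrix (Fin n) (Fin n) (ZMod q)))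
        ((M : Matrix (Fin n) (Fin n) (ZMod q)) * (R : Matrix (Fin n) (Fin n) (ZMod q))).trace := by
      refine Finset.expect_congr rfl fun R _ => ?_
      rw [hquery, Units.val_mul]
    rw [h2]
    unfold errP ansP
    simp only [add_zero]
    exact h1
  set μ := q * errP A u W V (M : Matrix (Fin n) (Fin n) (ZMod q)) 0 - ρ with hμ
  -- Restricting to invertible matrices scales everything by the density, so `μ = ρ * (q * orbitP -
  -- 1)`. The advantage `δ / 2` and `ρ ≥ 1 / 4` give the constant `8`.
  have hμge : q * δ / 8 ≤ μ := by
    have h1 : q * δ / 2 ≤ q * orbitP A u (V, M) - 1 := by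
      have := mul_le_mul_of_nonneg_left hp hq0.le
      rw [mul_add, mul_one_div_cancel hq0.ne'] at this
      linarith
    have h2 : μ = ρ * (q * orbitP A u (V, M) - 1) := by
      rw [hμ, herr]
      ring
    have h3 : 0 < q * δ := by positivity
    rw [h2]
    nlinarith
  have hμ0 : 0 < μ := lt_of_lt_of_le (by positivity) hμge
  have hge := ex_invertD_ge (W := W) hqm hmass (M : Matrix (Fin n) (Fin n) (ZMod q)) k hμ0 (by
    rw [hμ, hρ])
  -- As `μ ^ 2 ≥ q ^ 2 * δ ^ 2 / 64`, the failure bound is at most `128 * q * n ^ 2 / (q ^ k * δ ^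
  -- 2)`. The constant `256` in `hN` makes this at most one half.
  have hhalf : (1 : ℝ) / 2 ≤ 1 - n * (n * (2 * q ^ 3 / (q ^ k * μ ^ 2))) := by
    have h1 : q ^ 2 * δ ^ 2 / 64 ≤ μ ^ 2 := by
      have := pow_le_pow_left₀ (by positivity) hμge 2
      refine le_trans (le_of_eq ?_) this
      ring
    have h2 : (n : ℝ) * (n * (2 * q ^ 3 / (q ^ k * μ ^ 2))) =
        2 * n ^ 2 * q ^ 3 / (q ^ k * μ ^ 2) := by ring
    rw [h2]
    have h3 : 2 * (n : ℝ) ^ 2 * q ^ 3 / (q ^ k * μ ^ 2) ≤ 1 / 2 := by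
      rw [div_le_iff₀ (by positivity)]
      have h4 := mul_le_mul_of_nonneg_left h1 (by positivity : (0 : ℝ) ≤ q ^ k)
      have h5 := mul_le_mul_of_nonneg_left hN (by positivity : (0 : ℝ) ≤ (q : ℝ) ^ 2)
      nlinarith
    linarith
  have hfac : 1 / (2 * (q : ℝ) ^ (k + 1)) ≤
      ((1 - q / 2 ^ m) ^ (n * n + 1) / q) ^ (k + 1) := by
    rw [div_pow, ← pow_mul, ← div_div]
    exact div_le_div_of_nonneg_right hc (by positivity)
  have hd : DecidablePred (· ∈ ({encMat (M : Matrix (Fin n) (Fin n) (ZMod q))} : Set Data)) :=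
    Classical.decPred _
  rw [instanceOf_eq, RX.prob_compile hs.1, hs.2.1]
  calc 1 / (4 * (q : ℝ) ^ (k + 1)) = 1 / (2 * (q : ℝ) ^ (k + 1)) * (1 / 2) := by
        field_simp
        norm_num
    _ ≤ ((1 - q / 2 ^ m) ^ (n * n + 1) / q) ^ (k + 1) *
        (1 - n * (n * (2 * q ^ 3 / (q ^ k * μ ^ 2)))) :=
        mul_le_mul hfac hhalf (by norm_num) (le_trans (by positivity) hfac)
    _ ≤ _ := hge
    _ ≤ _ := by
        refine ex_mono fun rows _ => ?_
        split_ifs with h1 h2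
        · exact le_rfl
        · exact absurd ((congrArg encRows h1).trans (encRows_ofFn _)) h2
        · exact zero_le_one
        · exact le_rfl

theorem expect_invertR_ge {X a j k : ℕ} {A : Com} {u : ZMod q} {δ : ℝ} (hX : 5 ≤ X) (hq : q ≤ X)
    (hn : 0 < n) (hnX : n + 1 ≤ X) (hm : 0 < m) (hinst : m + (n + q) + 1 ≤ X) (ha : 0 < a)
    (hT : q * (q * (a * m ^ j)) ≤ X)
    (hA : ∀ (V : Fin m → Fin n → ZMod q) (M : GL (Fin n) (ZMod q)),
      HaltsWithin X (start A (instanceOf V M)))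
    (hk : k = Nat.clog q (a * m ^ j)) (hδ : 0 < δ) (hqm : (q : ℝ) ≤ 2 ^ m)
    (hc : (1 : ℝ) / 2 ≤ (1 - q / 2 ^ m) ^ ((n * n + 1) * (k + 1)))
    (hN : 256 * q * (n : ℝ) ^ 2 ≤ q ^ k * δ ^ 2)
    (hu : 1 / q + δ ≤ 𝔼 p : (Fin m → Fin n → ZMod q) × GL (Fin n) (ZMod q),
        answer A u (instanceOf p.1 p.2) (p.2 : Matrix (Fin n) (Fin n) (ZMod q)).trace) :
    δ / 2 * (1 / (4 * q ^ (k + 1))) ≤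
      𝔼 p : (Fin m → Fin n → ZMod q) × GL (Fin n) (ZMod q),
        prob ((RX.invertR A u a j).compile 0) (instanceOf p.1 p.2)
          {encMat (p.2 : Matrix (Fin n) (Fin n) (ZMod q))} := by
  set σ : ℝ := 1 / (4 * q ^ (k + 1)) with hσ
  have hσ0 : 0 ≤ σ := by positivity
  have hq0 : (0 : ℝ) < q := by exact_mod_cast (Fact.out : q.Prime).pos
  have hle1 : ∀ p : (Fin m → Fin n → ZMod q) × GL (Fin n) (ZMod q), orbitP A u p ≤ 1 := by
    intro p
    have : orbitP A u p ≤ 𝔼 _R : GL (Fin n) (ZMod q), (1 : ℝ) := by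
      refine Finset.expect_le_expect fun R _ => ?_
      rw [← sum_answer (hA (pullBack R p.1) (p.2 * R)) u]
      exact Finset.single_le_sum (f := fun a => answer A u (instanceOf (pullBack R p.1) (p.2 * R)) a)
        (fun a _ => answer_nonneg _ _ _ _) (Finset.mem_univ _)
    rwa [Finset.expect_const Finset.univ_nonempty] at this
  rw [← expect_orbitP] at hu
  -- This is Markov's inequality in pointwise form: the linear function on the left is nonpositive
  -- on bad instances, and on good ones it is at most `σ`, because `orbitP` is at most one.
  have key : 𝔼 p : (Fin m → Fin n → ZMod q) × GL (Fin n) (ZMod q),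
      σ * (orbitP A u p - (1 / q + δ / 2)) ≤
      𝔼 p : (Fin m → Fin n → ZMod q) × GL (Fin n) (ZMod q),
        prob ((RX.invertR A u a j).compile 0) (instanceOf p.1 p.2)
          {encMat (p.2 : Matrix (Fin n) (Fin n) (ZMod q))} := by
    refine Finset.expect_le_expect fun p _ => ?_
    by_cases hp : 1 / q + δ / 2 ≤ orbitP A u p
    · refine le_trans ?_ (prob_invertR_ge hX hq hn hnX hm hinst ha hT hA hk hδ hqm hc hN p hp)
      have h1 : (0 : ℝ) < 1 / q := by positivity
      have := hle1 p
      nlinarith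
    · push Not at hp
      exact (mul_nonpos_of_nonneg_of_nonpos hσ0 (by linarith)).trans (prob_nonneg _ _ _)
  refine le_trans ?_ key
  rw [← Finset.mul_expect, Finset.expect_sub_distrib, Finset.expect_const Finset.univ_nonempty]
  nlinarith

theorem haltsWithin_invertR {X a j : ℕ} {A : Com} {u : ZMod q} (hX : 5 ≤ X) (hq : q ≤ X)
    (hn : 0 < n) (hnX : n + 1 ≤ X) (hm : 0 < m) (hinst : m + (n + q) + 1 ≤ X) (ha : 0 < a)
    (hT : q * (q * (a * m ^ j)) ≤ X)
    (hA : ∀ (V : Fin m → Fin n → ZMod q) (M : GL (Fin n) (ZMod q)),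
      HaltsWithin X (start A (instanceOf V M)))
    (V : Fin m → Fin n → ZMod q) (M : GL (Fin n) (ZMod q)) :
    HaltsWithin ((RX.invertR A u a j).tm X)
      (start ((RX.invertR A u a j).compile 0) (instanceOf V M)) := by
  refine RX.tm_compile_bound (samples_invertR (V := V) (W := encColl (fV V M)) hX hq hn hnX hm
    (by omega) ha hT ?_).1
  rintro _ ⟨R, rfl⟩
  rw [query_eq]
  obtain ⟨h1, h2⟩ := instanceOf_bounds (pullBack R V) (M * R)
  exact ⟨h1, h2.trans hinst, hA _ _⟩

end


open scoped NNReal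
open Distr

/-! ### Polynomial bounds -/

theorem PolyBdd.mono {f g : ℕ → ℕ} (hg : PolyBdd g) (h : ∀ n, 1 ≤ n → f n ≤ g n) : PolyBdd f := by
  obtain ⟨C, c, hg⟩ := hg
  exact ⟨C, c, fun n hn => (h n hn).trans (hg n hn)⟩

theorem PolyBdd.pow {f : ℕ → ℕ} (hf : PolyBdd f) (j : ℕ) : PolyBdd fun n => f n ^ j := by
  induction j with
  | zero => simpa using PolyBdd.const 1
  | succ j ih => simpa only [pow_succ] using ih.mul hf

theorem PolyBdd.comp {f g : ℕ → ℕ} (hf : PolyBdd f) (hg : PolyBdd g) (h : ∀ n, 1 ≤ n → 1 ≤ g n) :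
    PolyBdd fun n => f (g n) := by
  obtain ⟨C, c, hf⟩ := hf
  exact ((PolyBdd.const C).mul (hg.pow c)).mono fun n hn => hf _ (h n hn)

theorem PolyBdd.isPoly {f : ℕ → ℕ} (hf : PolyBdd f) (h : ∀ n, 1 ≤ n → 0 < f n) :
    IsPoly fun n => (f n : ℝ) := by
  obtain ⟨C, c, hf⟩ := hf
  refine ⟨fun n hn => Nat.cast_pos.2 (h n hn), c, ?_⟩
  refine Asymptotics.IsBigO.of_bound C ?_
  filter_upwards [Filter.eventually_ge_atTop 1] with n hn
  rw [Real.norm_of_nonneg (by positivity), Real.norm_of_nonneg (by positivity)]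
  exact_mod_cast hf n hn

/-- The eventual bound is made valid for all `n ≥ 1`, as running times are required to hold in every
dimension. -/
theorem IsPoly.exists_le {s : ℕ → ℝ} (hs : IsPoly s) :
    ∃ C c : ℕ, ∀ n : ℕ, 1 ≤ n → s n ≤ C * (n : ℝ) ^ c := by
  obtain ⟨-, c, h⟩ := hs
  obtain ⟨C, hC, h⟩ := Asymptotics.bound_of_isBigO_nat_atTop h
  refine ⟨⌈C⌉₊, c, fun n hn => ?_⟩
  have hn0 : (0 : ℝ) < (n : ℝ) ^ c := by positivity
  have := h hn0.ne'
  rw [Real.norm_of_nonneg hn0.le] at this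
  exact (le_abs_self _).trans (this.trans (mul_le_mul_of_nonneg_right (Nat.le_ceil C) hn0.le))

theorem PolyBdd.eventually_le_two_pow {f : ℕ → ℕ} (hf : PolyBdd f) :
    ∀ᶠ n in Filter.atTop, f n ≤ 2 ^ n := by
  obtain ⟨C, c, hf⟩ := hf
  have h := (tendsto_pow_const_div_const_pow_of_one_lt c (one_lt_two : (1 : ℝ) < 2)).eventually
    (gt_mem_nhds (by positivity : (0 : ℝ) < 1 / (C + 1)))
  filter_upwards [h, Filter.eventually_ge_atTop 1] with n hn hn1
  refine (hf n hn1).trans ?_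
  rw [div_lt_div_iff₀ (by positivity) (by positivity)] at hn
  have : (C * n ^ c : ℝ) ≤ 2 ^ n := by
    have : (0 : ℝ) ≤ (n : ℝ) ^ c := by positivity
    nlinarith
  exact_mod_cast this

/-- A list of `m n` vectors is at least as long as the dimension, and linearly long. -/
theorem bounds_of_round {ε : ℝ} (hε : 0 < ε) {m : ℕ → ℕ}
    (hm : ∀ n : ℕ, m n = ⌊(1 + ε) * (n : ℝ)⌋₊ ∨ m n = ⌈(1 + ε) * (n : ℝ)⌉₊) (n : ℕ) :
    n ≤ m n ∧ m n ≤ ⌈1 + ε⌉₊ * n := by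
  have h1 : n ≤ ⌊(1 + ε) * (n : ℝ)⌋₊ := Nat.le_floor (by
    have : (0 : ℝ) ≤ n := by positivity
    nlinarith)
  have h2 : ⌈(1 + ε) * (n : ℝ)⌉₊ ≤ ⌈1 + ε⌉₊ * n := Nat.ceil_le.2 (by
    push_cast
    exact mul_le_mul_of_nonneg_right (Nat.le_ceil _) (by positivity))
  have h3 := Nat.floor_le_ceil ((1 + ε) * (n : ℝ))
  rcases hm n with h | h <;> omega


open scoped NNReal
open Distr

/-! ### The trace is hard-core -/

section

variable {q : ℕ} [Fact q.Prime]

theorem polyTimeComputable_trace : PolyTimeComputable q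
    fun n M => Matrix.trace (M : Matrix (Fin n) (Fin n) (ZMod q)) := by
  classical
  refine ⟨(Ex.trace q).compile 0, Ex.classical_compile _ 0,
    fun n => (((Ex.trace q).tm (n + q) + 1 : ℕ) : ℝ), ?_, fun n _ M => ?_⟩
  · refine PolyBdd.isPoly ?_ fun _ _ => Nat.succ_pos _
    exact ((Ex.polyBdd_tm (Ex.trace q)).comp (PolyBdd.id.add (.const q)) fun n hn => by omega).add
      (.const 1)
  · obtain ⟨h1, h2⟩ := evals_trace (X := n + q) (by omega) (by omega)
      (M : Matrix (Fin n) (Fin n) (ZMod q))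
    have h3 := (Ex.runs_compile _ h2).val_start
      {encField (M : Matrix (Fin n) (Fin n) (ZMod q)).trace}
    refine ⟨?_, ?_⟩
    · rw [Nat.floor_natCast]
      exact h3.1.mono (Nat.le_succ _)
    · rw [h3.prob, ex_pure, h1]
      simp

/-- By Bernoulli's inequality the loss over all `(n * n + 1) * (k + 1)` random scalars is at most
their number times `q / 2 ^ m n`. That number is polynomial in `n`, and `m n ≥ n`. -/
theorem eventually_half_le (D a j : ℕ) {m : ℕ → ℕ} (hm : ∀ n, n ≤ m n ∧ m n ≤ D * n)
    (ha : 0 < a) : ∀ᶠ n in Filter.atTop, (q : ℝ) ≤ 2 ^ m n ∧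
      (1 : ℝ) / 2 ≤ (1 - q / 2 ^ m n) ^ ((n * n + 1) * (Nat.clog q (a * m n ^ j) + 1)) := by
  have hq := (Fact.out : q.Prime).one_lt
  have hG : PolyBdd fun n => 2 * ((n * n + 1) * (q * (a * (D * n) ^ j) + 1)) * q :=
    ((PolyBdd.const 2).mul (((PolyBdd.id.mul PolyBdd.id).add (.const 1)).mul (((PolyBdd.const q).mul
      ((PolyBdd.const a).mul (((PolyBdd.const D).mul PolyBdd.id).pow j))).add (.const 1)))).mul
      (.const q)
  filter_upwards [hG.eventually_le_two_pow, Filter.eventually_ge_atTop 1] with n hn hn1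
  obtain ⟨hm1, hm2⟩ := hm n
  set k := Nat.clog q (a * m n ^ j) with hk
  have hkle : k + 1 ≤ q * (a * (D * n) ^ j) + 1 := by
    have h1 : k < q ^ k := Nat.lt_pow_self hq
    have h2 : q ^ k ≤ q * (a * m n ^ j) := pow_clog_le hq (Nat.mul_pos ha (pow_pos (by omega) j))
    have h3 : q * (a * m n ^ j) ≤ q * (a * (D * n) ^ j) :=
      Nat.mul_le_mul_left _ (Nat.mul_le_mul_left _ (Nat.pow_le_pow_left hm2 j))
    omega
  have hN : 2 * ((n * n + 1) * (k + 1)) * q ≤ 2 ^ m n :=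
    calc 2 * ((n * n + 1) * (k + 1)) * q
        ≤ 2 * ((n * n + 1) * (q * (a * (D * n) ^ j) + 1)) * q :=
          Nat.mul_le_mul_right _ (Nat.mul_le_mul_left _ (Nat.mul_le_mul_left _ hkle))
      _ ≤ 2 ^ n := hn
      _ ≤ 2 ^ m n := Nat.pow_le_pow_right (by norm_num) hm1
  set N := (n * n + 1) * (k + 1) with hNdef
  have hN1 : 1 ≤ N := Nat.mul_pos (by omega) (by omega)
  have hN' : (2 * N * q : ℝ) ≤ 2 ^ m n := by exact_mod_cast hN
  have hN1' : (1 : ℝ) ≤ N := by exact_mod_cast hN1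
  have hq0 : (0 : ℝ) < q := by exact_mod_cast (by omega : 0 < q)
  have hqm : (q : ℝ) ≤ 2 ^ m n := by nlinarith
  refine ⟨hqm, ?_⟩
  have hx : (q : ℝ) / 2 ^ m n ≤ 1 := div_le_one_of_le₀ hqm (by positivity)
  have hb := one_add_mul_le_pow (a := -((q : ℝ) / 2 ^ m n)) (by linarith) N
  rw [← sub_eq_add_neg] at hb
  refine le_trans ?_ hb
  have : (N : ℝ) * (q / 2 ^ m n) ≤ 1 / 2 := by
    rw [← mul_div_assoc, div_le_iff₀ (by positivity)]
    linarith
  linarith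

/-- For a fixed shift `u` the inverter is one uniform program `B`. If the shifted predictor had the
stated advantage for infinitely many `n`, then `B` would violate hardness at these `n`, for a
polynomial `t` that serves both as its running time and as the inverse of its success probability.
-/
theorem eventually_shift_lt {m : ℕ → ℕ} {D : ℕ} (hm : ∀ n, n ≤ m n ∧ m n ≤ D * n)
    (hard : ∀ t : ℕ → ℝ, IsPoly t → IsHard q m t) {s : ℕ → ℝ} (hs : IsPoly s) {A : Com}
    (hA : RunsInTime q m A s) (u : ZMod q) :
    ∀ᶠ n in Filter.atTop,
      (𝔼 p : (Fin (m n) → Fin n → ZMod q) × GL (Fin n) (ZMod q), answer A u (instanceOf p.1 p.2)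
        (p.2 : Matrix (Fin n) (Fin n) (ZMod q)).trace) < 1 / q + 1 / s n / q := by
  have hq := (Fact.out : q.Prime).one_lt
  have hq0 : (0 : ℝ) < q := by exact_mod_cast (by omega : 0 < q)
  obtain ⟨C₀, c, hsC₀⟩ := hs.exists_le
  obtain ⟨C, hC, hsC⟩ : ∃ C : ℕ, 0 < C ∧ ∀ n : ℕ, 1 ≤ n → s n ≤ (C * n ^ c : ℕ) := by
    refine ⟨C₀ + 1, Nat.succ_pos _, fun n hn => (hsC₀ n hn).trans ?_⟩
    push_cast
    exact mul_le_mul_of_nonneg_right (by linarith) (by positivity)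
  -- With `S = C * n ^ c ≥ s n` and `δ = 1 / (q * S)`, the vote needs `256 * q ^ 3 * n ^ 2 * S ^ 2 ≤
  -- q ^ k`. The left side is `a * n ^ j`, and `q ^ k` is at least `a * m n ^ j`.
  set a := 256 * q ^ 3 * C ^ 2 with ha
  have ha0 : 0 < a := by positivity
  set j := 2 + 2 * c with hj
  have hmP : PolyBdd m := ((PolyBdd.const D).mul .id).mono fun n _ => (hm n).2
  have hNP : PolyBdd fun n => q * (q * (a * m n ^ j)) :=
    (PolyBdd.const q).mul ((PolyBdd.const q).mul ((PolyBdd.const a).mul (hmP.pow j)))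
  have hSP : PolyBdd fun n => C * n ^ c := (PolyBdd.const C).mul (PolyBdd.id.pow c)
  set X : ℕ → ℕ := fun n => 5 + q + (n + 1) + (m n + (n + q) + 1) + q * (q * (a * m n ^ j)) +
    C * n ^ c with hX
  have hXP : PolyBdd X := ((((PolyBdd.const (5 + q)).add (PolyBdd.id.add (.const 1))).add
    ((hmP.add (PolyBdd.id.add (.const q))).add (.const 1))).add hNP).add hSP
  set B := (RX.invertR A u a j).compile 0 with hB
  -- The first summand is the running time. The second exceeds `8 * q * S * q ^ (k + 1)`, the
  -- inverse of the success probability `δ / 2 * (1 / (4 * q ^ (k + 1)))`, because `q ^ k` is at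
  -- most `q * (a * m n ^ j)`.
  set t : ℕ → ℕ := fun n => (RX.invertR A u a j).tm (X n) +
    (8 * q * (C * n ^ c) * (q * (q * (a * m n ^ j))) + 1) with ht
  have htP : PolyBdd t := ((RX.polyBdd_tm _).comp hXP fun n _ => by simp only [hX]; omega).add
    ((((PolyBdd.const (8 * q)).mul hSP).mul hNP).add (.const 1))
  have hAX : ∀ n, 1 ≤ n → ∀ (V : Fin (m n) → Fin n → ZMod q) (M : GL (Fin n) (ZMod q)),
      HaltsWithin (X n) (start A (instanceOf V M)) := fun n hn V M =>
    (hA n hn V M).mono ((Nat.floor_le_of_le (hsC n hn)).trans (by simp only [hX]; omega))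
  have hBt : RunsInTime q m B fun n => (t n : ℝ) := by
    intro n hn V M
    rw [Nat.floor_natCast]
    refine (haltsWithin_invertR (X := X n) (by simp only [hX]; omega) (by simp only [hX]; omega) hn
      (by simp only [hX]; omega) (hn.trans (hm n).1) (by simp only [hX]; omega) ha0
      (by simp only [hX]; omega) (hAX n hn) V M).mono ?_
    exact Nat.le_add_right _ _
  filter_upwards [hard _ (htP.isPoly fun n _ => by simp only [ht]; omega) B hBt,
    eventually_half_le (q := q) D a j hm ha0, Filter.eventually_ge_atTop 1] with n hinv hhalf hn
  by_contra! hlt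
  set k := Nat.clog q (a * m n ^ j) with hk
  set S : ℝ := ((C * n ^ c : ℕ) : ℝ) with hS
  have hS0 : 0 < S := Nat.cast_pos.2 (by positivity)
  have hs0 : 0 < s n := hs.1 n hn
  have hmn : 0 < m n := hn.trans (hm n).1
  have hlow : a * m n ^ j ≤ q ^ k := Nat.le_pow_clog hq _
  have hupp : q ^ k ≤ q * (a * m n ^ j) := pow_clog_le hq (by positivity)
  have hlow' : 256 * (q : ℝ) ^ 3 * n ^ 2 * S ^ 2 ≤ q ^ k := by
    have h1 : a * n ^ j ≤ q ^ k :=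
      (Nat.mul_le_mul_left _ (Nat.pow_le_pow_left (hm n).1 j)).trans hlow
    have h2 : (a * n ^ j : ℝ) ≤ q ^ k := by exact_mod_cast h1
    refine le_trans (le_of_eq ?_) h2
    rw [ha, hj, hS]
    push_cast
    ring
  have hδ : (0 : ℝ) < 1 / (q * S) := by positivity
  have hle : 1 / (q : ℝ) + 1 / (q * S) ≤ 1 / q + 1 / s n / q := by
    rw [div_div, mul_comm (s n)]
    have : (q : ℝ) * s n ≤ q * S := mul_le_mul_of_nonneg_left (hsC n hn) hq0.le
    have := one_div_le_one_div_of_le (by positivity) this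
    linarith
  have hge := expect_invertR_ge (X := X n) (k := k) (by simp only [hX]; omega)
    (by simp only [hX]; omega) hn (by simp only [hX]; omega) hmn (by simp only [hX]; omega) ha0
    (by simp only [hX]; omega) (hAX n hn) hk hδ hhalf.1 hhalf.2 (by
      rw [div_pow, one_pow, ← div_eq_mul_one_div, le_div_iff₀ (by positivity)]
      refine le_trans (le_of_eq ?_) hlow'
      ring) (hle.trans hlt)
  have hT : 8 * q * S * q ^ (k + 1) < (t n : ℝ) := by
    have h1 : 8 * q * (C * n ^ c) * q ^ (k + 1) < t n := by
      have h2 : q ^ (k + 1) ≤ q * (q * (a * m n ^ j)) := by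
        rw [pow_succ, mul_comm]
        exact Nat.mul_le_mul_left _ hupp
      have := Nat.mul_le_mul_left (8 * q * (C * n ^ c)) h2
      simp only [ht]
      omega
    rw [hS]
    exact_mod_cast h1
  have hfin := one_div_lt_one_div_of_lt (by positivity) hT
  have heq : 1 / (q * S) / 2 * (1 / (4 * (q : ℝ) ^ (k + 1))) = 1 / (8 * q * S * q ^ (k + 1)) := by
    field_simp
    norm_num
  rw [heq] at hge
  exact absurd (hge.trans hinv) (not_le.2 hfin)

theorem isHardCore_trace {m : ℕ → ℕ} {D : ℕ} (hm : ∀ n, n ≤ m n ∧ m n ≤ D * n)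
    (hard : ∀ t : ℕ → ℝ, IsPoly t → IsHard q m t) {s : ℕ → ℝ} (hs : IsPoly s) :
    IsHardCore q m (fun n M => Matrix.trace (M : Matrix (Fin n) (Fin n) (ZMod q))) s := by
  refine ⟨polyTimeComputable_trace, fun A hA => ?_⟩
  -- The useful shift may vary with `n`, while a program is fixed. As there are only `q` shifts, the
  -- bounds for all of them hold simultaneously for large `n`.
  have hall := Filter.eventually_all.2 fun u => eventually_shift_lt hm hard hs hA u
  filter_upwards [hall, Filter.eventually_ge_atTop 1] with n hn hn1
  by_contra! hlt
  have hpred : predictProb q m (fun n M => Matrix.trace (M : Matrix (Fin n) (Fin n) (ZMod q))) A n =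
      𝔼 p : (Fin (m n) → Fin n → ZMod q) × GL (Fin n) (ZMod q), answer A 0 (instanceOf p.1 p.2)
        (p.2 : Matrix (Fin n) (Fin n) (ZMod q)).trace := by
    refine Finset.expect_congr rfl fun p _ => ?_
    simp only [answer, add_zero]
  rw [hpred] at hlt
  obtain ⟨u, hu⟩ := exists_shift (P := fun u =>
    𝔼 p : (Fin (m n) → Fin n → ZMod q) × GL (Fin n) (ZMod q), answer A u (instanceOf p.1 p.2)
      (p.2 : Matrix (Fin n) (Fin n) (ZMod q)).trace) (by
    rw [← Finset.expect_sum_comm]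
    rw [Finset.expect_congr rfl fun p _ => sum_answer_shift (hA n hn1 p.1 p.2) _]
    exact Finset.expect_const Finset.univ_nonempty _) hlt (one_div_pos.2 (hs.1 n hn1))
  exact absurd hu (not_le.2 (hn u))

end

end TraceHC

theorem theorem3 (q : ℕ) [Fact q.Prime] (ε : ℝ) (hε : 0 < ε) (m : ℕ → ℕ)
    (hm : ∀ n : ℕ, m n = ⌊(1 + ε) * (n : ℝ)⌋₊ ∨ m n = ⌈(1 + ε) * (n : ℝ)⌉₊)
    (hard : ∀ t : ℕ → ℝ, TraceHC.IsPoly t → TraceHC.IsHard q m t) :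
    ∀ s : ℕ → ℝ, TraceHC.IsPoly s →
      TraceHC.IsHardCore q m
        (fun n M => Matrix.trace (M : Matrix (Fin n) (Fin n) (ZMod q))) s :=
  fun _ hs => TraceHC.isHardCore_trace (TraceHC.bounds_of_round hε hm) hard hs
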